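/- Let $d\ge 1$ and let $X=\mathbb R^d$, or $d=1$ and $X=\mathbb R_+=[0,\infty)$. A weight on $X$ is a locally integrable function on $X$ that is positive almost everywhere. For $m\in\mathbb N_0$, $1\le p<\infty$ and a family $w=(w_i)$ of weights indexed by multi-indices $i\in\mathbb N_0^d$, $|i|\le m$, put $$\|u\|_{W^{m,p}_w}=\Big(\sum_{|j|\le m}\int_X|D^ju|^p\,w_j\,dx\Big)^{1/p},$$ and let $W^{m,p}_w=W^{m,p}_w(X)$ be the completion, realised as a space of locally integrable functions with locally integrable weak derivatives up to order $m$, of the set of $\varphi\in C_0^\infty(X)$ (smooth on $X$, vanishing at infinity) with $\|\varphi\|_{W^{m,p}_w}<\infty$. Write $A_R=\{x\in X: R\le|x|\le 2R\}$. For weight families $w,w'$, a function $w_c$, an order $m\in\mathbb N_0$, $p\ge 1$ and $\rho>1$ consider, for all multi-indices $|i|\le m$, the following conditions. (A1) There is $c>0$, independent of $i$, with $w_i(x)\ge c$ for all $x\in X$, and $w_i$ is bounded on every ball. (A2) There is $K>0$ such that $w_i(x)/w_i'(x)$ is monotonically decreasing with respect to $|x|$ on $\{|x|\ge K\}$, and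 $w_i(x)/w'_i(x)\to 0$ as $|x|\to\infty$. (A3) $\displaystyle\limsup_{R\to\infty}R^{|i|-\frac dp}\,\sup_{A_R}|g|\,\Big(\int_{A_R}w_i^{-\frac1{\rho-1}}\,dx\Big)^{\frac{\rho-1}{p\rho}}<\infty$, both for $g=w_c$ and for $g=1$. (A4) $\displaystyle\limsup_{R\to\infty}R^{|i|-\frac dp}\,\sup_{A_R}|g|\,\sup_{A_R}\Big(\frac1{w_i}\Big)^{\frac1p}<\infty$, both for $g=w_c$ and for $g=1$. (A5) $w_i\in L^\infty_{loc}(X)$ and $w_i^{-1/(\rho-1)}\in L^1_{loc}(X)$. The following statements hold. 1. Let $s,l\in\mathbb N_0$, $1\le p,q<\infty$, let (A1) hold for $w$ with $m=s$ and (A2) for $w,w'$ with $m=l$. If either $0<d-(s-l)p<d$ and $\frac1p-\frac sd<\frac1q-\frac ld$, or $d=(s-l)p$, then the embedding $$W^{s,p}_w\cap W^{l,q}_{w'}\hookrightarrow W^{l,q}_w$$ is well defined, continuous and compact (the intersection carries the sum of the two norms). 2. Let $p\ge1$, $s,r\in\mathbb N_0$, and let $w_c$ be a weight that is bounded on every ball.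 Let $V$ be - $C^r(X)\cap C_b(X)$ if $p=1$ and $s-r\ge d$; - $C^{r,\eta}(X)\cap C_b(X)$ if $s-r\ge\frac dp\ge s-r-1$ and $0<\eta<s-r-\frac dp$; - $C^{r,1}(X)\cap C_b(X)$ if $p=1$ and $d=s-r-1$; with the norms $\sum_{k\le r}\sup_X|D^ku|$, plus the global Hölder seminorm of $D^ru$ in the last two cases. Let $C_{w_c}(X)$ be the space of continuous $u$ with $\|w_cu\|_\infty=\sup_X|w_cu|<\infty$. The conditions below are taken with $m=s$. (a) If (A3) and (A5) hold with the same $\rho>1$ and $w_i(0)=0$ for some $i$, then $W^{s,p\rho}_w\hookrightarrow V\cap C_{w_c}(X)$ continuously. (b) If (A1) and (A4) hold, then $W^{s,p}_w\hookrightarrow V\cap C_{w_c}(X)$ continuously. In particular, in both cases $\|w_cu\|_\infty\le C\|u\|$ with $C$ independent of $u$. -/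

import Mathlib

open MeasureTheory Filter Topology Set
open scoped ENNReal NNReal ContDiff

noncomputable section

/-- Euclidean space `ℝ^d`. -/
abbrev Euc (d : ℕ) : Type := EuclideanSpace ℝ (Fin d)

/-- Multi-indices of dimension `d`. -/
abbrev MIdx (d : ℕ) : Type := Fin d → ℕ

/-- The length `|i|` of a multi-index. -/
def mlen {d : ℕ} (i : MIdx d) : ℕ := ∑ k, i k

/-- The finite set of multi-indices `i` with `|i| ≤ m`. -/
def midxLE (d m : ℕ) : Finset (MIdx d) :=
  (Fintype.piFinset fun _ : Fin d => Finset.range (m + 1)).filter fun i => mlen i ≤ m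

/-- The classical partial derivative in the `k`-th coordinate direction. -/
def partialD {d : ℕ} (k : Fin d) (f : Euc d → ℝ) : Euc d → ℝ :=
  fun x => fderiv ℝ f x (EuclideanSpace.single k 1)

/-- The classical derivative `D^i f = ∂₁^{i₁} ⋯ ∂_d^{i_d} f`. -/
def multiD {d : ℕ} (i : MIdx d) (f : Euc d → ℝ) : Euc d → ℝ :=
  (List.finRange d).foldr (fun k g => (partialD k)^[i k] g) f

/-- `v` is the `i`-th weak derivative of `u` in the interior of `X`. -/
def IsWeakDeriv {d : ℕ} (X : Set (Euc d)) (i : MIdx d) (u v : Euc d → ℝ) : Prop :=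
  LocallyIntegrableOn u (interior X) ∧ LocallyIntegrableOn v (interior X) ∧
    ∀ φ : Euc d → ℝ, ContDiff ℝ ∞ φ → HasCompactSupport φ → tsupport φ ⊆ interior X →
      ∫ x in X, u x * multiD i φ x = (-1 : ℝ) ^ mlen i * ∫ x in X, v x * φ x

open Classical in
/-- The weak derivative `D^i u` (unique up to null sets; `0` if there is none). -/
def weakD {d : ℕ} (X : Set (Euc d)) (i : MIdx d) (u : Euc d → ℝ) : Euc d → ℝ :=
  if h : ∃ v, IsWeakDeriv X i u v then Classical.choose h else 0

/-- `(∑_{|j| ≤ m} ∫_X |v_j|^p w_j dx)^{1/p}` for a family `v = (v_j)`. -/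
def jetNorm {d : ℕ} (X : Set (Euc d)) (m : ℕ) (p : ℝ) (w v : MIdx d → Euc d → ℝ) : ℝ≥0∞ :=
  (∑ j ∈ midxLE d m, ∫⁻ x in X, ‖v j x‖ₑ ^ p * ENNReal.ofReal (w j x)) ^ (1 / p)

/-- The norm of `W^{m,p}_w(X)`. -/
def sobolevNorm {d : ℕ} (X : Set (Euc d)) (m : ℕ) (p : ℝ) (w : MIdx d → Euc d → ℝ)
    (u : Euc d → ℝ) : ℝ≥0∞ :=
  jetNorm X m p w fun j => weakD X j u

/-- `φ ∈ C_0^∞(X)`: smooth (up to the boundary of `X`) and vanishing at infinity. -/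
def SmoothVanishing {d : ℕ} (X : Set (Euc d)) (φ : Euc d → ℝ) : Prop :=
  ContDiff ℝ ∞ φ ∧ Tendsto φ (cocompact (Euc d) ⊓ 𝓟 X) (𝓝 0)

/-- `u ∈ W^{m,p}_w(X)`: `u` is a limit, in the weighted Sobolev norm, of functions in `C_0^∞(X)`
of finite norm. This is the completion of those functions, realised in the space of locally
integrable functions with weak derivatives. -/
def MemSobolev {d : ℕ} (X : Set (Euc d)) (m : ℕ) (p : ℝ) (w : MIdx d → Euc d → ℝ)
    (u : Euc d → ℝ) : Prop :=
  (∀ j : MIdx d, mlen j ≤ m → ∃ v, IsWeakDeriv X j u v) ∧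
    ∀ ε : ℝ≥0∞, 0 < ε → ∃ φ : Euc d → ℝ, SmoothVanishing X φ ∧
      jetNorm X m p w (fun j => multiD j φ) < ⊤ ∧
      jetNorm X m p w (fun j x => multiD j φ x - weakD X j u x) < ε

/-- A weight function on `X`: locally integrable and positive almost everywhere. -/
def IsWeight {d : ℕ} (X : Set (Euc d)) (w : Euc d → ℝ) : Prop :=
  LocallyIntegrableOn w X ∧ ∀ᵐ x ∂(volume.restrict X), 0 < w x

/-- `f` is bounded on the part of every ball that lies in `X`. -/
def BddOnBalls {d : ℕ} (X : Set (Euc d)) (f : Euc d → ℝ) : Prop :=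
  ∀ R : ℝ, ∃ C : ℝ, ∀ x ∈ X, ‖x‖ < R → |f x| ≤ C

/-- The weights `w_i`, `|i| ≤ m`, have a common positive lower bound and are bounded on balls. -/
def LowerBddLocBdd {d : ℕ} (X : Set (Euc d)) (m : ℕ) (w : MIdx d → Euc d → ℝ) : Prop :=
  (∃ c : ℝ, 0 < c ∧ ∀ i : MIdx d, mlen i ≤ m → ∀ x ∈ X, c ≤ w i x) ∧
    ∀ i : MIdx d, mlen i ≤ m → BddOnBalls X (w i)

/-- Outside some ball `w_i / w'_i`, `|i| ≤ m`, is decreasing with respect to `|x|`, and it tends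
to `0` at infinity. -/
def RatioDecreasesToZero {d : ℕ} (X : Set (Euc d)) (m : ℕ) (w w' : MIdx d → Euc d → ℝ) : Prop :=
  ∃ K : ℝ, 0 < K ∧ ∀ i : MIdx d, mlen i ≤ m →
    (∀ x ∈ X, ∀ y ∈ X, K ≤ ‖x‖ → ‖x‖ ≤ ‖y‖ → w i y / w' i y ≤ w i x / w' i x) ∧
      Tendsto (fun x => w i x / w' i x) (cocompact (Euc d) ⊓ 𝓟 X) (𝓝 0)

/-- The annulus `{x ∈ X : R ≤ |x| ≤ 2R}`. -/
def annulus {d : ℕ} (X : Set (Euc d)) (R : ℝ) : Set (Euc d) :=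
  {x | x ∈ X ∧ R ≤ ‖x‖ ∧ ‖x‖ ≤ 2 * R}

/-- `R^{|i|-d/p} · sup_{A_R} |g| · (∫_{A_R} w_i^{-1/(ρ-1)} dx)^{(ρ-1)/(pρ)}` stays bounded as
`R → ∞`, for every `|i| ≤ m`. -/
def AnnulusIntegralCond {d : ℕ} (X : Set (Euc d)) (m : ℕ) (p ρ : ℝ) (g : Euc d → ℝ)
    (w : MIdx d → Euc d → ℝ) : Prop :=
  ∀ i : MIdx d, mlen i ≤ m →
    limsup (fun R : ℝ => ENNReal.ofReal (R ^ ((mlen i : ℝ) - d / p)) *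
      (⨆ x ∈ annulus X R, ‖g x‖ₑ) *
      (∫⁻ x in annulus X R, ENNReal.ofReal (w i x) ^ (-(1 / (ρ - 1)))) ^ ((ρ - 1) / (p * ρ)))
      atTop < ⊤

/-- `R^{|i|-d/p} · sup_{A_R} |g| · sup_{A_R} (1/w_i)^{1/p}` stays bounded as `R → ∞`, for every
`|i| ≤ m`. -/
def AnnulusSupCond {d : ℕ} (X : Set (Euc d)) (m : ℕ) (p : ℝ) (g : Euc d → ℝ)
    (w : MIdx d → Euc d → ℝ) : Prop :=
  ∀ i : MIdx d, mlen i ≤ m →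
    limsup (fun R : ℝ => ENNReal.ofReal (R ^ ((mlen i : ℝ) - d / p)) *
      (⨆ x ∈ annulus X R, ‖g x‖ₑ) *
      ⨆ x ∈ annulus X R, (ENNReal.ofReal (w i x))⁻¹ ^ (1 / p))
      atTop < ⊤

/-- `w_i ∈ L^∞_loc(X)` and `w_i ∈ 𝓑_ρ(X)`, that is `w_i^{-1/(ρ-1)} ∈ L^1_loc(X)`, for `|i| ≤ m`. -/
def LocBddAndB {d : ℕ} (X : Set (Euc d)) (m : ℕ) (ρ : ℝ) (w : MIdx d → Euc d → ℝ) : Prop :=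
  ∀ i : MIdx d, mlen i ≤ m →
    (∀ R : ℝ, ∃ M : ℝ, ∀ᵐ x ∂(volume.restrict (X ∩ Metric.ball 0 R)), |w i x| ≤ M) ∧
      LocallyIntegrableOn (fun x => w i x ^ (-(1 / (ρ - 1)))) X

/-- The norm `∑_{k ≤ r} sup_X |D^k f|` of bounded `C^r` functions on `X`. -/
def crNorm {d : ℕ} (X : Set (Euc d)) (r : ℕ) (f : Euc d → ℝ) : ℝ≥0∞ :=
  ∑ k ∈ Finset.range (r + 1), ⨆ x ∈ X, ‖iteratedFDerivWithin ℝ k f X x‖ₑ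

/-- The Hölder seminorm with exponent `η` of `D^r f` on `X`. -/
def holderSeminorm {d : ℕ} (X : Set (Euc d)) (r : ℕ) (η : ℝ) (f : Euc d → ℝ) : ℝ≥0∞ :=
  ⨆ x ∈ X, ⨆ y ∈ X, ⨆ _ : x ≠ y,
    ‖iteratedFDerivWithin ℝ r f X x - iteratedFDerivWithin ℝ r f X y‖ₑ / ‖x - y‖ₑ ^ η

/-- The weighted supremum `sup_X |g f|`. -/
def weightedSup {d : ℕ} (X : Set (Euc d)) (g f : Euc d → ℝ) : ℝ≥0∞ :=
  ⨆ x ∈ X, ‖g x * f x‖ₑ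

/-- `W^{m,P}_w(X)` embeds continuously into the space of `C^r` functions on `X` for which the
norm `N` is finite: every element has a `C^r` representative, with `N` bounded by the Sobolev
norm. -/
def EmbedsInCr {d : ℕ} (X : Set (Euc d)) (m : ℕ) (P : ℝ) (w : MIdx d → Euc d → ℝ) (r : ℕ)
    (N : (Euc d → ℝ) → ℝ≥0∞) : Prop :=
  ∃ C : ℝ≥0, ∀ u, MemSobolev X m P w u → ∃ f : Euc d → ℝ,
    f =ᵐ[volume.restrict X] u ∧ ContDiffOn ℝ r f X ∧ N f ≤ C * sobolevNorm X m P w u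

/-- The continuous embedding of `W^{s,P}_w(X)` into `V ∩ C_{w_c}(X)`, where `V` is, depending on
`p`, `s`, `r` and `d`, one of `C^r ∩ C_b`, `C^{r,η} ∩ C_b` and `C^{r,1} ∩ C_b`. -/
def EmbedsInTarget {d : ℕ} (X : Set (Euc d)) (s r : ℕ) (p P : ℝ) (w : MIdx d → Euc d → ℝ)
    (wc : Euc d → ℝ) : Prop :=
  (p = 1 → (d : ℝ) ≤ (s : ℝ) - r →
    EmbedsInCr X s P w r fun f => crNorm X r f + weightedSup X wc f) ∧
  (∀ η : ℝ, (d : ℝ) / p ≤ (s : ℝ) - r → (s : ℝ) - r - 1 ≤ d / p → 0 < η →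
    η < (s : ℝ) - r - d / p →
    EmbedsInCr X s P w r fun f => crNorm X r f + holderSeminorm X r η f + weightedSup X wc f) ∧
  (p = 1 → (d : ℝ) = (s : ℝ) - r - 1 →
    EmbedsInCr X s P w r fun f => crNorm X r f + holderSeminorm X r 1 f + weightedSup X wc f)

/-- The embedding `W^{s,p}_w(X) ∩ W^{l,q}_{w'}(X) ↪ W^{l,q}_w(X)` is well defined, continuous and
compact, where the intersection carries the sum of the two norms. -/
def CompactlyEmbedsInter {d : ℕ} (X : Set (Euc d)) (s l : ℕ) (p q : ℝ)
    (w w' : MIdx d → Euc d → ℝ) : Prop :=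
  (∀ u, MemSobolev X s p w u → MemSobolev X l q w' u → MemSobolev X l q w u) ∧
  (∃ C : ℝ≥0, ∀ u, MemSobolev X s p w u → MemSobolev X l q w' u →
    sobolevNorm X l q w u ≤ C * (sobolevNorm X s p w u + sobolevNorm X l q w' u)) ∧
  ∀ (u : ℕ → Euc d → ℝ) (M : ℝ≥0),
    (∀ n, MemSobolev X s p w (u n) ∧ MemSobolev X l q w' (u n) ∧
      sobolevNorm X s p w (u n) + sobolevNorm X l q w' (u n) ≤ M) →
    ∃ (σ : ℕ → ℕ) (v : Euc d → ℝ), StrictMono σ ∧ MemSobolev X l q w v ∧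
      Tendsto (fun n => sobolevNorm X l q w fun x => u (σ n) x - v x) atTop (𝓝 0)

end

/-! Everything rests on Sobolev inequalities on cubes in which the side δ enters explicitly. On a
convex cell Q, |g(x) - g(y)| is at most |x - y| times the integral of |∇g| along the segment from x
to y. Averaging over y in Q and substituting z = x + t(y - x) gives `poincare_cell` when d(1/p -
1/q) < 1 and `morrey_cell` when p > d. Induction on the number of derivatives gives `lpD_le_lpDSum`
(from L^p to L^q) and `enorm_cell_le_lpDSum` (from L^p to the supremum, k > d/p). The endpoint p =
1, k = d comes instead from the fundamental theorem of calculus in each coordinate,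
`enorm_corner_le_lpDSum`.

Embeddings into spaces of C^r functions. On a cube with lowest corner a and side δ ≥ 1, the scaled
inequality bounds |D^m φ(a)| by the sum of δ^(i - d/p) ‖D^i φ‖_p over m ≤ i ≤ m + k. For distant a
one takes δ comparable to |a|: the cube then lies in an annulus A_R with R comparable to δ, and the
powers of R in (A3) and (A4) are exactly those needed. The weight is inserted by Hölder's inequality
in case (a) and by the supremum of 1/w_i in case (b). For a in a bounded set, unit cubes and the
local assumptions suffice. The outcome is the single hypothesis `ScaledBound`, produced by
`scaledBound_of_annulus`; it gives sup bounds and, via Morrey's inequality on small cubes, Hölder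
bounds. Applied to differences of smooth approximations these make all derivatives of order at most
r uniformly Cauchy on X, so the limit is a C^r representative (`MemSobolev.exists_contDiffOn`) and
the bounds pass to it (`ScaledBound.embedsInTarget`).

Compact embedding. Both alternatives reduce to s - l = k + 1 ≥ 1 and 1/p - 1/q < (k + 1)/d. As this
is strict, Poincaré's inequality on a grid leaves a positive power of the mesh: up to ε times the
Sobolev norm, derivatives of order at most l on a ball are controlled in L^q by finitely many cell
means (`LowerBddLocBdd.rellich_estimate`). The means of a bounded sequence stay in a product of
compact intervals, so a subsequence is Cauchy in L^q on every ball. Outside a large ball w is a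
small multiple of w' (`RatioDecreasesToZero.wLp_tail_le`), and the bound on the w' norm makes the
subsequence Cauchy for the w norm. Weights bounded below make the space complete
(`exists_sobolev_limit`).

That the intersection lies in the target space at all needs one approximation in the w norm. It is ψ
+ χ(φ - ψ) with a cutoff χ: the approximation φ in the first norm is used inside a ball, the
approximation ψ in the w' norm outside (`LocallyControls.exists_glued`). -/

/-! ### Multi-index derivatives versus iterated Fréchet derivatives. -/

/-- Iterated partial derivatives in the directions listed in `L`. -/
noncomputable def listD {d : ℕ} (L : List (Fin d)) (f : Euc d → ℝ) : Euc d → ℝ := L.foldr partialD f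

/-- The sorted list of directions of a multi-index. -/
def midxList {d : ℕ} (i : MIdx d) : List (Fin d) :=
  (List.finRange d).flatMap fun k => List.replicate (i k) k

section MultiIndex

variable {d : ℕ}

lemma listD_cons (a : Fin d) (L : List (Fin d)) (f : Euc d → ℝ) :
    listD (a :: L) f = partialD a (listD L f) := rfl

lemma contDiff_partialD {f : Euc d → ℝ} (hf : ContDiff ℝ ∞ f) (k : Fin d) :
    ContDiff ℝ ∞ (partialD k f) :=
  (hf.fderiv_right (m := ∞) (by simp)).clm_apply contDiff_const

lemma contDiff_listD {f : Euc d → ℝ} (hf : ContDiff ℝ ∞ f) (L : List (Fin d)) :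
    ContDiff ℝ ∞ (listD L f) := by
  induction L with
  | nil => exact hf
  | cons a L ih => exact contDiff_partialD ih a

lemma partialD_comm {f : Euc d → ℝ} (hf : ContDiff ℝ ∞ f) (a b : Fin d) :
    partialD a (partialD b f) = partialD b (partialD a f) := by
  have hd : Differentiable ℝ (fderiv ℝ f) :=
    (hf.fderiv_right (m := ∞) (by simp)).differentiable (by simp)
  have key : ∀ (a b : Fin d) (x : Euc d), partialD a (partialD b f) x =
      fderiv ℝ (fderiv ℝ f) x (EuclideanSpace.single a 1) (EuclideanSpace.single b 1) := by
    intro a b x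
    have : partialD b f = fun y => fderiv ℝ f y (EuclideanSpace.single b 1) := rfl
    rw [this]
    unfold partialD
    rw [fderiv_clm_apply (hd x) (by fun_prop)]
    simp
  ext x
  rw [key, key]
  have hs : IsSymmSndFDerivAt ℝ f x := hf.contDiffAt.isSymmSndFDerivAt
    (by rw [minSmoothness_of_isRCLikeNormedField]
        exact WithTop.coe_le_coe.2 (le_top : (2 : ℕ∞) ≤ ⊤))
  exact hs _ _

/-- Partial derivatives of smooth functions commute, so only the multiplicities of the directions
matter. This is what sorts an arbitrary tuple of directions into a multi-index. -/
lemma listD_perm {f : Euc d → ℝ} (hf : ContDiff ℝ ∞ f) {L L' : List (Fin d)} (h : L.Perm L') :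
    listD L f = listD L' f := by
  induction h with
  | nil => rfl
  | cons a _ ih => rw [listD_cons, listD_cons, ih]
  | swap a b L =>
    simp only [listD_cons]
    exact partialD_comm (contDiff_listD hf L) b a
  | trans _ _ ih1 ih2 => exact ih1.trans ih2

lemma iteratedFDeriv_single_eq_listD {f : Euc d → ℝ} (hf : ContDiff ℝ ∞ f) (n : ℕ)
    (κ : Fin n → Fin d) (x : Euc d) :
    iteratedFDeriv ℝ n f x (fun j => EuclideanSpace.single (κ j) (1 : ℝ)) =
      listD (List.ofFn κ) f x := by
  induction n generalizing x with
  | zero => simp [listD]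
  | succ n ih =>
    rw [iteratedFDeriv_succ_apply_left, List.ofFn_succ, listD_cons]
    have hd : DifferentiableAt ℝ (iteratedFDeriv ℝ n f) x :=
      (hf.differentiable_iteratedFDeriv (m := n) (by exact_mod_cast WithTop.coe_lt_top _)) x
    have h1 := fun y => ih (fun j => κ j.succ) y
    have h2 : listD (List.ofFn fun j : Fin n => κ j.succ) f =
        fun y => iteratedFDeriv ℝ n f y fun j => EuclideanSpace.single (κ j.succ) (1 : ℝ) :=
      (funext h1).symm
    rw [h2]
    unfold partialD
    rw [fderiv_continuousMultilinear_apply_const_apply hd]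
    rfl

lemma listD_append (L L' : List (Fin d)) (f : Euc d → ℝ) :
    listD (L ++ L') f = listD L (listD L' f) := List.foldr_append

lemma multiD_eq_listD (i : MIdx d) (f : Euc d → ℝ) : multiD i f = listD (midxList i) f := by
  unfold multiD midxList
  induction List.finRange d with
  | nil => rfl
  | cons a L ih =>
    rw [List.foldr_cons, ih, List.flatMap_cons, listD_append]
    generalize listD _ f = g
    induction i a generalizing g with
    | zero => rfl
    | succ n ihn => rw [Function.iterate_succ_apply', List.replicate_succ, listD_cons, ihn]

lemma length_midxList (i : MIdx d) : (midxList i).length = mlen i := by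
  simp [midxList, mlen, List.length_flatMap, Fin.sum_univ_def]

lemma count_midxList (i : MIdx d) (k : Fin d) : (midxList i).count k = i k := by
  rw [midxList, List.count_flatMap]
  have : (List.count k ∘ fun k => List.replicate (i k) k) = fun a => if a = k then i k else 0 := by
    ext a
    simp only [Function.comp, List.count_replicate, beq_iff_eq]
    split_ifs with h
    · rw [h]
    · rfl
  rw [this, ← Fin.sum_univ_def]
  simp

lemma contDiff_multiD {f : Euc d → ℝ} (hf : ContDiff ℝ ∞ f) (i : MIdx d) :
    ContDiff ℝ ∞ (multiD i f) := by
  rw [multiD_eq_listD]; exact contDiff_listD hf _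

lemma multiD_eq_iteratedFDeriv {f : Euc d → ℝ} (hf : ContDiff ℝ ∞ f) (i : MIdx d) (x : Euc d) :
    multiD i f x = iteratedFDeriv ℝ (midxList i).length f x
      (fun j => EuclideanSpace.single ((midxList i).get j) (1 : ℝ)) := by
  rw [iteratedFDeriv_single_eq_listD hf, multiD_eq_listD, List.ofFn_get]

lemma multiD_sub {f g : Euc d → ℝ} (hf : ContDiff ℝ ∞ f) (hg : ContDiff ℝ ∞ g) (i : MIdx d) :
    multiD i (fun x => f x - g x) = fun x => multiD i f x - multiD i g x := by
  ext x
  have h : (fun x => f x - g x) = f - g := rfl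
  rw [multiD_eq_iteratedFDeriv (hf.sub hg), multiD_eq_iteratedFDeriv hf, multiD_eq_iteratedFDeriv hg,
    h, iteratedFDeriv_sub_apply (hf.contDiffAt.of_le (by exact_mod_cast le_top))
      (hg.contDiffAt.of_le (by exact_mod_cast le_top))]
  rfl

lemma multiD_add {f g : Euc d → ℝ} (hf : ContDiff ℝ ∞ f) (hg : ContDiff ℝ ∞ g) (i : MIdx d) :
    multiD i (fun x => f x + g x) = fun x => multiD i f x + multiD i g x := by
  ext x
  have h : (fun x => f x + g x) = f + g := rfl
  rw [multiD_eq_iteratedFDeriv (hf.add hg), multiD_eq_iteratedFDeriv hf, multiD_eq_iteratedFDeriv hg,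
    h, iteratedFDeriv_add_apply (hf.contDiffAt.of_le (by exact_mod_cast le_top))
      (hg.contDiffAt.of_le (by exact_mod_cast le_top))]
  rfl

lemma abs_multiD_le {f : Euc d → ℝ} (hf : ContDiff ℝ ∞ f) (i : MIdx d) (x : Euc d) :
    ‖multiD i f x‖ ≤ ‖iteratedFDeriv ℝ (mlen i) f x‖ := by
  rw [multiD_eq_iteratedFDeriv hf, ← length_midxList]
  refine (ContinuousMultilinearMap.le_opNorm _ _).trans ?_
  simp

lemma mem_midxLE {m : ℕ} {i : MIdx d} : i ∈ midxLE d m ↔ mlen i ≤ m := by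
  simp only [midxLE, Finset.mem_filter, Fintype.mem_piFinset, Finset.mem_range,
    and_iff_right_iff_imp]
  intro h k
  exact Nat.lt_succ_of_le
    ((Finset.single_le_sum (fun _ _ => Nat.zero_le _) (Finset.mem_univ k)).trans h)

/-- Expanding each argument in the standard basis writes the n-linear form as a sum over d^n tuples
of directions; each tuple, once sorted, contributes one multi-index derivative of order exactly n.
-/
lemma norm_iteratedFDeriv_le_sum_multiD {f : Euc d → ℝ} (hf : ContDiff ℝ ∞ f) (n : ℕ)
    (x : Euc d) :
    ‖iteratedFDeriv ℝ n f x‖ ≤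
      (d : ℝ) ^ n * ∑ i ∈ (midxLE d n).filter (fun i => mlen i = n), ‖multiD i f x‖ := by
  set S := ∑ i ∈ (midxLE d n).filter (fun i => mlen i = n), ‖multiD i f x‖ with hS
  have hS0 : 0 ≤ S := Finset.sum_nonneg fun _ _ => norm_nonneg _
  have hκ : ∀ κ : Fin n → Fin d,
      ‖iteratedFDeriv ℝ n f x (fun j => EuclideanSpace.single (κ j) (1 : ℝ))‖ ≤ S := by
    intro κ
    rw [iteratedFDeriv_single_eq_listD hf]
    -- The multi-index counts how often each direction occurs in κ.
    set i : MIdx d := fun k => (List.ofFn κ).count k with hi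
    have hp : (List.ofFn κ).Perm (midxList i) := by
      rw [List.perm_iff_count]
      intro a
      rw [count_midxList]
    have hl : mlen i = n := by rw [← length_midxList, ← hp.length_eq, List.length_ofFn]
    rw [listD_perm hf hp, ← multiD_eq_listD]
    exact Finset.single_le_sum (f := fun i => ‖multiD i f x‖) (fun _ _ => norm_nonneg _)
      (Finset.mem_filter.2 ⟨mem_midxLE.2 hl.le, hl⟩)
  refine ContinuousMultilinearMap.opNorm_le_bound (by positivity) fun m => ?_
  have hm : ∀ j, m j = ∑ k, (m j k) • EuclideanSpace.single k (1 : ℝ) := by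
    intro j
    have := (EuclideanSpace.basisFun (Fin d) ℝ).sum_repr (m j)
    simpa using this.symm
  have hexp : iteratedFDeriv ℝ n f x m = ∑ κ : Fin n → Fin d,
      (∏ j, m j (κ j)) * iteratedFDeriv ℝ n f x (fun j => EuclideanSpace.single (κ j) (1 : ℝ)) := by
    conv_lhs => rw [show m = fun j => ∑ k, (m j k) • EuclideanSpace.single k (1 : ℝ) from funext hm]
    have := (iteratedFDeriv ℝ n f x).toMultilinearMap.map_sum
      (fun (j : Fin n) (k : Fin d) => (m j k) • EuclideanSpace.single k (1 : ℝ))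
    refine this.trans (Finset.sum_congr rfl fun κ _ => ?_)
    rw [MultilinearMap.map_smul_univ]
    rfl
  rw [hexp]
  refine (norm_sum_le _ _).trans ?_
  have : ∀ κ ∈ (Finset.univ : Finset (Fin n → Fin d)), ‖(∏ j, m j (κ j)) *
      iteratedFDeriv ℝ n f x (fun j => EuclideanSpace.single (κ j) (1 : ℝ))‖ ≤
      S * ∏ j, ‖m j‖ := by
    intro κ _
    rw [norm_mul, norm_prod, mul_comm]
    gcongr
    · exact hκ κ
    · exact PiLp.norm_apply_le _ _
  refine (Finset.sum_le_sum this).trans ?_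
  simp [mul_assoc]

end MultiIndex


/-! ### Averages along segments in convex cells. -/

/-- A convex set that looks like a cube of side `δ`. -/
structure IsCell {d : ℕ} (δ : ℝ) (Q : Set (Euc d)) : Prop where
  pos : 0 < δ
  meas : MeasurableSet Q
  convex : Convex ℝ Q
  vol : volume Q = ENNReal.ofReal δ ^ (d : ℝ)
  diam : ∀ x ∈ Q, ∀ y ∈ Q, ‖x - y‖ ≤ d * δ

/-- Hölder's inequality against the constant 1. It is used for Lebesgue measure on a cell and for a
weighted measure in the segment parameter t. -/
lemma lintegral_rpow_le_measure_univ_mul {α : Type*} [MeasurableSpace α] {ν : Measure α}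
    {f : α → ℝ≥0∞} (hf : AEMeasurable f ν) {q : ℝ} (hq : 1 ≤ q) :
    (∫⁻ a, f a ∂ν) ^ q ≤ ν univ ^ (q - 1) * ∫⁻ a, f a ^ q ∂ν := by
  have h := eLpNorm'_le_eLpNorm'_mul_rpow_measure_univ (μ := ν) (f := f) one_pos hq
    hf.aestronglyMeasurable
  simp only [eLpNorm', enorm_eq_self, ENNReal.rpow_one, div_one] at h
  have hq0 : 0 < q := by linarith
  calc (∫⁻ a, f a ∂ν) ^ q ≤ ((∫⁻ a, f a ^ q ∂ν) ^ (1 / q) * ν univ ^ (1 - 1 / q)) ^ q := by gcongr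
    _ = _ := by
      rw [ENNReal.mul_rpow_of_nonneg _ _ hq0.le, ← ENNReal.rpow_mul, ← ENNReal.rpow_mul,
        one_div_mul_cancel hq0.ne', ENNReal.rpow_one, mul_comm, sub_mul, one_div_mul_cancel hq0.ne',
        one_mul]

/-- The homothety with centre x and ratio t has Jacobian t^d and, by convexity, maps Q into itself.
-/
lemma setLIntegral_comp_homothety_le {d : ℕ} {Q : Set (Euc d)} (hQ : MeasurableSet Q)
    (hc : Convex ℝ Q) {x : Euc d} (hx : x ∈ Q) {t : ℝ} (ht : 0 < t) (ht1 : t ≤ 1)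
    (H : Euc d → ℝ≥0∞) :
    ∫⁻ y in Q, H (x + t • (y - x)) ≤ ENNReal.ofReal t ^ (-(d : ℝ)) * ∫⁻ y in Q, H y := by
  have hder : ∀ y ∈ Q, HasFDerivWithinAt (fun y : Euc d => x + t • (y - x))
      (t • ContinuousLinearMap.id ℝ (Euc d)) Q y := by
    intro y _
    exact (((hasFDerivWithinAt_id y Q).sub_const x).const_smul t).const_add x
  have hinj : InjOn (fun y : Euc d => x + t • (y - x)) Q := by
    intro a _ b _ h
    simpa [ht.ne'] using h
  have h := lintegral_image_eq_lintegral_abs_det_fderiv_mul volume hQ hder hinj H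
  have hdet : |(t • ContinuousLinearMap.id ℝ (Euc d)).det| = t ^ d := by
    rw [ContinuousLinearMap.det, ContinuousLinearMap.toLinearMap_smul, LinearMap.det_smul]
    simp [abs_of_pos ht]
  rw [hdet, lintegral_const_mul' _ _ ENNReal.ofReal_ne_top] at h
  have himg : (fun y : Euc d => x + t • (y - x)) '' Q ⊆ Q := by
    rintro _ ⟨y, hy, rfl⟩
    exact hc.add_smul_sub_mem hx hy ⟨ht.le, ht1⟩
  have h1 : ENNReal.ofReal (t ^ d) * ∫⁻ y in Q, H (x + t • (y - x)) ≤ ∫⁻ y in Q, H y :=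
    h ▸ lintegral_mono_set himg
  have e : ENNReal.ofReal (t ^ d) = ENNReal.ofReal t ^ (d : ℝ) := by
    rw [ENNReal.rpow_natCast, ENNReal.ofReal_pow ht.le]
  rw [e] at h1
  rw [ENNReal.rpow_neg, ← ENNReal.div_eq_inv_mul, ENNReal.le_div_iff_mul_le, mul_comm]
  · exact h1
  · left; simp [ht]
  · left; simp

lemma setLIntegral_Ioc_rpow_lt_top {a : ℝ} (ha : -1 < a) :
    ∫⁻ t in Ioc (0 : ℝ) 1, ENNReal.ofReal t ^ a < ⊤ := by
  have h := (intervalIntegral.intervalIntegrable_rpow' (a := 0) (b := 1) ha).1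
  have h2 := h.lintegral_lt_top
  refine lt_of_eq_of_lt (setLIntegral_congr_fun measurableSet_Ioc fun t ht => ?_) h2
  simp only [ENNReal.ofReal_rpow_of_pos ht.1]

section Averages

variable {d : ℕ} {Q : Set (Euc d)}

/-- The average (times the volume of `Q`) of `H` over the points `x + t (y - x)`, `y ∈ Q`. -/
noncomputable def segAvg (Q : Set (Euc d)) (H : Euc d → ℝ≥0∞) (t : ℝ) (x : Euc d) : ℝ≥0∞ :=
  ∫⁻ y in Q, H (x + t • (y - x))

lemma measurable_segAvg_uncurry (Q : Set (Euc d)) {H : Euc d → ℝ≥0∞} (hH : Measurable H) :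
    Measurable fun z : Euc d × ℝ => segAvg Q H z.2 z.1 := by
  unfold segAvg
  refine Measurable.lintegral_prod_right' (f := fun z : (Euc d × ℝ) × Euc d =>
    H (z.1.1 + z.1.2 • (z.2 - z.1.1))) (hH.comp ?_)
  exact Continuous.measurable (by fun_prop)

/-- Hölder's inequality followed by the homothety substitution. The bound holds at every point of Q
but blows up like t^(-d) as t tends to 0. -/
lemma segAvg_rpow_le (hQ : MeasurableSet Q) (hc : Convex ℝ Q) {H : Euc d → ℝ≥0∞}
    (hH : Measurable H) {p : ℝ} (hp : 1 ≤ p) {x : Euc d} (hx : x ∈ Q) {t : ℝ} (ht : 0 < t)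
    (ht1 : t ≤ 1) :
    segAvg Q H t x ^ p ≤
      volume Q ^ (p - 1) * (ENNReal.ofReal t ^ (-(d : ℝ)) * ∫⁻ y in Q, H y ^ p) := by
  have hm : Measurable fun y => H (x + t • (y - x)) :=
    hH.comp (Continuous.measurable (by fun_prop))
  refine (lintegral_rpow_le_measure_univ_mul hm.aemeasurable hp).trans ?_
  rw [Measure.restrict_apply_univ]
  gcongr
  exact setLIntegral_comp_homothety_le hQ hc hx ht ht1 (fun y => H y ^ p)

/-- After integration in x as well there is no blow-up at t = 0. For t ≥ 1/2 the substitution is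
made in y; for t < 1/2 the roles are exchanged, the same map being a homothety in x with centre y
and ratio 1 - t > 1/2. Either Jacobian costs at most 2^d. -/
lemma lintegral_segAvg_rpow_le (hQ : MeasurableSet Q) (hc : Convex ℝ Q) {H : Euc d → ℝ≥0∞}
    (hH : Measurable H) {p : ℝ} (hp : 1 ≤ p) {t : ℝ} (ht : 0 < t) (ht1 : t ≤ 1) :
    ∫⁻ x in Q, segAvg Q H t x ^ p ≤
      volume Q ^ (p - 1) * (volume Q * (2 ^ (d : ℝ) * ∫⁻ y in Q, H y ^ p)) := by
  have hm : Measurable fun z : Euc d × Euc d => H (z.1 + t • (z.2 - z.1)) ^ p :=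
    (hH.comp (Continuous.measurable (by fun_prop))).pow_const _
  have hbd : ∀ {s : ℝ}, 1 / 2 ≤ s → ENNReal.ofReal s ^ (-(d : ℝ)) ≤ 2 ^ (d : ℝ) := by
    intro s hs
    rw [ENNReal.rpow_neg, ← ENNReal.inv_rpow]
    refine ENNReal.rpow_le_rpow ?_ (by positivity)
    rw [ENNReal.inv_le_iff_inv_le]
    calc (2 : ℝ≥0∞)⁻¹ = ENNReal.ofReal (1 / 2) := by
          rw [one_div, ENNReal.ofReal_inv_of_pos (by norm_num)]; simp
      _ ≤ _ := ENNReal.ofReal_le_ofReal hs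
  have hcst : ∀ c : ℝ≥0∞, ∫⁻ _ in Q, c = volume Q * c := by
    intro c; rw [setLIntegral_const, mul_comm]
  calc ∫⁻ x in Q, segAvg Q H t x ^ p
      ≤ ∫⁻ x in Q, volume Q ^ (p - 1) * ∫⁻ y in Q, H (x + t • (y - x)) ^ p := by
        refine lintegral_mono fun x => ?_
        have hm : Measurable fun y => H (x + t • (y - x)) :=
          hH.comp (Continuous.measurable (by fun_prop))
        refine (lintegral_rpow_le_measure_univ_mul hm.aemeasurable hp).trans ?_
        rw [Measure.restrict_apply_univ]
    _ = volume Q ^ (p - 1) * ∫⁻ x in Q, ∫⁻ y in Q, H (x + t • (y - x)) ^ p := by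
        rw [lintegral_const_mul]
        exact Measurable.lintegral_prod_right' hm
    _ ≤ _ := by
        gcongr
        rw [← hcst]
        by_cases h : 1 / 2 ≤ t
        · refine setLIntegral_mono measurable_const fun x hx => ?_
          refine (setLIntegral_comp_homothety_le hQ hc hx ht ht1 fun y => H y ^ p).trans ?_
          gcongr
          exact hbd h
        · rw [lintegral_lintegral_swap hm.aemeasurable]
          refine setLIntegral_mono measurable_const fun y hy => ?_
          have e : ∀ x : Euc d, x + t • (y - x) = y + (1 - t) • (x - y) := by
            intro x; module
          simp only [e]
          refine (setLIntegral_comp_homothety_le hQ hc hy (by linarith) (by linarith)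
            fun y => H y ^ p).trans ?_
          gcongr
          exact hbd (by linarith)

/-- Interpolation between the two preceding bounds: of the q powers of the average, q - p are
estimated pointwise and p in the mean, so only t^(-d(q-p)/p) is lost. -/
lemma lintegral_segAvg_rpow_le_of_le (hQ : MeasurableSet Q) (hc : Convex ℝ Q)
    {H : Euc d → ℝ≥0∞} (hH : Measurable H) {p q : ℝ} (hp : 1 ≤ p) (hpq : p ≤ q) {t : ℝ}
    (ht : 0 < t) (ht1 : t ≤ 1) :
    ∫⁻ x in Q, segAvg Q H t x ^ q ≤ ENNReal.ofReal t ^ (-(d : ℝ) * ((q - p) / p)) *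
      (2 ^ (d : ℝ) * volume Q ^ (q - q / p + 1) * (∫⁻ y in Q, H y ^ p) ^ (q / p)) := by
  set A := ∫⁻ y in Q, H y ^ p with hA
  have hp0 : 0 < p := by linarith
  have hκ : 0 ≤ (q - p) / p := div_nonneg (by linarith) hp0.le
  have hmS : Measurable fun x => segAvg Q H t x :=
    (measurable_segAvg_uncurry Q hH).comp (measurable_id.prodMk measurable_const)
  calc ∫⁻ x in Q, segAvg Q H t x ^ q
      ≤ ∫⁻ x in Q, (volume Q ^ (p - 1) * (ENNReal.ofReal t ^ (-(d : ℝ)) * A)) ^ ((q - p) / p) *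
          segAvg Q H t x ^ p := by
        refine setLIntegral_mono ((hmS.pow_const _).const_mul _) fun x hx => ?_
        have : segAvg Q H t x ^ q = (segAvg Q H t x ^ p) ^ ((q - p) / p) * segAvg Q H t x ^ p := by
          rw [← ENNReal.rpow_mul, ← ENNReal.rpow_add_of_nonneg _ _ (by positivity) hp0.le]
          congr 1; field_simp; ring
        rw [this]
        gcongr
        exact segAvg_rpow_le hQ hc hH hp hx ht ht1
    _ = (volume Q ^ (p - 1) * (ENNReal.ofReal t ^ (-(d : ℝ)) * A)) ^ ((q - p) / p) *
          ∫⁻ x in Q, segAvg Q H t x ^ p := by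
        rw [lintegral_const_mul _ (hmS.pow_const _)]
    _ ≤ (volume Q ^ (p - 1) * (ENNReal.ofReal t ^ (-(d : ℝ)) * A)) ^ ((q - p) / p) *
          (volume Q ^ (p - 1) * (volume Q * (2 ^ (d : ℝ) * A))) := by
        gcongr
        exact lintegral_segAvg_rpow_le hQ hc hH hp ht ht1
    _ = _ := by
        rw [ENNReal.mul_rpow_of_nonneg _ _ hκ, ENNReal.mul_rpow_of_nonneg _ _ hκ,
          ← ENNReal.rpow_mul, ← ENNReal.rpow_mul]
        have e1 : A ^ (q / p) = A ^ ((q - p) / p) * A := by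
          conv_rhs => rw [← ENNReal.rpow_one A, ← ENNReal.rpow_mul, one_mul]
          rw [← ENNReal.rpow_add_of_nonneg _ _ hκ (by positivity)]
          congr 1; field_simp; ring
        have e2 : volume Q ^ (q - q / p + 1) =
            volume Q ^ ((p - 1) * ((q - p) / p)) * (volume Q ^ (p - 1) * volume Q) := by
          have h0 : 0 ≤ p - 1 := by linarith
          have h3 : volume Q ^ (p - 1) * volume Q = volume Q ^ p := by
            nth_rw 2 [← ENNReal.rpow_one (volume Q)]
            rw [← ENNReal.rpow_add_of_nonneg _ _ h0 zero_le_one]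
            congr 1; ring
          rw [h3, ← ENNReal.rpow_add_of_nonneg _ _ (by positivity) hp0.le]
          congr 1; field_simp; ring
        rw [e1, e2]
        ring

/-- Integrating the previous bound directly in t would ask for too much. Hölder's inequality in t is
applied with respect to the measure t^(-b) dt on (0, 1] instead, with b adapted to the exponents. -/
lemma lintegral_lintegral_segAvg_rpow_le (d : ℕ) {p q : ℝ} (hp : 1 ≤ p) (hpq : p ≤ q)
    (hd : d * (1 / p - 1 / q) < 1) :
    ∃ C : ℝ≥0∞, C ≠ ⊤ ∧ ∀ (Q : Set (Euc d)), MeasurableSet Q → Convex ℝ Q →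
      ∀ H : Euc d → ℝ≥0∞, Measurable H →
      ∫⁻ x in Q, (∫⁻ t in Ioc (0 : ℝ) 1, segAvg Q H t x) ^ q ≤
        C * volume Q ^ (q - q / p + 1) * (∫⁻ y in Q, H y ^ p) ^ (q / p) := by
  have hp0 : 0 < p := by linarith
  have hq0 : 0 < q := by linarith
  have hq1 : 1 ≤ q := by linarith
  -- The condition b < 1 makes the measure t^(-b) dt finite, the second condition makes the
  -- remaining power of t integrable. At b = 1 the second one is exactly d(1/p - 1/q) < 1, so any b
  -- slightly below 1 works.
  obtain ⟨b, hb1, hb2⟩ : ∃ b : ℝ, b < 1 ∧ -1 < b * (q - 1) - d * ((q - p) / p) := by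
    have h1 : d * ((q - p) / p) < q := by
      have : d * (1 / p - 1 / q) * q < 1 * q := by gcongr
      calc d * ((q - p) / p) = d * (1 / p - 1 / q) * q := by field_simp
        _ < _ := by simpa using this
    set m := q - d * ((q - p) / p) with hm
    have hm0 : 0 < m := by linarith
    refine ⟨1 - m / (2 * q), by have : 0 < m / (2 * q) := by positivity
                                linarith, ?_⟩
    have h2 : m / (2 * q) * (q - 1) < m := by
      rw [div_mul_eq_mul_div, div_lt_iff₀ (by positivity)]
      nlinarith
    have : d * ((q - p) / p) = q - m := by rw [hm]; ring
    rw [this]; nlinarith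
  set ν : Measure ℝ := (volume.restrict (Ioc (0 : ℝ) 1)).withDensity
    (fun t => ENNReal.ofReal t ^ (-b)) with hν
  have hmd : Measurable fun t : ℝ => ENNReal.ofReal t ^ (-b) :=
    ENNReal.measurable_ofReal.pow_const _
  have hνu : ν univ < ⊤ := by
    rw [hν, withDensity_apply _ MeasurableSet.univ, Measure.restrict_univ]
    exact setLIntegral_Ioc_rpow_lt_top (by linarith)
  set I := ∫⁻ t in Ioc (0 : ℝ) 1, ENNReal.ofReal t ^ (b * (q - 1) - d * ((q - p) / p)) with hI
  have hIt : I < ⊤ := setLIntegral_Ioc_rpow_lt_top hb2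
  refine ⟨ν univ ^ (q - 1) * (I * 2 ^ (d : ℝ)), ?_, ?_⟩
  · refine ENNReal.mul_ne_top (ENNReal.rpow_ne_top_of_nonneg (by linarith) hνu.ne)
      (ENNReal.mul_ne_top hIt.ne (ENNReal.rpow_ne_top_of_nonneg (by positivity) (by simp)))
  intro Q hQ hc H hH
  have hmS := measurable_segAvg_uncurry Q hH
  have hmSx : ∀ x, Measurable fun t => segAvg Q H t x := fun x =>
    hmS.comp (measurable_const.prodMk measurable_id)
  have hmT : ∀ x, Measurable fun t => ENNReal.ofReal t ^ b * segAvg Q H t x := fun x =>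
    (ENNReal.measurable_ofReal.pow_const _).mul (hmSx x)
  have step : ∀ x, (∫⁻ t in Ioc (0 : ℝ) 1, segAvg Q H t x) ^ q ≤
      ν univ ^ (q - 1) * ∫⁻ t in Ioc (0 : ℝ) 1,
        ENNReal.ofReal t ^ (b * (q - 1)) * segAvg Q H t x ^ q := by
    intro x
    have e1 : ∫⁻ t in Ioc (0 : ℝ) 1, segAvg Q H t x =
        ∫⁻ t, ENNReal.ofReal t ^ b * segAvg Q H t x ∂ν := by
      rw [hν, lintegral_withDensity_eq_lintegral_mul _ hmd
        (hmT x)]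
      refine setLIntegral_congr_fun measurableSet_Ioc fun t ht => ?_
      simp only [Pi.mul_apply]
      rw [← mul_assoc, ← ENNReal.rpow_add _ _ (by simpa using ht.1) (by simp)]
      simp
    rw [e1]
    refine (lintegral_rpow_le_measure_univ_mul
      (hmT x).aemeasurable hq1).trans ?_
    refine mul_le_mul_right ?_ _
    rw [hν, lintegral_withDensity_eq_lintegral_mul _ hmd ((hmT x).pow_const _)]
    refine (setLIntegral_congr_fun measurableSet_Ioc fun t ht => ?_).le
    simp only [Pi.mul_apply]
    rw [ENNReal.mul_rpow_of_nonneg _ _ hq0.le, ← mul_assoc, ← ENNReal.rpow_mul,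
      ← ENNReal.rpow_add _ _ (by simpa using ht.1) (by simp)]
    congr 2; ring
  have hmj : Measurable fun z : Euc d × ℝ =>
      ENNReal.ofReal z.2 ^ (b * (q - 1)) * segAvg Q H z.2 z.1 ^ q :=
    ((ENNReal.measurable_ofReal.comp measurable_snd).pow_const _).mul (hmS.pow_const _)
  calc ∫⁻ x in Q, (∫⁻ t in Ioc (0 : ℝ) 1, segAvg Q H t x) ^ q
      ≤ ∫⁻ x in Q, ν univ ^ (q - 1) * ∫⁻ t in Ioc (0 : ℝ) 1,
        ENNReal.ofReal t ^ (b * (q - 1)) * segAvg Q H t x ^ q := lintegral_mono step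
    _ = ν univ ^ (q - 1) * ∫⁻ t in Ioc (0 : ℝ) 1, ∫⁻ x in Q,
        ENNReal.ofReal t ^ (b * (q - 1)) * segAvg Q H t x ^ q := by
        rw [lintegral_const_mul _ (Measurable.lintegral_prod_right' hmj),
          lintegral_lintegral_swap hmj.aemeasurable]
    _ ≤ ν univ ^ (q - 1) * ∫⁻ t in Ioc (0 : ℝ) 1,
        ENNReal.ofReal t ^ (b * (q - 1) - d * ((q - p) / p)) *
        (2 ^ (d : ℝ) * volume Q ^ (q - q / p + 1) * (∫⁻ y in Q, H y ^ p) ^ (q / p)) := by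
        refine mul_le_mul_right ?_ _
        refine setLIntegral_mono
          ((ENNReal.measurable_ofReal.pow_const _).mul measurable_const) fun t ht => ?_
        rw [lintegral_const_mul]
        swap
        · exact (hmS.comp (measurable_id.prodMk measurable_const)).pow_const _
        refine (mul_le_mul_right (lintegral_segAvg_rpow_le_of_le hQ hc hH hp hpq ht.1 ht.2)
          _).trans ?_
        rw [← mul_assoc, ← ENNReal.rpow_add _ _ (by simpa using ht.1) (by simp)]
        refine le_of_eq ?_
        congr 2; ring
    _ = _ := by
        rw [lintegral_mul_const _ (ENNReal.measurable_ofReal.pow_const _), ← hI]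
        ring

/-- For p > d the pointwise bound can be integrated directly: its p-th root behaves like t^(-d/p)
with d/p < 1. -/
lemma lintegral_segAvg_le (d : ℕ) {p : ℝ} (hp : 1 ≤ p) (hd : (d : ℝ) < p) :
    ∃ C : ℝ≥0∞, C ≠ ⊤ ∧ ∀ (Q : Set (Euc d)), MeasurableSet Q → Convex ℝ Q →
      ∀ H : Euc d → ℝ≥0∞, Measurable H → ∀ x ∈ Q,
      ∫⁻ t in Ioc (0 : ℝ) 1, segAvg Q H t x ≤
        C * volume Q ^ (1 - 1 / p) * (∫⁻ y in Q, H y ^ p) ^ (1 / p) := by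
  have hp0 : 0 < p := by linarith
  have hI : ∫⁻ t in Ioc (0 : ℝ) 1, ENNReal.ofReal t ^ (-(d : ℝ) / p) < ⊤ :=
    setLIntegral_Ioc_rpow_lt_top (by rw [lt_div_iff₀ hp0]; linarith)
  refine ⟨_, hI.ne, fun Q hQ hc H hH x hx => ?_⟩
  rw [mul_assoc, ← lintegral_mul_const _ (ENNReal.measurable_ofReal.pow_const _)]
  refine setLIntegral_mono ((ENNReal.measurable_ofReal.pow_const _).mul measurable_const)
    fun t ht => ?_
  have h := segAvg_rpow_le hQ hc hH hp hx ht.1 ht.2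
  have h2 := ENNReal.rpow_le_rpow h (z := 1 / p) (by positivity)
  rw [← ENNReal.rpow_mul, mul_one_div_cancel hp0.ne', ENNReal.rpow_one] at h2
  refine h2.trans (le_of_eq ?_)
  rw [ENNReal.mul_rpow_of_nonneg _ _ (by positivity), ENNReal.mul_rpow_of_nonneg _ _ (by positivity),
    ← ENNReal.rpow_mul, ← ENNReal.rpow_mul]
  have e1 : (p - 1) * (1 / p) = 1 - 1 / p := by field_simp
  have e2 : -(d : ℝ) * (1 / p) = -(d : ℝ) / p := by ring
  rw [e1, e2]; ring

end Averages

/-! ### Poincaré–Sobolev and Morrey inequalities on cells. -/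

section Poincare

variable {d : ℕ} {F : Type*} [NormedAddCommGroup F] [NormedSpace ℝ F]

lemma enorm_sub_le_lintegral_segment [CompleteSpace F] {g : Euc d → F} (hg : ContDiff ℝ 1 g) (x y : Euc d) :
    ‖g x - g y‖ₑ ≤
      ‖x - y‖ₑ * ∫⁻ t in Ioc (0 : ℝ) 1, ‖fderiv ℝ g (x + t • (y - x))‖ₑ := by
  have hc : Continuous fun t : ℝ => fderiv ℝ g (x + t • (y - x)) (y - x) :=
    ((hg.continuous_fderiv (by simp)).comp (by fun_prop)).clm_apply continuous_const
  have hd : ∀ t ∈ uIcc (0 : ℝ) 1, HasDerivAt (fun t : ℝ => g (x + t • (y - x)))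
      (fderiv ℝ g (x + t • (y - x)) (y - x)) t := by
    intro t _
    have h1 : HasDerivAt (fun t : ℝ => x + t • (y - x)) (y - x) t := by
      simpa using ((hasDerivAt_id t).smul_const (y - x)).const_add x
    exact ((hg.differentiable (by simp)) (x + t • (y - x))).hasFDerivAt.comp_hasDerivAt t h1
  have h := intervalIntegral.integral_eq_sub_of_hasDerivAt hd (hc.intervalIntegrable 0 1)
  have e : g y - g x = ∫ t in Ioc (0 : ℝ) 1, fderiv ℝ g (x + t • (y - x)) (y - x) := by
    rw [← intervalIntegral.integral_of_le zero_le_one, h]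
    simp
  rw [← enorm_neg, neg_sub, e]
  refine (enorm_integral_le_lintegral_enorm _).trans ?_
  rw [← lintegral_const_mul']
  · refine lintegral_mono fun t => ?_
    refine (ContinuousLinearMap.le_opENorm _ _).trans ?_
    rw [← enorm_neg (y - x), neg_sub, mul_comm]
  · simp

lemma measurable_enorm_fderiv_of_contDiff {g : Euc d → F} (hg : ContDiff ℝ 1 g) :
    Measurable fun z => ‖fderiv ℝ g z‖ₑ :=
  ((hg.continuous_fderiv (by simp)).enorm).measurable

lemma setLIntegral_enorm_sub_le [CompleteSpace F] {δ : ℝ} {Q : Set (Euc d)} (hQ : IsCell δ Q) {g : Euc d → F}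
    (hg : ContDiff ℝ 1 g) {x : Euc d} (hx : x ∈ Q) :
    ∫⁻ y in Q, ‖g x - g y‖ₑ ≤ d * ENNReal.ofReal δ *
      ∫⁻ t in Ioc (0 : ℝ) 1, segAvg Q (fun z => ‖fderiv ℝ g z‖ₑ) t x := by
  have hm : Measurable fun z : Euc d × ℝ => ‖fderiv ℝ g (x + z.2 • (z.1 - x))‖ₑ :=
    (measurable_enorm_fderiv_of_contDiff hg).comp (Continuous.measurable (by fun_prop))
  calc ∫⁻ y in Q, ‖g x - g y‖ₑ
      ≤ ∫⁻ y in Q, d * ENNReal.ofReal δ *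
          ∫⁻ t in Ioc (0 : ℝ) 1, ‖fderiv ℝ g (x + t • (y - x))‖ₑ := by
        refine setLIntegral_mono ((Measurable.lintegral_prod_right' hm).const_mul _) fun y hy => ?_
        refine (enorm_sub_le_lintegral_segment hg x y).trans ?_
        gcongr
        rw [← ofReal_norm, ← ENNReal.ofReal_natCast, ← ENNReal.ofReal_mul (by positivity)]
        exact ENNReal.ofReal_le_ofReal (hQ.diam x hx y hy)
    _ = _ := by
        rw [lintegral_const_mul _ (Measurable.lintegral_prod_right' hm),
          lintegral_lintegral_swap hm.aemeasurable]
        rfl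

lemma IsCell.vol_rpow {δ : ℝ} {Q : Set (Euc d)} (hQ : IsCell δ Q) (a : ℝ) :
    volume Q ^ a = ENNReal.ofReal δ ^ (d * a) := by
  rw [hQ.vol, ENNReal.rpow_mul]

/-- A Poincaré–Sobolev inequality on cells. -/
lemma poincare_cell (d : ℕ) {p q : ℝ} (hp : 1 ≤ p) (hpq : p ≤ q) (hd : d * (1 / p - 1 / q) < 1)
    (F : Type*) [NormedAddCommGroup F] [NormedSpace ℝ F] [CompleteSpace F] :
    ∃ C : ℝ≥0∞, C ≠ ⊤ ∧ ∀ (δ : ℝ) (Q : Set (Euc d)), IsCell δ Q → ∀ g : Euc d → F,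
      ContDiff ℝ 1 g →
      (∫⁻ x in Q, (∫⁻ y in Q, ‖g x - g y‖ₑ) ^ q) ^ (1 / q) ≤
        C * ENNReal.ofReal δ ^ (1 + d * (1 - 1 / p + 1 / q)) *
          eLpNorm' (fderiv ℝ g) p (volume.restrict Q) := by
  have hp0 : 0 < p := by linarith
  have hq0 : 0 < q := by linarith
  obtain ⟨C, hC, h⟩ := lintegral_lintegral_segAvg_rpow_le d hp hpq hd
  refine ⟨d * C ^ (1 / q), ENNReal.mul_ne_top (by simp)
    (ENNReal.rpow_ne_top_of_nonneg (by positivity) hC), fun δ Q hQ g hg => ?_⟩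
  have hmH := measurable_enorm_fderiv_of_contDiff hg
  have hδ0 : ENNReal.ofReal δ ≠ 0 := by simpa using hQ.pos
  have h1 : ∫⁻ x in Q, (∫⁻ y in Q, ‖g x - g y‖ₑ) ^ q ≤ (d * ENNReal.ofReal δ) ^ q *
      (C * volume Q ^ (q - q / p + 1) * (∫⁻ y in Q, ‖fderiv ℝ g y‖ₑ ^ p) ^ (q / p)) := by
    refine le_trans ?_ (mul_le_mul_right (h Q hQ.meas hQ.convex _ hmH) _)
    have hmS : Measurable fun x => ∫⁻ t in Ioc (0 : ℝ) 1, segAvg Q (fun z => ‖fderiv ℝ g z‖ₑ) t x :=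
      Measurable.lintegral_prod_right' (measurable_segAvg_uncurry Q hmH)
    rw [← lintegral_const_mul _ (hmS.pow_const _)]
    refine setLIntegral_mono ((hmS.pow_const _).const_mul _) fun x hx => ?_
    rw [← ENNReal.mul_rpow_of_nonneg _ _ hq0.le]
    gcongr
    exact setLIntegral_enorm_sub_le hQ hg hx
  have h2 := ENNReal.rpow_le_rpow h1 (z := 1 / q) (by positivity)
  refine h2.trans (le_of_eq ?_)
  have hq' : (0 : ℝ) ≤ 1 / q := by positivity
  rw [ENNReal.mul_rpow_of_nonneg _ _ hq', ENNReal.mul_rpow_of_nonneg _ _ hq',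
    ENNReal.mul_rpow_of_nonneg _ _ hq', ← ENNReal.rpow_mul, mul_one_div_cancel hq0.ne',
    ENNReal.rpow_one, ← ENNReal.rpow_mul, ← ENNReal.rpow_mul, hQ.vol_rpow,
    ENNReal.rpow_add _ _ hδ0 (by simp), ENNReal.rpow_one, eLpNorm']
  have e1 : (q - q / p + 1) * (1 / q) = 1 - 1 / p + 1 / q := by field_simp
  have e2 : q / p * (1 / q) = 1 / p := by field_simp
  rw [e1, e2]; ring

/-- The supremum version of the Poincaré–Sobolev inequality on cells. -/
lemma morrey_cell (d : ℕ) {p : ℝ} (hp : 1 ≤ p) (hd : (d : ℝ) < p)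
    (F : Type*) [NormedAddCommGroup F] [NormedSpace ℝ F] [CompleteSpace F] :
    ∃ C : ℝ≥0∞, C ≠ ⊤ ∧ ∀ (δ : ℝ) (Q : Set (Euc d)), IsCell δ Q → ∀ g : Euc d → F,
      ContDiff ℝ 1 g → ∀ x ∈ Q,
      ∫⁻ y in Q, ‖g x - g y‖ₑ ≤ C * ENNReal.ofReal δ ^ (1 + d * (1 - 1 / p)) *
          eLpNorm' (fderiv ℝ g) p (volume.restrict Q) := by
  obtain ⟨C, hC, h⟩ := lintegral_segAvg_le d hp hd
  refine ⟨d * C, ENNReal.mul_ne_top (by simp) hC, fun δ Q hQ g hg x hx => ?_⟩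
  have hδ0 : ENNReal.ofReal δ ≠ 0 := by simpa using hQ.pos
  refine (setLIntegral_enorm_sub_le hQ hg hx).trans ?_
  refine (mul_le_mul_right
    (h Q hQ.meas hQ.convex _ (measurable_enorm_fderiv_of_contDiff hg) x hx) _).trans (le_of_eq ?_)
  rw [hQ.vol_rpow, ENNReal.rpow_add _ _ hδ0 (by simp), ENNReal.rpow_one, eLpNorm']
  ring

end Poincare


/-! ### Cubes and grid cells as cells. -/

section Cells

variable {d : ℕ}

lemma norm_le_card_mul {x : Euc d} {c : ℝ} (h : ∀ k, |x k| ≤ c) : ‖x‖ ≤ d * c := by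
  have hx : x = ∑ k, (x k) • EuclideanSpace.single k (1 : ℝ) := by
    have := (EuclideanSpace.basisFun (Fin d) ℝ).sum_repr x
    simpa using this.symm
  rw [hx]
  refine (norm_sum_le _ _).trans ?_
  calc ∑ k, ‖(x k) • EuclideanSpace.single k (1 : ℝ)‖ ≤ ∑ _k : Fin d, c :=
        Finset.sum_le_sum fun k _ => by simpa [norm_smul] using h k
    _ = d * c := by simp

lemma isCell_of_intervals {δ : ℝ} (hδ : 0 < δ) {J : Fin d → Set ℝ}
    (hm : ∀ k, MeasurableSet (J k)) (hc : ∀ k, Convex ℝ (J k))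
    (hv : ∀ k, volume (J k) = ENNReal.ofReal δ) (hd : ∀ k, ∀ s ∈ J k, ∀ t ∈ J k, |s - t| ≤ δ) :
    IsCell δ {x : Euc d | ∀ k, x k ∈ J k} := by
  have he : {x : Euc d | ∀ k, x k ∈ J k} =
      (WithLp.ofLp : Euc d → Fin d → ℝ) ⁻¹' (univ.pi J) := by
    ext x; simp
  have hms : MeasurableSet (univ.pi J) := MeasurableSet.univ_pi hm
  refine ⟨hδ, ?_, ?_, ?_, ?_⟩
  · rw [he]; exact (PiLp.volume_preserving_ofLp (Fin d)).measurable hms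
  · intro x hx y hy a b ha hb hab k
    exact hc k (hx k) (hy k) ha hb hab
  · rw [he, (PiLp.volume_preserving_ofLp (Fin d)).measure_preimage hms.nullMeasurableSet,
      volume_pi, Measure.pi_pi]
    simp [hv]
  · intro x hx y hy
    exact norm_le_card_mul fun k => hd k _ (hx k) _ (hy k)

/-- The closed cube with lowest corner `a` and side `δ`. -/
def cube (a : Euc d) (δ : ℝ) : Set (Euc d) := {x | ∀ k, x k ∈ Icc (a k) (a k + δ)}

/-- The half-open cubes of the grid of mesh `δ`. -/
def gridCell (δ : ℝ) (z : Fin d → ℤ) : Set (Euc d) :=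
  {x | ∀ k, x k ∈ Ico (z k * δ) (z k * δ + δ)}

lemma isCell_cube (a : Euc d) {δ : ℝ} (hδ : 0 < δ) : IsCell δ (cube a δ) := by
  refine isCell_of_intervals hδ (fun _ => measurableSet_Icc) (fun _ => convex_Icc _ _)
    (fun k => by simp) fun k s hs t ht => ?_
  rw [abs_le]; constructor <;> linarith [hs.1, hs.2, ht.1, ht.2]

lemma isCell_gridCell {δ : ℝ} (hδ : 0 < δ) (z : Fin d → ℤ) : IsCell δ (gridCell (d := d) δ z) := by
  refine isCell_of_intervals hδ (fun _ => measurableSet_Ico) (fun _ => convex_Ico _ _)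
    (fun k => by simp) fun k s hs t ht => ?_
  rw [abs_le]; constructor <;> linarith [hs.1, hs.2, ht.1, ht.2]

lemma mem_gridCell_iff {δ : ℝ} (hδ : 0 < δ) {z : Fin d → ℤ} {x : Euc d} :
    x ∈ gridCell δ z ↔ z = fun k => ⌊x k / δ⌋ := by
  rw [funext_iff]
  refine forall_congr' fun k => ?_
  rw [eq_comm, Int.floor_eq_iff, le_div_iff₀ hδ, div_lt_iff₀ hδ, add_mul, one_mul]
  rfl

lemma IsCell.isBounded {δ : ℝ} {Q : Set (Euc d)} (hQ : IsCell δ Q) : Bornology.IsBounded Q := by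
  rw [Metric.isBounded_iff]
  exact ⟨d * δ, fun x hx y hy => by rw [dist_eq_norm]; exact hQ.diam x hx y hy⟩

lemma Continuous.integrableOn_of_isBounded {F : Type*} [NormedAddCommGroup F] {g : Euc d → F}
    (hg : Continuous g) {Q : Set (Euc d)} (hQ : Bornology.IsBounded Q) : IntegrableOn g Q :=
  (hg.locallyIntegrable.integrableOn_isCompact hQ.isCompact_closure).mono_set subset_closure

lemma IsCell.ofReal_ne_zero {δ : ℝ} {Q : Set (Euc d)} (hQ : IsCell δ Q) :
    ENNReal.ofReal δ ≠ 0 := by simpa using hQ.pos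

lemma IsCell.vol_ne_zero {δ : ℝ} {Q : Set (Euc d)} (hQ : IsCell δ Q) : volume Q ≠ 0 := by
  rw [hQ.vol]
  exact (ENNReal.rpow_pos (pos_iff_ne_zero.2 hQ.ofReal_ne_zero) ENNReal.ofReal_ne_top).ne'

lemma IsCell.vol_ne_top {δ : ℝ} {Q : Set (Euc d)} (hQ : IsCell δ Q) : volume Q ≠ ⊤ := by
  rw [hQ.vol]; exact ENNReal.rpow_ne_top_of_nonneg (by positivity) (by simp)

end Cells

/-! ### Scaled Sobolev inequalities of higher order. -/

section Sobolev

variable {d : ℕ}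

/-- The volume times g(x) is the integral of g(x) - g(y) over y in Q plus the integral of g. -/
lemma vol_mul_enorm_le {F : Type*} [NormedAddCommGroup F] [NormedSpace ℝ F] [CompleteSpace F]
    {δ : ℝ} {Q : Set (Euc d)} (hQ : IsCell δ Q) {g : Euc d → F} (hg : Continuous g) (x : Euc d) :
    volume Q * ‖g x‖ₑ ≤ (∫⁻ y in Q, ‖g x - g y‖ₑ) + ‖∫ y in Q, g y‖ₑ := by
  have hgi := hg.integrableOn_of_isBounded hQ.isBounded
  have hci : IntegrableOn (fun _ : Euc d => g x) Q :=
    continuous_const.integrableOn_of_isBounded hQ.isBounded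
  have e : ∫ y in Q, g x = (∫ y in Q, (g x - g y)) + ∫ y in Q, g y := by
    rw [integral_sub hci hgi]; simp
  have hv := hQ.vol_ne_top
  have e2 : volume Q * ‖g x‖ₑ = ‖∫ y in Q, g x‖ₑ := by
    rw [setIntegral_const, enorm_smul, measureReal_def, Real.enorm_of_nonneg (by positivity),
      ENNReal.ofReal_toReal hv]
  rw [e2, e]
  refine (enorm_add_le _ _).trans ?_
  gcongr
  exact enorm_integral_le_lintegral_enorm _

/-- A function is controlled in `L^q` on a cell by its gradient in `L^p` and its mean. -/
lemma eLpNorm'_cell_le_mean (d : ℕ) {p q : ℝ} (hp : 1 ≤ p) (hpq : p ≤ q)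
    (hd : d * (1 / p - 1 / q) < 1)
    (F : Type*) [NormedAddCommGroup F] [NormedSpace ℝ F] [CompleteSpace F] :
    ∃ C : ℝ≥0∞, C ≠ ⊤ ∧ ∀ (δ : ℝ) (Q : Set (Euc d)), IsCell δ Q → ∀ g : Euc d → F,
      ContDiff ℝ 1 g →
      eLpNorm' g q (volume.restrict Q) ≤
        C * ENNReal.ofReal δ ^ (1 + d * (1 / q - 1 / p)) *
          eLpNorm' (fderiv ℝ g) p (volume.restrict Q) +
        ENNReal.ofReal δ ^ (d * (1 / q - 1)) * ‖∫ y in Q, g y‖ₑ := by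
  have hq0 : 0 < q := by linarith
  obtain ⟨C, hC, h⟩ := poincare_cell d hp hpq hd F
  refine ⟨C, hC, fun δ Q hQ g hg => ?_⟩
  have hδ := hQ.ofReal_ne_zero
  set D := ENNReal.ofReal δ with hD
  have hDt : D ≠ ⊤ := by simp [hD]
  have hv0 := hQ.vol_ne_zero
  have hvt := hQ.vol_ne_top
  have hmeas : Measurable fun x => ∫⁻ y in Q, ‖g x - g y‖ₑ := by
    have : Measurable fun z : Euc d × Euc d => ‖g z.1 - g z.2‖ₑ :=
      (((hg.continuous.comp continuous_fst).sub (hg.continuous.comp continuous_snd)).enorm).measurable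
    exact Measurable.lintegral_prod_right' this
  have h1 : volume Q * eLpNorm' g q (volume.restrict Q) ≤
      (∫⁻ x in Q, (∫⁻ y in Q, ‖g x - g y‖ₑ) ^ q) ^ (1 / q) +
        volume Q ^ (1 / q) * ‖∫ y in Q, g y‖ₑ := by
    have e0 : volume Q * eLpNorm' g q (volume.restrict Q) =
        (∫⁻ x in Q, (volume Q * ‖g x‖ₑ) ^ q) ^ (1 / q) := by
      simp_rw [ENNReal.mul_rpow_of_nonneg _ _ hq0.le]
      rw [lintegral_const_mul _ (hg.continuous.enorm.measurable.pow_const _),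
        ENNReal.mul_rpow_of_nonneg _ _ (by positivity), ← ENNReal.rpow_mul,
        mul_one_div_cancel hq0.ne', ENNReal.rpow_one, eLpNorm']
    have e3 : volume Q ^ (1 / q) * ‖∫ y in Q, g y‖ₑ =
        (∫⁻ _ in Q, ‖∫ y in Q, g y‖ₑ ^ q) ^ (1 / q) := by
      rw [setLIntegral_const, ENNReal.mul_rpow_of_nonneg _ _ (by positivity), ← ENNReal.rpow_mul,
        mul_one_div_cancel hq0.ne', ENNReal.rpow_one, mul_comm]
    rw [e0, e3]
    refine le_trans ?_ (ENNReal.lintegral_Lp_add_le hmeas.aemeasurable aemeasurable_const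
      (by linarith))
    gcongr with x
    exact vol_mul_enorm_le hQ hg.continuous x
  rw [← ENNReal.mul_le_mul_iff_right hv0 hvt]
  refine h1.trans ((add_le_add_left (h δ Q hQ g hg) _).trans (le_of_eq ?_))
  have e1 : D ^ (1 + d * (1 - 1 / p + 1 / q)) = D ^ (d : ℝ) * D ^ (1 + d * (1 / q - 1 / p)) := by
    rw [← ENNReal.rpow_add _ _ hδ hDt]; congr 1; ring
  have e2 : D ^ (d * (1 / q)) = D ^ (d : ℝ) * D ^ (d * (1 / q - 1)) := by
    rw [← ENNReal.rpow_add _ _ hδ hDt]; congr 1; ring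
  rw [hQ.vol_rpow, hQ.vol, ← hD, e1, e2]
  ring

lemma eLpNorm'_restrict_le_of_le {α F : Type*} [MeasurableSpace α] [NormedAddCommGroup F]
    {μ : Measure α} {g : α → F} {p q : ℝ} (hp : 0 < p) (hpq : p ≤ q) {s : Set α}
    (hg : AEStronglyMeasurable g (μ.restrict s)) :
    eLpNorm' g p (μ.restrict s) ≤ eLpNorm' g q (μ.restrict s) * μ s ^ (1 / p - 1 / q) := by
  simpa using eLpNorm'_le_eLpNorm'_mul_rpow_measure_univ hp hpq hg

lemma enorm_integral_cell_le {F : Type*} [NormedAddCommGroup F] [NormedSpace ℝ F]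
    {δ : ℝ} {Q : Set (Euc d)} (hQ : IsCell δ Q) {g : Euc d → F} (hg : Continuous g) {p : ℝ}
    (hp : 1 ≤ p) :
    ‖∫ y in Q, g y‖ₑ ≤ ENNReal.ofReal δ ^ (d * (1 - 1 / p)) * eLpNorm' g p (volume.restrict Q) := by
  refine (enorm_integral_le_lintegral_enorm _).trans ?_
  have := eLpNorm'_restrict_le_of_le (μ := volume) (s := Q) one_pos hp
    hg.aestronglyMeasurable
  rw [hQ.vol_rpow] at this
  simp only [eLpNorm', ENNReal.rpow_one, div_one] at this ⊢
  rw [mul_comm]; exact this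

/-- The `L^p` norm on `Q` of the `m`-th derivative. -/
noncomputable def lpD (m : ℕ) (p : ℝ) (Q : Set (Euc d)) (f : Euc d → ℝ) : ℝ≥0∞ :=
  eLpNorm' (iteratedFDeriv ℝ m f) p (volume.restrict Q)

lemma eLpNorm'_fderiv_iteratedFDeriv (m : ℕ) (p : ℝ) (Q : Set (Euc d)) (f : Euc d → ℝ) :
    eLpNorm' (fderiv ℝ (iteratedFDeriv ℝ m f)) p (volume.restrict Q) = lpD (m + 1) p Q f := by
  unfold lpD eLpNorm'
  congr 2
  ext x
  rw [← ofReal_norm, norm_fderiv_iteratedFDeriv, ofReal_norm]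

lemma ContDiff.contDiff_one_iteratedFDeriv {f : Euc d → ℝ} (hf : ContDiff ℝ ∞ f) (m : ℕ) :
    ContDiff ℝ 1 (iteratedFDeriv ℝ m f) :=
  hf.iteratedFDeriv_right (m := 1) (i := m) (by exact_mod_cast le_top)

/-- The gain from one derivative. In `eLpNorm'_cell_le_mean` the mean is absorbed into the L^p norm
by Hölder's inequality, and the powers of δ combine to the scaling exponent d(1/q - 1/p). -/
lemma lpD_le_step (d : ℕ) {p q : ℝ} (hp : 1 ≤ p) (hpq : p ≤ q) (hd : d * (1 / p - 1 / q) < 1)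
    (m : ℕ) :
    ∃ C : ℝ≥0∞, C ≠ ⊤ ∧ ∀ (δ : ℝ) (Q : Set (Euc d)), IsCell δ Q → ∀ f : Euc d → ℝ,
      ContDiff ℝ ∞ f → lpD m q Q f ≤ C * ENNReal.ofReal δ ^ (d * (1 / q - 1 / p)) *
          (lpD m p Q f + ENNReal.ofReal δ * lpD (m + 1) p Q f) := by
  obtain ⟨C, hC, h⟩ := eLpNorm'_cell_le_mean d hp hpq hd (Euc d [×m]→L[ℝ] ℝ)
  refine ⟨C + 1, by simp [hC], fun δ Q hQ f hf => ?_⟩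
  have hδ := hQ.ofReal_ne_zero
  have h1 := h δ Q hQ _ (hf.contDiff_one_iteratedFDeriv m)
  rw [eLpNorm'_fderiv_iteratedFDeriv] at h1
  refine h1.trans ?_
  have h2 := enorm_integral_cell_le hQ (hf.contDiff_one_iteratedFDeriv m).continuous hp
  calc _ ≤ C * ENNReal.ofReal δ ^ (1 + d * (1 / q - 1 / p)) * lpD (m + 1) p Q f +
        ENNReal.ofReal δ ^ (d * (1 / q - 1)) *
          (ENNReal.ofReal δ ^ (d * (1 - 1 / p)) * lpD m p Q f) := by
        gcongr; exact h2
    _ = C * ENNReal.ofReal δ ^ (d * (1 / q - 1 / p)) * (ENNReal.ofReal δ * lpD (m + 1) p Q f) +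
        1 * ENNReal.ofReal δ ^ (d * (1 / q - 1 / p)) * lpD m p Q f := by
        have : (d : ℝ) * (1 / q - 1 / p) = d * (1 / q - 1) + d * (1 - 1 / p) := by ring
        rw [ENNReal.rpow_add _ _ hδ (by simp), ENNReal.rpow_one, this,
          ENNReal.rpow_add _ _ hδ (by simp)]
        ring
    _ ≤ (C + 1) * ENNReal.ofReal δ ^ (d * (1 / q - 1 / p)) *
          (ENNReal.ofReal δ * lpD (m + 1) p Q f) +
        (C + 1) * ENNReal.ofReal δ ^ (d * (1 / q - 1 / p)) * lpD m p Q f := by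
        gcongr
        · exact le_self_add
        · exact le_add_self
    _ = _ := by ring

/-- The scaled sum of the `L^p` norms of the derivatives of order `m`, …, `m + k`. -/
noncomputable def lpDSum (m k : ℕ) (p δ : ℝ) (Q : Set (Euc d)) (f : Euc d → ℝ) : ℝ≥0∞ :=
  ∑ j ∈ Finset.range (k + 1), ENNReal.ofReal δ ^ j * lpD (m + j) p Q f

lemma lpDSum_mono {m k k' : ℕ} (h : k ≤ k') (p δ : ℝ) (Q : Set (Euc d)) (f : Euc d → ℝ) :
    lpDSum m k p δ Q f ≤ lpDSum m k' p δ Q f :=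
  Finset.sum_le_sum_of_subset (Finset.range_mono (by omega))

lemma mul_lpDSum_succ_le (m k : ℕ) (p δ : ℝ) (Q : Set (Euc d)) (f : Euc d → ℝ) :
    ENNReal.ofReal δ * lpDSum (m + 1) k p δ Q f ≤ lpDSum m (k + 1) p δ Q f := by
  unfold lpDSum
  rw [Finset.sum_range_succ' _ (k + 1), Finset.mul_sum]
  refine le_trans (le_of_eq (Finset.sum_congr rfl fun j _ => ?_)) le_self_add
  rw [show m + (j + 1) = m + 1 + j by ring, pow_succ]; ring

/-- The subcritical Sobolev inequality of order `k` on cells. -/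
lemma lpD_le_lpDSum (d : ℕ) {θ : ℝ} (hθ : d * θ < 1) (k : ℕ) :
    ∀ {p q : ℝ}, 1 ≤ p → p ≤ q → 1 / p - 1 / q ≤ k * θ → ∀ m : ℕ,
    ∃ C : ℝ≥0∞, C ≠ ⊤ ∧ ∀ (δ : ℝ) (Q : Set (Euc d)), IsCell δ Q → ∀ f : Euc d → ℝ,
      ContDiff ℝ ∞ f → lpD m q Q f ≤ C * ENNReal.ofReal δ ^ (d * (1 / q - 1 / p)) *
          lpDSum m k p δ Q f := by
  induction k with
  | zero =>
    intro p q hp hpq h m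
    have hp0 : 0 < p := by linarith
    have hq0 : 0 < q := by linarith
    have e : p = q := by
      simp only [CharP.cast_eq_zero, zero_mul, sub_nonpos] at h
      exact le_antisymm hpq ((one_div_le_one_div hp0 hq0).1 h)
    subst e
    exact ⟨1, by simp, fun δ Q hQ f hf => by simp [lpDSum]⟩
  | succ k ih =>
    intro p q hp hpq h m
    have hp0 : 0 < p := by linarith
    have hq0 : 0 < q := by linarith
    -- Here θ is the decrease of the reciprocal exponent allowed per derivative. The first k
    -- derivatives reach p1 with 1/p1 = 1/p - kθ and the last one covers the remaining gap, at most
    -- θ. If k steps already suffice then p1 = q; if kθ ≤ 0 then p1 = p.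
    obtain ⟨p1, hp1, hp1q, h1, h2⟩ : ∃ p1, p ≤ p1 ∧ p1 ≤ q ∧ 1 / p - 1 / p1 ≤ k * θ ∧
        d * (1 / p1 - 1 / q) < 1 := by
      have hqi : 0 < 1 / q := by positivity
      have hqp : 1 / q ≤ 1 / p := one_div_le_one_div_of_le hp0 hpq
      push_cast at h
      by_cases hkθ : 1 / p - 1 / q ≤ k * θ
      · exact ⟨q, hpq, le_rfl, hkθ, by simp⟩
      · by_cases hk : (k : ℝ) * θ ≤ 0
        · refine ⟨p, le_rfl, hpq, ?_, ?_⟩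
          · rcases Nat.eq_zero_or_pos k with h0 | h0
            · simp [h0]
            · have hk0 : (1 : ℝ) ≤ k := by exact_mod_cast h0
              have : θ ≤ 0 := by
                by_contra hh
                push Not at hh
                nlinarith
              nlinarith
          · have : 1 / p - 1 / q ≤ θ := by linarith
            exact lt_of_le_of_lt (mul_le_mul_of_nonneg_left this (by positivity)) hθ
        · push Not at hkθ hk
          have hr : 0 < 1 / p - k * θ := by linarith
          refine ⟨1 / (1 / p - k * θ), ?_, ?_, ?_, ?_⟩
          · rw [le_div_iff₀ hr]
            have : p * (1 / p) = 1 := mul_one_div_cancel hp0.ne'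
            nlinarith
          · rw [div_le_iff₀ hr]
            have : q * (1 / q) = 1 := mul_one_div_cancel hq0.ne'
            nlinarith
          · rw [one_div_one_div]; linarith
          · rw [one_div_one_div]
            have : 1 / p - k * θ - 1 / q ≤ θ := by linarith
            exact lt_of_le_of_lt (mul_le_mul_of_nonneg_left this (by positivity)) hθ
    obtain ⟨C1, hC1, H1⟩ := lpD_le_step d (hp.trans hp1) hp1q h2 m
    obtain ⟨C2, hC2, H2⟩ := ih hp hp1 h1 m
    obtain ⟨C3, hC3, H3⟩ := ih hp hp1 h1 (m + 1)
    refine ⟨C1 * (C2 + C3), ENNReal.mul_ne_top hC1 (by simp [hC2, hC3]), fun δ Q hQ f hf => ?_⟩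
    set D := ENNReal.ofReal δ with hD
    have hδ : D ≠ 0 := hQ.ofReal_ne_zero
    calc lpD m q Q f ≤ C1 * D ^ (d * (1 / q - 1 / p1)) * (lpD m p1 Q f + D * lpD (m + 1) p1 Q f) :=
          H1 δ Q hQ f hf
      _ ≤ C1 * D ^ (d * (1 / q - 1 / p1)) *
          (C2 * D ^ (d * (1 / p1 - 1 / p)) * lpDSum m k p δ Q f +
            D * (C3 * D ^ (d * (1 / p1 - 1 / p)) * lpDSum (m + 1) k p δ Q f)) := by
          gcongr
          · exact H2 δ Q hQ f hf
          · exact H3 δ Q hQ f hf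
      _ = C1 * (D ^ (d * (1 / q - 1 / p1)) * D ^ (d * (1 / p1 - 1 / p))) *
          (C2 * lpDSum m k p δ Q f + C3 * (D * lpDSum (m + 1) k p δ Q f)) := by ring
      _ ≤ C1 * D ^ (d * (1 / q - 1 / p)) *
          (C2 * lpDSum m (k + 1) p δ Q f + C3 * lpDSum m (k + 1) p δ Q f) := by
          have e : D ^ (d * (1 / q - 1 / p1)) * D ^ (d * (1 / p1 - 1 / p)) =
              D ^ (d * (1 / q - 1 / p)) := by
            rw [← ENNReal.rpow_add _ _ hδ (by simp [hD])]; congr 1; ring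
          rw [e]
          refine mul_le_mul_right (add_le_add (mul_le_mul_right ?_ _) (mul_le_mul_right ?_ _)) _
          · exact lpDSum_mono (Nat.le_succ k) _ _ _ _
          · exact mul_lpDSum_succ_le _ _ _ _ _ _
      _ = _ := by ring

/-- Morrey's inequality on cells. -/
lemma enorm_sub_cell_le (d : ℕ) {p : ℝ} (hp : 1 ≤ p) (hd : (d : ℝ) < p) (m : ℕ) :
    ∃ C : ℝ≥0∞, C ≠ ⊤ ∧ ∀ (δ : ℝ) (Q : Set (Euc d)), IsCell δ Q → ∀ f : Euc d → ℝ,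
      ContDiff ℝ ∞ f → ∀ x ∈ Q, ∀ y ∈ Q, ‖iteratedFDeriv ℝ m f x - iteratedFDeriv ℝ m f y‖ₑ ≤
        C * ENNReal.ofReal δ ^ (1 - d / p) * lpD (m + 1) p Q f := by
  obtain ⟨C, hC, h⟩ := morrey_cell d hp hd (Euc d [×m]→L[ℝ] ℝ)
  refine ⟨2 * C, ENNReal.mul_ne_top (by simp) hC, fun δ Q hQ f hf x hx y hy => ?_⟩
  have hδ := hQ.ofReal_ne_zero
  set g := iteratedFDeriv ℝ m f with hg
  have hgc : ContDiff ℝ 1 g := hf.contDiff_one_iteratedFDeriv m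
  have hv0 := hQ.vol_ne_zero
  have hvt := hQ.vol_ne_top
  have hm : ∀ x, Measurable fun z => ‖g x - g z‖ₑ := fun x =>
    ((continuous_const.sub hgc.continuous).enorm).measurable
  have h1 : volume Q * ‖g x - g y‖ₑ ≤ (∫⁻ z in Q, ‖g x - g z‖ₑ) + ∫⁻ z in Q, ‖g y - g z‖ₑ := by
    rw [mul_comm, ← setLIntegral_const, ← lintegral_add_left (hm x)]
    refine lintegral_mono fun z => ?_
    have : g x - g y = (g x - g z) - (g y - g z) := by abel
    rw [this]; exact enorm_sub_le
  rw [← ENNReal.mul_le_mul_iff_right hv0 hvt]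
  refine h1.trans ((add_le_add (h δ Q hQ g hgc x hx) (h δ Q hQ g hgc y hy)).trans (le_of_eq ?_))
  rw [hg, eLpNorm'_fderiv_iteratedFDeriv, hQ.vol, ← two_mul, mul_comm C, mul_comm (2 * C),
    ← mul_assoc, ← mul_assoc, ← mul_assoc, ← mul_assoc, ← ENNReal.rpow_add _ _ hδ (by simp)]
  have : (d : ℝ) + (1 - d / p) = 1 + d * (1 - 1 / p) := by ring
  rw [this]; ring

/-- Morrey's inequality compares the value at x with the mean over Q, and the mean is bounded by the
L^p norm. -/
lemma enorm_cell_le_step (d : ℕ) {p : ℝ} (hp : 1 ≤ p) (hd : (d : ℝ) < p) (m : ℕ) :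
    ∃ C : ℝ≥0∞, C ≠ ⊤ ∧ ∀ (δ : ℝ) (Q : Set (Euc d)), IsCell δ Q → ∀ f : Euc d → ℝ,
      ContDiff ℝ ∞ f → ∀ x ∈ Q, ‖iteratedFDeriv ℝ m f x‖ₑ ≤
        C * ENNReal.ofReal δ ^ (-(d / p)) *
          (lpD m p Q f + ENNReal.ofReal δ * lpD (m + 1) p Q f) := by
  obtain ⟨C, hC, h⟩ := morrey_cell d hp hd (Euc d [×m]→L[ℝ] ℝ)
  refine ⟨C + 1, by simp [hC], fun δ Q hQ f hf x hx => ?_⟩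
  have hδ := hQ.ofReal_ne_zero
  set g := iteratedFDeriv ℝ m f with hg
  have hgc : ContDiff ℝ 1 g := hf.contDiff_one_iteratedFDeriv m
  have hv0 := hQ.vol_ne_zero
  have hvt := hQ.vol_ne_top
  have h1 := vol_mul_enorm_le hQ hgc.continuous x
  have h2 := enorm_integral_cell_le hQ hgc.continuous hp
  rw [← ENNReal.mul_le_mul_iff_right hv0 hvt]
  refine h1.trans ((add_le_add (h δ Q hQ g hgc x hx) h2).trans ?_)
  rw [hg, eLpNorm'_fderiv_iteratedFDeriv, hQ.vol]
  set D := ENNReal.ofReal δ with hD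
  have e : D ^ (d * (1 - 1 / p)) = D ^ (d : ℝ) * D ^ (-(d / p)) := by
    rw [← ENNReal.rpow_add _ _ hδ (by simp [hD])]; congr 1; ring
  rw [ENNReal.rpow_add _ _ hδ (by simp [hD]), ENNReal.rpow_one, e]
  calc _ = C * (D ^ (d : ℝ) * D ^ (-(d / p)) * (D * lpD (m + 1) p Q f)) +
        1 * (D ^ (d : ℝ) * D ^ (-(d / p)) * lpD m p Q f) := by rw [lpD, lpD]; ring
    _ ≤ (C + 1) * (D ^ (d : ℝ) * D ^ (-(d / p)) * (D * lpD (m + 1) p Q f)) +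
        (C + 1) * (D ^ (d : ℝ) * D ^ (-(d / p)) * lpD m p Q f) := by
        gcongr
        · exact le_self_add
        · exact le_add_self
    _ = _ := by ring

/-- The supremum bound for `k > d / p` on cells. -/
lemma enorm_cell_le_lpDSum (d : ℕ) {p : ℝ} (hp : 1 ≤ p) {k : ℕ} (hk : d / p < k) (m : ℕ) :
    ∃ C : ℝ≥0∞, C ≠ ⊤ ∧ ∀ (δ : ℝ) (Q : Set (Euc d)), IsCell δ Q → ∀ f : Euc d → ℝ,
      ContDiff ℝ ∞ f → ∀ x ∈ Q, ‖iteratedFDeriv ℝ m f x‖ₑ ≤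
        C * ENNReal.ofReal δ ^ (-(d / p)) * lpDSum m k p δ Q f := by
  have hp0 : 0 < p := by linarith
  obtain ⟨k, rfl⟩ : ∃ j, k = j + 1 := by
    refine Nat.exists_eq_succ_of_ne_zero ?_
    rintro rfl
    have : (0 : ℝ) ≤ d / p := by positivity
    simp at hk; linarith
  push_cast at hk
  -- With k + 1 derivatives available, p1 = (k + 1)p exceeds d and satisfies 1/p - 1/p1 = k/p1. So k
  -- derivatives with gain θ = 1/p1 lead from L^p to L^p1, and the last derivative gives the
  -- supremum by Morrey's inequality.
  set p1 := (k + 1) * p with hp1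
  have hk1 : (0 : ℝ) < k + 1 := by positivity
  have hpp1 : p ≤ p1 := by
    rw [hp1]; nlinarith [Nat.cast_nonneg (α := ℝ) k]
  have hdp1 : (d : ℝ) < p1 := by
    rwa [div_lt_iff₀ hp0] at hk
  have hθ : (d : ℝ) * (1 / p1) < 1 := by
    rw [mul_one_div, div_lt_one (by linarith)]; exact hdp1
  have hkθ : 1 / p - 1 / p1 ≤ k * (1 / p1) := by
    rw [hp1]; refine le_of_eq ?_; field_simp; ring
  obtain ⟨C1, hC1, H1⟩ := enorm_cell_le_step d (hp.trans hpp1) hdp1 m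
  obtain ⟨C2, hC2, H2⟩ := lpD_le_lpDSum d hθ k hp hpp1 hkθ m
  obtain ⟨C3, hC3, H3⟩ := lpD_le_lpDSum d hθ k hp hpp1 hkθ (m + 1)
  refine ⟨C1 * (C2 + C3), ENNReal.mul_ne_top hC1 (by simp [hC2, hC3]), fun δ Q hQ f hf x hx => ?_⟩
  set D := ENNReal.ofReal δ with hD
  have hδ : D ≠ 0 := hQ.ofReal_ne_zero
  calc _ ≤ C1 * D ^ (-(d / p1)) * (lpD m p1 Q f + D * lpD (m + 1) p1 Q f) :=
        H1 δ Q hQ f hf x hx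
    _ ≤ C1 * D ^ (-(d / p1)) *
        (C2 * D ^ (d * (1 / p1 - 1 / p)) * lpDSum m k p δ Q f +
          D * (C3 * D ^ (d * (1 / p1 - 1 / p)) * lpDSum (m + 1) k p δ Q f)) := by
        gcongr
        · exact H2 δ Q hQ f hf
        · exact H3 δ Q hQ f hf
    _ = C1 * (D ^ (-(d / p1)) * D ^ (d * (1 / p1 - 1 / p))) *
        (C2 * lpDSum m k p δ Q f + C3 * (D * lpDSum (m + 1) k p δ Q f)) := by ring
    _ ≤ C1 * D ^ (-(d / p)) *
        (C2 * lpDSum m (k + 1) p δ Q f + C3 * lpDSum m (k + 1) p δ Q f) := by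
        have e : D ^ (-(d / p1)) * D ^ (d * (1 / p1 - 1 / p)) = D ^ (-(d / p)) := by
          rw [← ENNReal.rpow_add _ _ hδ (by simp [hD])]; congr 1; ring
        rw [e]
        refine mul_le_mul_right (add_le_add (mul_le_mul_right ?_ _) (mul_le_mul_right ?_ _)) _
        · exact lpDSum_mono (Nat.le_succ k) _ _ _ _
        · exact mul_lpDSum_succ_le _ _ _ _ _ _
    _ = _ := by ring

end Sobolev


/-! ### The endpoint p = 1 with d derivatives. -/

section Corner

variable {d : ℕ}

/-- Write h(a) as h(t) minus the integral of h' from a to t, and average over t in an interval of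
length δ that starts at a. -/
lemma enorm_le_lintegral_Icc {F : Type*} [NormedAddCommGroup F] [NormedSpace ℝ F]
    [CompleteSpace F] {h h' : ℝ → F} (hd : ∀ t, HasDerivAt h (h' t) t) (hc : Continuous h')
    (a : ℝ) (δ : ℝ) :
    ENNReal.ofReal δ * ‖h a‖ₑ ≤
      ∫⁻ t in Icc a (a + δ), (‖h t‖ₑ + ENNReal.ofReal δ * ‖h' t‖ₑ) := by
  have hch : Continuous h := continuous_iff_continuousAt.2 fun t => (hd t).continuousAt
  set B := ∫⁻ t in Icc a (a + δ), ‖h' t‖ₑ with hB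
  have hpt : ∀ t ∈ Icc a (a + δ), ‖h a‖ₑ ≤ ‖h t‖ₑ + B := by
    intro t ht
    have e := intervalIntegral.integral_eq_sub_of_hasDerivAt (fun s _ => hd s)
      (hc.intervalIntegrable a t)
    have : h a = h t - ∫ s in a..t, h' s := by rw [e]; abel
    rw [this]
    refine enorm_sub_le.trans ?_
    gcongr
    rw [intervalIntegral.integral_of_le ht.1]
    refine (enorm_integral_le_lintegral_enorm _).trans ?_
    exact lintegral_mono_set fun s hs => ⟨hs.1.le, hs.2.trans ht.2⟩
  have hv : volume (Icc a (a + δ)) = ENNReal.ofReal δ := by simp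
  calc ENNReal.ofReal δ * ‖h a‖ₑ = ∫⁻ _ in Icc a (a + δ), ‖h a‖ₑ := by
        rw [setLIntegral_const, hv, mul_comm]
    _ ≤ ∫⁻ t in Icc a (a + δ), (‖h t‖ₑ + B) :=
        setLIntegral_mono (hch.enorm.measurable.add_const _) hpt
    _ = _ := by
        rw [lintegral_add_left hch.enorm.measurable, setLIntegral_const, hv,
          lintegral_add_left hch.enorm.measurable,
          lintegral_const_mul _ hc.enorm.measurable, mul_comm B]

lemma measurable_lpDSum_integrand {f : Euc d → ℝ} (hf : ContDiff ℝ ∞ f) (m k : ℕ) (D : ℝ≥0∞) :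
    Measurable fun x => ∑ j ∈ Finset.range (k + 1), D ^ j * ‖iteratedFDeriv ℝ (m + j) f x‖ₑ :=
  Finset.measurable_fun_sum _ fun j _ =>
    ((hf.contDiff_one_iteratedFDeriv (m + j)).continuous.enorm.measurable).const_mul _

lemma enorm_iteratedFDeriv_toLp_update_le {f : Euc d → ℝ} (hf : ContDiff ℝ ∞ f) (m : ℕ)
    (x : Fin d → ℝ) (i : Fin d) (δ : ℝ) :
    ENNReal.ofReal δ * ‖iteratedFDeriv ℝ m f (WithLp.toLp 2 x)‖ₑ ≤
      ∫⁻ t in Icc (x i) (x i + δ),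
        (‖iteratedFDeriv ℝ m f (WithLp.toLp 2 (Function.update x i t))‖ₑ +
          ENNReal.ofReal δ * ‖iteratedFDeriv ℝ (m + 1) f (WithLp.toLp 2 (Function.update x i t))‖ₑ) := by
  set g := iteratedFDeriv ℝ m f with hg
  have hgc : ContDiff ℝ 1 g := hf.contDiff_one_iteratedFDeriv m
  have hu : ∀ t : ℝ, (WithLp.toLp 2 (Function.update x i t) : Euc d) =
      WithLp.toLp 2 (Function.update x i 0) + t • EuclideanSpace.single i (1 : ℝ) := by
    intro t
    ext k
    by_cases hk : k = i
    · subst hk; simp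
    · simp [hk]
  have hl : ∀ t : ℝ, HasDerivAt (fun t : ℝ => (WithLp.toLp 2 (Function.update x i t) : Euc d))
      (EuclideanSpace.single i (1 : ℝ)) t := by
    intro t
    rw [funext hu]
    simpa using ((hasDerivAt_id t).smul_const (EuclideanSpace.single i (1 : ℝ))).const_add
      (WithLp.toLp 2 (Function.update x i 0) : Euc d)
  have hlc : Continuous fun t : ℝ => (WithLp.toLp 2 (Function.update x i t) : Euc d) :=
    continuous_iff_continuousAt.2 fun t => (hl t).continuousAt
  have hd : ∀ t, HasDerivAt (fun t : ℝ => g (WithLp.toLp 2 (Function.update x i t)))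
      (fderiv ℝ g (WithLp.toLp 2 (Function.update x i t)) (EuclideanSpace.single i (1 : ℝ))) t :=
    fun t => ((hgc.differentiable (by simp)) _).hasFDerivAt.comp_hasDerivAt t (hl t)
  have h := enorm_le_lintegral_Icc hd
    (((hgc.continuous_fderiv (by simp)).comp hlc).clm_apply continuous_const) (x i) δ
  rw [Function.update_eq_self] at h
  refine h.trans (lintegral_mono fun t => ?_)
  dsimp only
  gcongr
  refine (ContinuousLinearMap.le_opENorm _ _).trans ?_
  rw [← ofReal_norm, ← ofReal_norm, hg, norm_fderiv_iteratedFDeriv, ofReal_norm]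
  simp

/-- Integrating over `k` coordinates, started at `a`, costs `k` derivatives. -/
lemma enorm_le_lmarginal {f : Euc d → ℝ} (hf : ContDiff ℝ ∞ f) (a : Fin d → ℝ) (δ : ℝ)
    (S : Finset (Fin d)) : ∀ (m : ℕ) (x : Fin d → ℝ), (∀ i ∈ S, x i = a i) →
    ENNReal.ofReal δ ^ S.card * ‖iteratedFDeriv ℝ m f (WithLp.toLp 2 x)‖ₑ ≤
      2 ^ S.card * (∫⋯∫⁻_S, (fun y => ∑ j ∈ Finset.range (S.card + 1),
        ENNReal.ofReal δ ^ j * ‖iteratedFDeriv ℝ (m + j) f (WithLp.toLp 2 y)‖ₑ)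
        ∂fun i => (volume : Measure ℝ).restrict (Icc (a i) (a i + δ))) x := by
  induction S using Finset.induction_on with
  | empty => intro m x _; simp
  | insert i S hi ih =>
    intro m x hx
    set D := ENNReal.ofReal δ with hD
    set ν : Fin d → Measure ℝ := fun i => (volume : Measure ℝ).restrict (Icc (a i) (a i + δ))
      with hν
    have hmeas : ∀ m k, Measurable fun y : Fin d → ℝ => ∑ j ∈ Finset.range (k + 1),
        D ^ j * ‖iteratedFDeriv ℝ (m + j) f (WithLp.toLp 2 y)‖ₑ := fun m k =>
      (measurable_lpDSum_integrand hf m k D).comp (PiLp.volume_preserving_toLp (Fin d)).measurable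
    rw [Finset.card_insert_of_notMem hi, lmarginal_insert _ (hmeas _ _) hi]
    have h1 := enorm_iteratedFDeriv_toLp_update_le hf m x i δ
    rw [hx i (Finset.mem_insert_self i S)] at h1
    have hxu : ∀ t, ∀ k ∈ S, Function.update x i t k = a k := by
      intro t k hk
      rw [Function.update_of_ne (by rintro rfl; exact hi hk)]
      exact hx k (Finset.mem_insert_of_mem hk)
    calc D ^ (S.card + 1) * ‖iteratedFDeriv ℝ m f (WithLp.toLp 2 x)‖ₑ
        = D ^ S.card * (D * ‖iteratedFDeriv ℝ m f (WithLp.toLp 2 x)‖ₑ) := by ring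
      _ ≤ D ^ S.card * ∫⁻ t in Icc (a i) (a i + δ),
          (‖iteratedFDeriv ℝ m f (WithLp.toLp 2 (Function.update x i t))‖ₑ +
          D * ‖iteratedFDeriv ℝ (m + 1) f (WithLp.toLp 2 (Function.update x i t))‖ₑ) := by gcongr
      _ = ∫⁻ t, (D ^ S.card * ‖iteratedFDeriv ℝ m f (WithLp.toLp 2 (Function.update x i t))‖ₑ +
          D * (D ^ S.card *
            ‖iteratedFDeriv ℝ (m + 1) f (WithLp.toLp 2 (Function.update x i t))‖ₑ)) ∂ν i := by
          rw [← lintegral_const_mul' _ _ (ENNReal.pow_ne_top ENNReal.ofReal_ne_top)]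
          refine lintegral_congr fun t => ?_
          ring
      _ ≤ ∫⁻ t, 2 ^ (S.card + 1) * (∫⋯∫⁻_S, (fun y => ∑ j ∈ Finset.range (S.card + 1 + 1),
            D ^ j * ‖iteratedFDeriv ℝ (m + j) f (WithLp.toLp 2 y)‖ₑ) ∂ν)
              (Function.update x i t) ∂ν i := by
          refine lintegral_mono fun t => ?_
          have e1 := ih m (Function.update x i t) (hxu t)
          have e2 := ih (m + 1) (Function.update x i t) (hxu t)
          -- The term without and the term with an extra derivative are each dominated by the sum
          -- with one more order; this doubles the constant for each new coordinate.
          have e3 : (∫⋯∫⁻_S, (fun y => ∑ j ∈ Finset.range (S.card + 1),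
              D ^ j * ‖iteratedFDeriv ℝ (m + j) f (WithLp.toLp 2 y)‖ₑ) ∂ν)
                (Function.update x i t) ≤
              (∫⋯∫⁻_S, (fun y => ∑ j ∈ Finset.range (S.card + 1 + 1),
              D ^ j * ‖iteratedFDeriv ℝ (m + j) f (WithLp.toLp 2 y)‖ₑ) ∂ν)
                (Function.update x i t) :=
            lmarginal_mono (fun y => Finset.sum_le_sum_of_subset (Finset.range_mono (by omega))) _
          have e4 : D * (∫⋯∫⁻_S, (fun y => ∑ j ∈ Finset.range (S.card + 1),
              D ^ j * ‖iteratedFDeriv ℝ (m + 1 + j) f (WithLp.toLp 2 y)‖ₑ) ∂ν)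
                (Function.update x i t) ≤
              (∫⋯∫⁻_S, (fun y => ∑ j ∈ Finset.range (S.card + 1 + 1),
              D ^ j * ‖iteratedFDeriv ℝ (m + j) f (WithLp.toLp 2 y)‖ₑ) ∂ν)
                (Function.update x i t) := by
            unfold lmarginal
            rw [← lintegral_const_mul' _ _ ENNReal.ofReal_ne_top]
            refine lintegral_mono fun y => ?_
            dsimp only
            rw [Finset.sum_range_succ' _ (S.card + 1), Finset.mul_sum]
            refine le_trans (le_of_eq (Finset.sum_congr rfl fun j _ => ?_)) le_self_add
            rw [show m + (j + 1) = m + 1 + j by ring, pow_succ]; ring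
          refine (add_le_add e1 (mul_le_mul_right e2 D)).trans ?_
          rw [mul_left_comm, ← mul_add, pow_succ, mul_assoc, two_mul]
          gcongr
      _ = _ := by
          rw [lintegral_const_mul' _ _ (by simp)]

/-- The supremum bound for `p = 1`, `k = d`. -/
lemma enorm_corner_le_lpDSum {f : Euc d → ℝ} (hf : ContDiff ℝ ∞ f) (m : ℕ) (a : Euc d) {δ : ℝ}
    (hδ : 0 < δ) :
    ‖iteratedFDeriv ℝ m f a‖ₑ ≤
      2 ^ d * ENNReal.ofReal δ ^ (-(d : ℝ)) * lpDSum m d 1 δ (cube a δ) f := by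
  have h := enorm_le_lmarginal hf (WithLp.ofLp a) δ Finset.univ m (WithLp.ofLp a) fun _ _ => rfl
  rw [lmarginal_univ, Finset.card_univ, Fintype.card_fin, WithLp.toLp_ofLp] at h
  set D := ENNReal.ofReal δ with hD
  have e : ∫⁻ y, (∑ j ∈ Finset.range (d + 1),
        D ^ j * ‖iteratedFDeriv ℝ (m + j) f (WithLp.toLp 2 y)‖ₑ)
        ∂Measure.pi (fun i => (volume : Measure ℝ).restrict (Icc (a i) (a i + δ))) =
      lpDSum m d 1 δ (cube a δ) f := by
    rw [← Measure.restrict_pi_pi, ← volume_pi]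
    have hc : cube a δ = WithLp.ofLp ⁻¹' (univ.pi fun i => Icc (a i) (a i + δ)) := by
      ext x; simp only [cube, mem_ofPred_eq, mem_preimage, mem_univ_pi]
    have hmp := (PiLp.volume_preserving_ofLp (Fin d)).restrict_preimage
      (s := univ.pi fun i => Icc (a i) (a i + δ)) (MeasurableSet.univ_pi fun _ => measurableSet_Icc)
    have hm := measurable_lpDSum_integrand hf m d D
    have hm' : Measurable fun y : Fin d → ℝ => ∑ j ∈ Finset.range (d + 1),
        D ^ j * ‖iteratedFDeriv ℝ (m + j) f (WithLp.toLp 2 y)‖ₑ :=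
      hm.comp (PiLp.volume_preserving_toLp (Fin d)).measurable
    rw [← hmp.lintegral_comp hm', ← hc]
    simp only [WithLp.toLp_ofLp]
    rw [lintegral_finsetSum _ fun j _ =>
      ((hf.contDiff_one_iteratedFDeriv (m + j)).continuous.enorm.measurable).const_mul _]
    refine Finset.sum_congr rfl fun j _ => ?_
    rw [lintegral_const_mul' _ _ (ENNReal.pow_ne_top ENNReal.ofReal_ne_top)]
    simp [lpD, eLpNorm']
  have hD0 : D ≠ 0 := by simpa [hD] using hδ
  rw [e] at h
  rw [ENNReal.rpow_neg, ENNReal.rpow_natCast, mul_right_comm, ← ENNReal.div_eq_inv_mul.trans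
    (mul_comm _ _), ENNReal.le_div_iff_mul_le (by left; simp [hD0]) (by left; simp [hD]), mul_comm]
  exact h

end Corner


/-! ### Geometry of the domains. -/

section Domain

variable {d : ℕ} {X : Set (Euc d)}

/-- The domains considered: the whole space or the closed positive orthant. -/
def IsModelDomain (X : Set (Euc d)) : Prop := X = univ ∨ X = {x : Euc d | ∀ k, 0 ≤ x k}

lemma IsModelDomain.isClosed (hX : IsModelDomain X) : IsClosed X := by
  rcases hX with rfl | rfl
  · exact isClosed_univ
  · simp only [ofPred_forall]
    exact isClosed_iInter fun k => isClosed_le continuous_const (by fun_prop)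

lemma IsModelDomain.convex (hX : IsModelDomain X) : Convex ℝ X := by
  rcases hX with rfl | rfl
  · exact convex_univ
  · intro x hx y hy a b ha hb _ k
    exact add_nonneg (mul_nonneg ha (hx k)) (mul_nonneg hb (hy k))

lemma IsModelDomain.interior_nonempty (hX : IsModelDomain X) : (interior X).Nonempty := by
  rcases hX with rfl | rfl
  · simp
  · refine ⟨WithLp.toLp 2 fun _ => 1, mem_interior.2 ⟨{x : Euc d | ∀ k, 0 < x k},
      fun x hx k => (hx k).le, ?_, fun k => by simp⟩⟩
    simp only [ofPred_forall]
    exact isOpen_iInter_of_finite fun k => isOpen_lt continuous_const (by fun_prop)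

lemma IsModelDomain.uniqueDiffOn (hX : IsModelDomain X) : UniqueDiffOn ℝ X :=
  uniqueDiffOn_convex hX.convex hX.interior_nonempty

lemma IsModelDomain.measurableSet (hX : IsModelDomain X) : MeasurableSet X := hX.isClosed.measurableSet

/-- The boundary of a convex set is null. Weak derivatives, defined through the interior, are
therefore determined almost everywhere on X. -/
lemma IsModelDomain.interior_ae_eq (hX : IsModelDomain X) : interior X =ᵐ[volume] X :=
  interior_ae_eq_of_null_frontier (hX.convex.addHaar_frontier volume)

/-- Increasing coordinates never leaves X. For this reason cubes are anchored at their lowest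
corner: the estimates then hold up to the boundary without any extension operator. -/
lemma IsModelDomain.cube_subset (hX : IsModelDomain X) {a : Euc d} (ha : a ∈ X) (δ : ℝ) :
    cube a δ ⊆ X := by
  rcases hX with rfl | rfl
  · exact subset_univ _
  · exact fun x hx k => (ha k).trans (hx k).1

/-- The coordinatewise minimum serves as the lowest corner of a cube containing two given points of
X. -/
lemma IsModelDomain.inf_mem (hX : IsModelDomain X) {x y : Euc d} (hx : x ∈ X) (hy : y ∈ X) :
    (WithLp.toLp 2 fun k => min (x k) (y k) : Euc d) ∈ X := by
  rcases hX with rfl | rfl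
  · exact mem_univ _
  · exact fun k => le_min (hx k) (hy k)

end Domain

/-! ### Weighted Lebesgue norms and jets of derivatives. -/

section WeightedNorms

variable {d : ℕ} {X : Set (Euc d)} {p : ℝ}

/-- The norm of `L^p(X, W dx)`. -/
noncomputable def wLp (X : Set (Euc d)) (p : ℝ) (W v : Euc d → ℝ) : ℝ≥0∞ :=
  (∫⁻ x in X, ‖v x‖ₑ ^ p * ENNReal.ofReal (W x)) ^ (1 / p)

/-- The measure `W dx` on `X`. -/
noncomputable def wMeas (X : Set (Euc d)) (W : Euc d → ℝ) : Measure (Euc d) :=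
  (volume.restrict X).withDensity fun x => ENNReal.ofReal (W x)

lemma wLp_eq_eLpNorm' {W v : Euc d → ℝ} (hW : AEMeasurable W (volume.restrict X))
    (hv : AEStronglyMeasurable v (volume.restrict X)) :
    wLp X p W v = eLpNorm' v p (wMeas X W) := by
  unfold wLp eLpNorm' wMeas
  rw [lintegral_withDensity_eq_lintegral_mul₀ hW.ennreal_ofReal (hv.enorm.pow_const _)]
  simp only [Pi.mul_apply, mul_comm]

lemma wMeas_absolutelyContinuous (X : Set (Euc d)) (W : Euc d → ℝ) :
    wMeas X W ≪ volume.restrict X := withDensity_absolutelyContinuous _ _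

/-- Positivity of the weight almost everywhere gives it the same null sets as Lebesgue measure on X,
so limits taken for the weighted measure can be identified almost everywhere. -/
lemma absolutelyContinuous_wMeas {W : Euc d → ℝ} (hW : AEMeasurable W (volume.restrict X))
    (hpos : ∀ᵐ x ∂(volume.restrict X), 0 < W x) : volume.restrict X ≪ wMeas X W :=
  withDensity_absolutelyContinuous' hW.ennreal_ofReal (by
    filter_upwards [hpos] with x hx
    simpa using hx)

lemma wLp_add_le (hp : 1 ≤ p) {W v v' : Euc d → ℝ} (hW : AEMeasurable W (volume.restrict X))
    (hv : AEStronglyMeasurable v (volume.restrict X))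
    (hv' : AEStronglyMeasurable v' (volume.restrict X)) :
    wLp X p W (fun x => v x + v' x) ≤ wLp X p W v + wLp X p W v' := by
  have hs : AEStronglyMeasurable (fun x => v x + v' x) (volume.restrict X) := hv.add hv'
  rw [wLp_eq_eLpNorm' hW hs, wLp_eq_eLpNorm' hW hv, wLp_eq_eLpNorm' hW hv']
  have hac := wMeas_absolutelyContinuous X W
  exact eLpNorm'_add_le (hv.mono_ac hac) (hv'.mono_ac hac) hp

lemma wLp_sub_comm (W v v' : Euc d → ℝ) :
    wLp X p W (fun x => v x - v' x) = wLp X p W (fun x => v' x - v x) := by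
  unfold wLp
  simp only [enorm_sub_rev]

lemma wLp_mono_set {Y : Set (Euc d)} (h : Y ⊆ X) (hp : 0 ≤ p) (W v : Euc d → ℝ) :
    wLp Y p W v ≤ wLp X p W v :=
  ENNReal.rpow_le_rpow (lintegral_mono_set h) (by positivity)

lemma jetNorm_eq_wLp (X : Set (Euc d)) (m : ℕ) (hp : 1 ≤ p) (w v : MIdx d → Euc d → ℝ) :
    jetNorm X m p w v = (∑ j ∈ midxLE d m, wLp X p (w j) (v j) ^ p) ^ (1 / p) := by
  unfold jetNorm wLp
  congr 1
  refine Finset.sum_congr rfl fun j _ => ?_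
  rw [← ENNReal.rpow_mul, one_div_mul_cancel (by linarith), ENNReal.rpow_one]

lemma wLp_le_jetNorm {m : ℕ} (hp : 1 ≤ p) (w v : MIdx d → Euc d → ℝ) {j : MIdx d}
    (hj : mlen j ≤ m) : wLp X p (w j) (v j) ≤ jetNorm X m p w v := by
  have hp0 : 0 < p := by linarith
  rw [jetNorm_eq_wLp X m hp]
  calc wLp X p (w j) (v j) = (wLp X p (w j) (v j) ^ p) ^ (1 / p) := by
        rw [← ENNReal.rpow_mul, mul_one_div_cancel hp0.ne', ENNReal.rpow_one]
    _ ≤ _ := by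
        gcongr
        exact Finset.single_le_sum (f := fun j => wLp X p (w j) (v j) ^ p)
          (fun _ _ => zero_le) (mem_midxLE.2 hj)

lemma jetNorm_le_sum (m : ℕ) (hp : 1 ≤ p) (w v : MIdx d → Euc d → ℝ) :
    jetNorm X m p w v ≤ ∑ j ∈ midxLE d m, wLp X p (w j) (v j) := by
  have hp0 : 0 < p := by linarith
  rw [jetNorm_eq_wLp X m hp, one_div, ENNReal.rpow_inv_le_iff hp0]
  induction midxLE d m using Finset.induction_on with
  | empty => simp [hp0]
  | insert j S hj ih =>
    rw [Finset.sum_insert hj, Finset.sum_insert hj]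
    refine (add_le_add le_rfl ih).trans ?_
    exact ENNReal.add_rpow_le_rpow_add _ _ hp

lemma jetNorm_add_le {m : ℕ} (hp : 1 ≤ p) {w v v' : MIdx d → Euc d → ℝ}
    (hw : ∀ j, mlen j ≤ m → AEMeasurable (w j) (volume.restrict X))
    (hv : ∀ j, mlen j ≤ m → AEStronglyMeasurable (v j) (volume.restrict X))
    (hv' : ∀ j, mlen j ≤ m → AEStronglyMeasurable (v' j) (volume.restrict X)) :
    jetNorm X m p w (fun j x => v j x + v' j x) ≤ jetNorm X m p w v + jetNorm X m p w v' := by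
  rw [jetNorm_eq_wLp X m hp, jetNorm_eq_wLp X m hp, jetNorm_eq_wLp X m hp]
  refine le_trans ?_ (ENNReal.Lp_add_le _ _ _ hp)
  gcongr with j hj
  rw [mem_midxLE] at hj
  exact wLp_add_le hp (hw j hj) (hv j hj) (hv' j hj)

lemma jetNorm_sub_comm (m : ℕ) (w v v' : MIdx d → Euc d → ℝ) :
    jetNorm X m p w (fun j x => v j x - v' j x) = jetNorm X m p w (fun j x => v' j x - v j x) := by
  unfold jetNorm
  simp only [enorm_sub_rev]

lemma jetNorm_congr {m : ℕ} {w v v' : MIdx d → Euc d → ℝ}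
    (h : ∀ j, mlen j ≤ m → v j =ᵐ[volume.restrict X] v' j) :
    jetNorm X m p w v = jetNorm X m p w v' := by
  unfold jetNorm
  congr 1
  refine Finset.sum_congr rfl fun j hj => lintegral_congr_ae ?_
  filter_upwards [h j (mem_midxLE.1 hj)] with x hx
  rw [hx]

end WeightedNorms

/-! ### Uniqueness of weak derivatives and smooth approximation. -/

section WeakDerivatives

variable {d : ℕ} {X : Set (Euc d)}

lemma LocallyIntegrableOn.aestronglyMeasurable_of_interior (hX : IsModelDomain X) {v : Euc d → ℝ}
    (hv : LocallyIntegrableOn v (interior X)) : AEStronglyMeasurable v (volume.restrict X) := by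
  rw [← Measure.restrict_congr_set hX.interior_ae_eq]
  exact hv.aestronglyMeasurable

/-- The difference integrates to zero against all test functions in the interior, hence vanishes
almost everywhere there, and the boundary is null. -/
lemma IsWeakDeriv.ae_eq (hX : IsModelDomain X) {j : MIdx d} {u v v' : Euc d → ℝ}
    (h : IsWeakDeriv X j u v) (h' : IsWeakDeriv X j u v') : v =ᵐ[volume.restrict X] v' := by
  have hl : LocallyIntegrableOn (fun x => v x - v' x) (interior X) (volume.restrict X) := by
    have := h.2.1.sub h'.2.1
    exact fun x hx => (this x hx).imp fun s hs => ⟨hs.1, hs.2.mono_measure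
      Measure.restrict_le_self⟩
  have hint : ∀ {v : Euc d → ℝ}, LocallyIntegrableOn v (interior X) → ∀ φ : Euc d → ℝ,
      ContDiff ℝ ∞ φ → HasCompactSupport φ → tsupport φ ⊆ interior X →
      IntegrableOn (fun x => φ x * v x) X := by
    intro v hv φ hφ hc hs
    have h1 : IntegrableOn (fun x => φ x • v x) (tsupport φ) :=
      (hv.integrableOn_compact_subset hs hc).continuousOn_smul hφ.continuous.continuousOn hc
    have h2 : Integrable fun x => φ x • v x :=
      (integrableOn_iff_integrable_of_support_subset (by
        refine fun x hx => subset_tsupport φ ?_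
        rw [Function.mem_support] at hx ⊢
        exact fun h0 => hx (by simp [h0]))).1 h1
    exact h2.integrableOn
  have key := isOpen_interior.ae_eq_zero_of_integral_contDiff_smul_eq_zero hl (by
    intro φ hφ hc hs
    have e1 := h.2.2 φ hφ hc hs
    have e2 := h'.2.2 φ hφ hc hs
    rw [e1] at e2
    have e3 : ∫ x in X, v x * φ x = ∫ x in X, v' x * φ x :=
      mul_left_cancel₀ (pow_ne_zero _ (by norm_num)) e2
    simp only [smul_eq_mul, mul_sub]
    rw [integral_sub (hint h.2.1 φ hφ hc hs) (hint h'.2.1 φ hφ hc hs), sub_eq_zero]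
    simpa only [mul_comm] using e3)
  have hmem : ∀ᵐ x ∂(volume.restrict X), x ∈ interior X := by
    rw [← Measure.restrict_congr_set hX.interior_ae_eq]
    exact ae_restrict_mem isOpen_interior.measurableSet
  filter_upwards [key, hmem] with x hx hx'
  exact sub_eq_zero.1 (hx hx')

lemma isWeakDeriv_weakD {j : MIdx d} {u : Euc d → ℝ} (h : ∃ v, IsWeakDeriv X j u v) :
    IsWeakDeriv X j u (weakD X j u) := by
  unfold weakD
  rw [dif_pos h]
  exact Classical.choose_spec h

lemma IsWeakDeriv.weakD_ae_eq (hX : IsModelDomain X) {j : MIdx d} {u v : Euc d → ℝ}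
    (h : IsWeakDeriv X j u v) : weakD X j u =ᵐ[volume.restrict X] v :=
  (isWeakDeriv_weakD ⟨v, h⟩).ae_eq hX h

lemma mlen_zero : mlen (0 : MIdx d) = 0 := by simp [mlen]

lemma multiD_zero (f : Euc d → ℝ) : multiD (0 : MIdx d) f = f := by
  rw [multiD_eq_listD]
  have : (midxList (0 : MIdx d)) = [] := by
    rw [← List.length_eq_zero_iff, length_midxList, mlen_zero]
  rw [this]; rfl

lemma isWeakDeriv_zero {u : Euc d → ℝ} (hu : LocallyIntegrableOn u (interior X)) :
    IsWeakDeriv X 0 u u :=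
  ⟨hu, hu, fun φ _ _ _ => by rw [multiD_zero, mlen_zero]; simp⟩

variable {m : ℕ} {p : ℝ} {w : MIdx d → Euc d → ℝ} {u : Euc d → ℝ}

lemma MemSobolev.isWeakDeriv (hu : MemSobolev X m p w u) {j : MIdx d} (hj : mlen j ≤ m) :
    IsWeakDeriv X j u (weakD X j u) := isWeakDeriv_weakD (hu.1 j hj)

lemma MemSobolev.weakD_zero (hX : IsModelDomain X) (hu : MemSobolev X m p w u) :
    weakD X 0 u =ᵐ[volume.restrict X] u :=
  (isWeakDeriv_zero (hu.isWeakDeriv (j := 0) (by simp [mlen_zero])).1).weakD_ae_eq hX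

lemma MemSobolev.aestronglyMeasurable_weakD (hX : IsModelDomain X) (hu : MemSobolev X m p w u)
    {j : MIdx d} (hj : mlen j ≤ m) : AEStronglyMeasurable (weakD X j u) (volume.restrict X) :=
  LocallyIntegrableOn.aestronglyMeasurable_of_interior hX (hu.isWeakDeriv hj).2.1

/-- The Sobolev norm of a smooth function, computed with classical derivatives. -/
noncomputable def jet (X : Set (Euc d)) (m : ℕ) (p : ℝ) (w : MIdx d → Euc d → ℝ)
    (φ : Euc d → ℝ) : ℝ≥0∞ := jetNorm X m p w fun j => multiD j φ

lemma aestronglyMeasurable_multiD {φ : Euc d → ℝ} (hφ : ContDiff ℝ ∞ φ) (j : MIdx d)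
    (μ : Measure (Euc d)) : AEStronglyMeasurable (multiD j φ) μ :=
  (contDiff_multiD hφ j).continuous.aestronglyMeasurable

lemma MemSobolev.jetNorm_sub_triangle (hX : IsModelDomain X) (hp : 1 ≤ p)
    (hw : ∀ j, mlen j ≤ m → AEMeasurable (w j) (volume.restrict X))
    (hu : MemSobolev X m p w u) {φ : Euc d → ℝ} (hφ : ContDiff ℝ ∞ φ) :
    jet X m p w φ ≤ jetNorm X m p w (fun j x => multiD j φ x - weakD X j u x) +
      sobolevNorm X m p w u ∧
    sobolevNorm X m p w u ≤ jetNorm X m p w (fun j x => multiD j φ x - weakD X j u x) +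
      jet X m p w φ := by
  have hm1 : ∀ j, mlen j ≤ m →
      AEStronglyMeasurable (fun x => multiD j φ x - weakD X j u x) (volume.restrict X) := fun j hj =>
    (aestronglyMeasurable_multiD hφ j _).sub (hu.aestronglyMeasurable_weakD hX hj)
  constructor
  · have := jetNorm_add_le hp hw hm1 fun j hj => hu.aestronglyMeasurable_weakD hX hj
    simpa [jet, sobolevNorm] using this
  · rw [jetNorm_sub_comm]
    have := jetNorm_add_le hp hw (v := fun j x => weakD X j u x - multiD j φ x)
      (v' := fun j => multiD j φ)
      (fun j hj => (hu.aestronglyMeasurable_weakD hX hj).sub (aestronglyMeasurable_multiD hφ j _))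
      (fun j hj => aestronglyMeasurable_multiD hφ j _)
    simpa [jet, sobolevNorm] using this

/-- Smooth approximations of an element of the Sobolev space. -/
lemma MemSobolev.exists_seq (hX : IsModelDomain X) (hp : 1 ≤ p)
    (hw : ∀ j, mlen j ≤ m → AEMeasurable (w j) (volume.restrict X))
    (hu : MemSobolev X m p w u) :
    ∃ φ : ℕ → Euc d → ℝ, (∀ n, SmoothVanishing X (φ n)) ∧
      Tendsto (fun n => jetNorm X m p w (fun j x => multiD j (φ n) x - weakD X j u x)) atTop (𝓝 0) ∧
      (∀ n, jet X m p w (φ n) < ⊤) ∧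
      Tendsto (fun n => jet X m p w (φ n)) atTop (𝓝 (sobolevNorm X m p w u)) := by
  have h : ∀ n : ℕ, ∃ φ : Euc d → ℝ, SmoothVanishing X φ ∧ jet X m p w φ < ⊤ ∧
      jetNorm X m p w (fun j x => multiD j φ x - weakD X j u x) < ((n : ℝ≥0∞) + 1)⁻¹ := fun n =>
    hu.2 _ (by simp)
  choose φ h1 h2 h3 using h
  have ht : Tendsto (fun n => jetNorm X m p w (fun j x => multiD j (φ n) x - weakD X j u x))
      atTop (𝓝 0) := by
    refine tendsto_of_tendsto_of_tendsto_of_le_of_le tendsto_const_nhds ?_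
      (fun _ => zero_le) fun n => (h3 n).le
    have := ENNReal.tendsto_inv_nat_nhds_zero.comp (tendsto_add_atTop_nat 1)
    simpa [Function.comp_def] using this
  refine ⟨φ, h1, ht, h2, ?_⟩
  have hs := fun n => hu.jetNorm_sub_triangle hX hp hw (h1 n).1
  -- The two triangle inequalities bound the liminf from below and the limsup from above; this form
  -- avoids subtracting extended norms.
  refine tendsto_of_le_liminf_of_limsup_le ?_ ?_
  · by_contra! hlt
    obtain ⟨c, hc1, hc2⟩ := exists_between hlt
    have hf := frequently_lt_of_liminf_lt (by isBoundedDefault) hc1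
    have hε : 0 < sobolevNorm X m p w u - c := tsub_pos_of_lt hc2
    obtain ⟨n, hn1, hn2⟩ := (hf.and_eventually (ht.eventually_lt_const hε)).exists
    have := (hs n).2.trans_lt (ENNReal.add_lt_add hn2 hn1)
    rw [tsub_add_cancel_of_le hc2.le] at this
    exact lt_irrefl _ this
  · have h4 := limsup_le_limsup (Eventually.of_forall fun n => (hs n).1) (f := atTop)
    refine h4.trans (le_of_eq ?_)
    simpa using (ht.add_const (sobolevNorm X m p w u)).limsup_eq

lemma jetNorm_seq_cauchy (hX : IsModelDomain X) (hp : 1 ≤ p)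
    (hw : ∀ j, mlen j ≤ m → AEMeasurable (w j) (volume.restrict X))
    (hu : MemSobolev X m p w u) {φ ψ : Euc d → ℝ} (hφ : ContDiff ℝ ∞ φ) (hψ : ContDiff ℝ ∞ ψ) :
    jet X m p w (fun x => φ x - ψ x) ≤
      jetNorm X m p w (fun j x => multiD j φ x - weakD X j u x) +
      jetNorm X m p w (fun j x => multiD j ψ x - weakD X j u x) := by
  rw [jetNorm_sub_comm m w (fun j => multiD j ψ)]
  have := jetNorm_add_le hp hw (v := fun j x => multiD j φ x - weakD X j u x)
    (v' := fun j x => weakD X j u x - multiD j ψ x)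
    (fun j hj => (aestronglyMeasurable_multiD hφ j _).sub (hu.aestronglyMeasurable_weakD hX hj))
    (fun j hj => (hu.aestronglyMeasurable_weakD hX hj).sub (aestronglyMeasurable_multiD hψ j _))
  unfold jet
  simpa [multiD_sub hφ hψ] using this

end WeakDerivatives

/-! ### Uniform limits of derivatives up to the boundary. -/

section UniformLimits

/-- The mean value inequality on the convex set makes g n - g N Lipschitz with a small constant for
all n ≥ N. Letting n tend to infinity shows that G differs from g N by a function with small
Lipschitz constant, while g N is differentiable. No interior point is needed, so boundary points are
covered. -/
lemma Convex.hasFDerivWithinAt_of_uniform_limit {E F : Type*} [NormedAddCommGroup E]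
    [NormedSpace ℝ E] [NormedAddCommGroup F] [NormedSpace ℝ F] {X : Set E} (hX : Convex ℝ X)
    {g : ℕ → E → F} {g' : ℕ → E → E →L[ℝ] F} {G : E → F} {G' : E → E →L[ℝ] F}
    (hg : ∀ n x, HasFDerivAt (g n) (g' n x) x)
    (hG : ∀ x ∈ X, Tendsto (fun n => g n x) atTop (𝓝 (G x)))
    (hG' : TendstoUniformlyOn g' G' atTop X) {x : E} (hx : x ∈ X) :
    HasFDerivWithinAt G (G' x) X x := by
  rw [hasFDerivWithinAt_iff_isLittleO, Asymptotics.isLittleO_iff]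
  intro ε hε
  rw [Metric.tendstoUniformlyOn_iff] at hG'
  obtain ⟨N, hN⟩ := eventually_atTop.1 (hG' (ε / 4) (by positivity))
  have hlip : ∀ y ∈ X, ‖(G y - g N y) - (G x - g N x)‖ ≤ ε / 2 * ‖y - x‖ := by
    intro y hy
    have hb : ∀ n ≥ N, ‖(g n y - g N y) - (g n x - g N x)‖ ≤ ε / 2 * ‖y - x‖ := by
      intro n hn
      refine hX.norm_image_sub_le_of_norm_hasFDerivWithin_le (f := fun z => g n z - g N z)
        (f' := fun z => g' n z - g' N z)
        (fun z _ => ((hg n z).sub (hg N z)).hasFDerivWithinAt) (fun z hz => ?_) hx hy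
      have h1 := hN n hn z hz
      have h2 := hN N le_rfl z hz
      rw [dist_eq_norm] at h1 h2
      calc ‖g' n z - g' N z‖ = ‖(G' z - g' N z) - (G' z - g' n z)‖ := by congr 1; abel
        _ ≤ ‖G' z - g' N z‖ + ‖G' z - g' n z‖ := norm_sub_le _ _
        _ ≤ ε / 2 := by linarith
    have ht : Tendsto (fun n => ‖(g n y - g N y) - (g n x - g N x)‖) atTop
        (𝓝 ‖(G y - g N y) - (G x - g N x)‖) :=
      (((hG y hy).sub_const _).sub ((hG x hx).sub_const _)).norm
    exact le_of_tendsto ht (eventually_atTop.2 ⟨N, hb⟩)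
  have hd := (hg N x).hasFDerivWithinAt (s := X)
  rw [hasFDerivWithinAt_iff_isLittleO, Asymptotics.isLittleO_iff] at hd
  filter_upwards [hd (show 0 < ε / 4 by positivity), self_mem_nhdsWithin] with y hy1 hyX
  have h2 := hN N le_rfl x hx
  rw [dist_eq_norm] at h2
  have h3 : ‖(G' x - g' N x) (y - x)‖ ≤ ε / 4 * ‖y - x‖ :=
    (ContinuousLinearMap.le_opNorm _ _).trans (by gcongr)
  calc ‖G y - G x - G' x (y - x)‖ = ‖((G y - g N y) - (G x - g N x)) +
        (g N y - g N x - g' N x (y - x)) - (G' x - g' N x) (y - x)‖ := by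
        congr 1; rw [sub_apply]; abel
    _ ≤ ‖(G y - g N y) - (G x - g N x)‖ + ‖g N y - g N x - g' N x (y - x)‖ +
        ‖(G' x - g' N x) (y - x)‖ := (norm_sub_le _ _).trans (by gcongr; exact norm_add_le _ _)
    _ ≤ ε * ‖y - x‖ := by linarith [hlip y hyX]

/-- The limits of the iterated derivatives form a Taylor series of the limit function on X. As X has
unique derivatives, they are its iterated derivatives within X. -/
lemma exists_contDiffOn_limit {d : ℕ} {X : Set (Euc d)} (hX : IsModelDomain X) {r : ℕ}
    {φ : ℕ → Euc d → ℝ} (hφ : ∀ n, ContDiff ℝ ∞ (φ n))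
    (hc : ∀ k ≤ r, UniformCauchySeqOn (fun n => iteratedFDeriv ℝ k (φ n)) atTop X) :
    ∃ f : Euc d → ℝ, ContDiffOn ℝ r f X ∧ ∀ k ≤ r, ∀ x ∈ X,
      Tendsto (fun n => iteratedFDeriv ℝ k (φ n) x) atTop (𝓝 (iteratedFDerivWithin ℝ k f X x)) := by
  classical
  have hlim : ∀ k ≤ r, ∀ x ∈ X, ∃ L, Tendsto (fun n => iteratedFDeriv ℝ k (φ n) x) atTop (𝓝 L) :=
    fun k hk x hx => cauchySeq_tendsto_of_complete ((hc k hk).cauchySeq hx)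
  choose! P hP using hlim
  have hu : ∀ k ≤ r, TendstoUniformlyOn (fun n => iteratedFDeriv ℝ k (φ n)) (P k) atTop X :=
    fun k hk => (hc k hk).tendstoUniformlyOn_of_tendsto fun x hx => hP k hk x hx
  set f : Euc d → ℝ := fun x => (P 0 x).curry0 with hf
  have hT : HasFTaylorSeriesUpToOn r f (fun x k => P k x) X := by
    refine ⟨fun x _ => rfl, fun k hk x hx => ?_, fun k hk => ?_⟩
    · have hk' : k < r := by exact_mod_cast hk
      refine hX.convex.hasFDerivWithinAt_of_uniform_limit
        (g := fun n => iteratedFDeriv ℝ k (φ n))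
        (g' := fun n x => (iteratedFDeriv ℝ (k + 1) (φ n) x).curryLeft)
        (G' := fun x => (P (k + 1) x).curryLeft)
        (fun n x => ?_) (hP k hk'.le) ?_ hx
      · have := (hφ n).ftaylorSeries.hasFTaylorSeriesUpToOn univ
        have h2 := this.fderivWithin k (by exact_mod_cast WithTop.coe_lt_top _) x (mem_univ x)
        rwa [hasFDerivWithinAt_univ] at h2
      · have := (continuousMultilinearCurryLeftEquiv ℝ (fun _ : Fin (k + 1) => Euc d) ℝ
          ).toContinuousLinearEquiv.toContinuousLinearMap.uniformContinuous
        exact this.comp_tendstoUniformlyOn (hu (k + 1) hk')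
    · have hk' : k ≤ r := by exact_mod_cast hk
      exact (hu k hk').continuousOn (Frequently.of_forall fun n =>
        ((hφ n).contDiff_one_iteratedFDeriv k).continuous.continuousOn)
  refine ⟨f, hT.contDiffOn, fun k hk x hx => ?_⟩
  rw [← hT.eq_iteratedFDerivWithin_of_uniqueDiffOn (by exact_mod_cast hk) hX.uniqueDiffOn hx]
  exact hP k hk x hx

end UniformLimits


/-! ### Supremum and Hölder bounds from scaled bounds. -/

section PointwiseBounds

variable {d : ℕ} {X : Set (Euc d)}

/-- At every point of `X` there is a cube of side `δ ≥ 1` on which `N` controls the scaled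
derivatives of order at most `s`, also after multiplication by `wc`. -/
def ScaledBound (X : Set (Euc d)) (s : ℕ) (p : ℝ) (wc : Euc d → ℝ)
    (N : (Euc d → ℝ) → ℝ≥0∞) : Prop :=
  ∃ M : ℝ≥0∞, M ≠ ⊤ ∧ ∀ a ∈ X, ∃ δ : ℝ, 1 ≤ δ ∧ ∀ φ : Euc d → ℝ, ContDiff ℝ ∞ φ →
    ∀ i ≤ s, ENNReal.ofReal δ ^ ((i : ℝ) - d / p) * lpD i p (cube a δ) φ ≤ M * N φ ∧
      ‖wc a‖ₑ * (ENNReal.ofReal δ ^ ((i : ℝ) - d / p) * lpD i p (cube a δ) φ) ≤ M * N φ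

/-- Because δ ≥ 1, raising the exponent of δ only weakens the bound, and each order of derivative
can receive the power required by `ScaledBound`. It is used with e = 0 for suprema and with e = d/q
for the Hölder estimate. -/
lemma rpow_mul_lpDSum_le {m k : ℕ} {p δ e : ℝ} (hδ : 1 ≤ δ) (he : e ≤ m) (Q : Set (Euc d))
    (f : Euc d → ℝ) :
    ENNReal.ofReal δ ^ (e - d / p) * lpDSum m k p δ Q f ≤
      ∑ j ∈ Finset.range (k + 1), ENNReal.ofReal δ ^ (((m + j : ℕ) : ℝ) - d / p) *
        lpD (m + j) p Q f := by
  have hD1 : 1 ≤ ENNReal.ofReal δ := by simpa using hδ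
  have hD0 : ENNReal.ofReal δ ≠ 0 := (zero_lt_one.trans_le hD1).ne'
  unfold lpDSum
  rw [Finset.mul_sum]
  refine Finset.sum_le_sum fun j _ => ?_
  rw [← mul_assoc, ← ENNReal.rpow_natCast, ← ENNReal.rpow_add _ _ hD0 (by simp)]
  refine mul_le_mul_left (ENNReal.rpow_le_rpow_of_exponent_le hD1 ?_) _
  push_cast; linarith

lemma ScaledBound.enorm_le {s : ℕ} {p : ℝ} (hp : 1 ≤ p) {wc : Euc d → ℝ}
    {N : (Euc d → ℝ) → ℝ≥0∞} (h : ScaledBound X s p wc N) {m k : ℕ} (hms : m + k ≤ s)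
    (hk : d / p < k ∨ (p = 1 ∧ d ≤ k)) :
    ∃ C : ℝ≥0∞, C ≠ ⊤ ∧ ∀ φ : Euc d → ℝ, ContDiff ℝ ∞ φ → ∀ a ∈ X,
      ‖iteratedFDeriv ℝ m φ a‖ₑ ≤ C * N φ ∧ ‖wc a‖ₑ * ‖iteratedFDeriv ℝ m φ a‖ₑ ≤ C * N φ := by
  obtain ⟨C, hC, H⟩ : ∃ C : ℝ≥0∞, C ≠ ⊤ ∧ ∀ (δ : ℝ), 0 < δ → ∀ f : Euc d → ℝ,
      ContDiff ℝ ∞ f → ∀ a : Euc d, ‖iteratedFDeriv ℝ m f a‖ₑ ≤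
        C * ENNReal.ofReal δ ^ (-(d / p)) * lpDSum m k p δ (cube a δ) f := by
    rcases hk with hk | ⟨rfl, hk⟩
    · obtain ⟨C, hC, H⟩ := enorm_cell_le_lpDSum d hp hk m
      exact ⟨C, hC, fun δ hδ f hf a => H δ _ (isCell_cube a hδ) f hf a
        fun k => ⟨le_rfl, by linarith⟩⟩
    · refine ⟨2 ^ d, by simp, fun δ hδ f hf a => (enorm_corner_le_lpDSum hf m a hδ).trans ?_⟩
      rw [div_one]
      gcongr
      exact lpDSum_mono hk _ _ _ _
  obtain ⟨M, hM, hMb⟩ := h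
  refine ⟨C * ((k + 1 : ℕ) * M), ENNReal.mul_ne_top hC (ENNReal.mul_ne_top (by simp) hM),
    fun φ hφ a ha => ?_⟩
  obtain ⟨δ, hδ, hb⟩ := hMb a ha
  have h1 := H δ (by linarith) φ hφ a
  have h2 := rpow_mul_lpDSum_le (p := p) (k := k) hδ (Nat.cast_nonneg m) (cube a δ) φ
  rw [zero_sub] at h2
  have h3 : ‖iteratedFDeriv ℝ m φ a‖ₑ ≤ C * ∑ j ∈ Finset.range (k + 1),
      ENNReal.ofReal δ ^ (((m + j : ℕ) : ℝ) - d / p) * lpD (m + j) p (cube a δ) φ := by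
    refine h1.trans ?_
    rw [mul_assoc]
    gcongr
  have hj : ∀ j ∈ Finset.range (k + 1), m + j ≤ s := fun j hj => by
    have := Finset.mem_range.1 hj; omega
  constructor
  · refine h3.trans ?_
    rw [mul_assoc]
    gcongr
    refine (Finset.sum_le_card_nsmul _ _ (M * N φ) fun j hj' => (hb φ hφ _ (hj j hj')).1).trans ?_
    rw [Finset.card_range, nsmul_eq_mul, mul_assoc]
  · refine (mul_le_mul_right h3 _).trans ?_
    rw [mul_left_comm, mul_assoc, Finset.mul_sum]
    gcongr
    refine (Finset.sum_le_card_nsmul _ _ (M * N φ) fun j hj' => (hb φ hφ _ (hj j hj')).2).trans ?_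
    rw [Finset.card_range, nsmul_eq_mul, mul_assoc]

/-- Morrey's inequality in L^q gives the Hölder exponent 1 - d/q, which equals η for q = d/(1 - η).
Reaching this q from p with k derivatives in subcritical steps requires precisely η < k + 1 - d/p.
When p is already at least that large, q = p works with θ = 0. -/
lemma exists_holder_exponent {d : ℕ} (hd : 1 ≤ d) {p η : ℝ} (hp : 1 ≤ p) {k : ℕ} (hη0 : 0 < η)
    (hη1 : η < 1) (hη : η < k + 1 - d / p) :
    ∃ q θ : ℝ, p ≤ q ∧ d < q ∧ η ≤ 1 - d / q ∧ d * θ < 1 ∧ 1 / p - 1 / q ≤ k * θ := by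
  have hp0 : 0 < p := by linarith
  have hd0 : (0 : ℝ) < d := by exact_mod_cast hd
  by_cases hpe : 1 / p ≤ (1 - η) / d
  · have h1 : d / p ≤ 1 - η := by
      rw [le_div_iff₀ hd0] at hpe
      calc d / p = 1 / p * d := by ring
        _ ≤ _ := hpe
    refine ⟨p, 0, le_rfl, ?_, by linarith, by simp, by simp⟩
    have : d / p < 1 := by linarith
    rwa [div_lt_one hp0] at this
  · push Not at hpe
    have h1η : 0 < 1 - η := by linarith
    have hk0 : (0 : ℝ) < k := by
      rcases Nat.eq_zero_or_pos k with h | h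
      · subst h
        exfalso
        rw [div_lt_iff₀ hd0] at hpe
        have : d / p = 1 / p * d := by ring
        simp only [CharP.cast_eq_zero, zero_add] at hη
        linarith
      · exact_mod_cast h
    refine ⟨d / (1 - η), (1 / p - (1 - η) / d) / k, ?_, ?_, ?_, ?_, ?_⟩
    · rw [le_div_iff₀ h1η]
      rw [div_lt_div_iff₀ hd0 hp0] at hpe
      linarith
    · rw [lt_div_iff₀ h1η]; nlinarith
    · rw [div_div_cancel₀ hd0.ne']; linarith
    · have : d * ((1 / p - (1 - η) / d) / k) = (d / p - (1 - η)) / k := by field_simp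
      rw [this, div_lt_one hk0]; linarith
    · rw [mul_div_cancel₀ _ hk0.ne', one_div_div]

/-- Points at distance at least 1 are handled by the supremum bound. Closer points lie in one cube
of side |x - y|; Morrey's inequality there yields the power of |x - y|, and the L^q norm of the next
derivative is estimated on the larger cube with the same corner, where `ScaledBound` applies. -/
lemma ScaledBound.enorm_sub_le (hX : IsModelDomain X) (hd : 1 ≤ d) {s : ℕ} {p : ℝ} (hp : 1 ≤ p)
    {wc : Euc d → ℝ} {N : (Euc d → ℝ) → ℝ≥0∞} (h : ScaledBound X s p wc N) {r k : ℕ}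
    (hrk : r + (k + 1) ≤ s) {η : ℝ} (hη0 : 0 < η) (hη1 : η < 1) (hη : η < k + 1 - d / p) :
    ∃ C : ℝ≥0∞, C ≠ ⊤ ∧ ∀ φ : Euc d → ℝ, ContDiff ℝ ∞ φ → ∀ x ∈ X, ∀ y ∈ X,
      ‖iteratedFDeriv ℝ r φ x - iteratedFDeriv ℝ r φ y‖ₑ ≤ C * N φ * ‖x - y‖ₑ ^ η := by
  obtain ⟨q, θ, hpq, hdq, hηq, hθ, hkθ⟩ := exists_holder_exponent hd hp hη0 hη1 hη
  have hq0 : 0 < q := by linarith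
  obtain ⟨C0, hC0, H0⟩ := h.enorm_le hp hrk (Or.inl (by push_cast; linarith))
  obtain ⟨C1, hC1, H1⟩ := enorm_sub_cell_le d (hp.trans hpq) hdq r
  obtain ⟨C2, hC2, H2⟩ := lpD_le_lpDSum d hθ k hp hpq hkθ (r + 1)
  obtain ⟨M, hM, hMb⟩ := h
  refine ⟨2 * C0 + C1 * (C2 * ((k + 1 : ℕ) * M)), by
    refine ENNReal.add_ne_top.2 ⟨ENNReal.mul_ne_top (by simp) hC0, ?_⟩
    exact ENNReal.mul_ne_top hC1 (ENNReal.mul_ne_top hC2 (ENNReal.mul_ne_top (by simp) hM)),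
    fun φ hφ x hx y hy => ?_⟩
  by_cases h1 : 1 ≤ ‖x - y‖
  · have h1' : (1 : ℝ≥0∞) ≤ ‖x - y‖ₑ ^ η := by
      refine ENNReal.one_le_rpow ?_ hη0
      rw [← ofReal_norm]; exact ENNReal.one_le_ofReal.2 h1
    calc _ ≤ ‖iteratedFDeriv ℝ r φ x‖ₑ + ‖iteratedFDeriv ℝ r φ y‖ₑ := _root_.enorm_sub_le
      _ ≤ C0 * N φ + C0 * N φ := add_le_add (H0 φ hφ x hx).1 (H0 φ hφ y hy).1
      _ = (2 * C0) * N φ * 1 := by ring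
      _ ≤ _ := by gcongr; exact le_self_add
  · push Not at h1
    by_cases hxy : x = y
    · simp [hxy]
    have ht0 : 0 < ‖x - y‖ := norm_pos_iff.2 (sub_ne_zero.2 hxy)
    set t := ‖x - y‖ with ht
    set a : Euc d := WithLp.toLp 2 fun k => min (x k) (y k) with ha
    have haX : a ∈ X := hX.inf_mem hx hy
    have hk : ∀ k, |x k - y k| ≤ t := fun k => by
      simpa using PiLp.norm_apply_le (x - y) k
    have hxa : x ∈ cube a t := fun k => by
      have := abs_le.1 (hk k)
      simp only [ha]
      refine ⟨min_le_left _ _, ?_⟩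
      rcases le_total (x k) (y k) with h | h
      · rw [min_eq_left h]; linarith
      · rw [min_eq_right h]; linarith
    have hya : y ∈ cube a t := fun k => by
      have := abs_le.1 (hk k)
      simp only [ha]
      refine ⟨min_le_right _ _, ?_⟩
      rcases le_total (x k) (y k) with h | h
      · rw [min_eq_left h]; linarith
      · rw [min_eq_right h]; linarith
    obtain ⟨δ, hδ, hb⟩ := hMb a haX
    have hsub : cube a t ⊆ cube a δ := fun z hz k =>
      ⟨(hz k).1, (hz k).2.trans (by linarith)⟩
    have hmono : lpD (r + 1) q (cube a t) φ ≤ lpD (r + 1) q (cube a δ) φ :=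
      eLpNorm'_mono_measure _ (Measure.restrict_mono hsub le_rfl) hq0.le
    have h2 := H2 δ _ (isCell_cube a (by linarith)) φ hφ
    have hdq1 : (d : ℝ) / q ≤ 1 := by rw [div_le_one hq0]; linarith
    have h3 := rpow_mul_lpDSum_le (p := p) (k := k) (m := r + 1) (e := d / q) hδ
      (by push_cast; linarith [Nat.cast_nonneg (α := ℝ) r]) (cube a δ) φ
    have hj : ∀ j ∈ Finset.range (k + 1), r + 1 + j ≤ s := fun j hj => by
      have := Finset.mem_range.1 hj; omega
    have h4 : lpD (r + 1) q (cube a δ) φ ≤ C2 * ((k + 1 : ℕ) * M) * N φ := by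
      refine h2.trans ?_
      rw [show (d : ℝ) * (1 / q - 1 / p) = d / q - d / p by ring, mul_assoc, mul_assoc]
      refine mul_le_mul_right (h3.trans ?_) _
      refine (Finset.sum_le_card_nsmul _ _ (M * N φ)
        fun j hj' => (hb φ hφ _ (hj j hj')).1).trans ?_
      rw [Finset.card_range, nsmul_eq_mul, mul_assoc]
    have h5 : ENNReal.ofReal t ^ (1 - d / q) ≤ ‖x - y‖ₑ ^ η := by
      rw [ht, ofReal_norm]
      refine ENNReal.rpow_le_rpow_of_exponent_ge ?_ hηq
      rw [← ofReal_norm]; exact ENNReal.ofReal_le_one.2 h1.le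
    calc _ ≤ C1 * ENNReal.ofReal t ^ (1 - d / q) * lpD (r + 1) q (cube a t) φ :=
          H1 t _ (isCell_cube a ht0) φ hφ x hxa y hya
      _ ≤ C1 * ‖x - y‖ₑ ^ η * (C2 * ((k + 1 : ℕ) * M) * N φ) := by
          gcongr
          exact hmono.trans h4
      _ = (C1 * (C2 * ((k + 1 : ℕ) * M))) * N φ * ‖x - y‖ₑ ^ η := by ring
      _ ≤ _ := by gcongr; exact le_add_self

end PointwiseBounds

/-! ### From bounds on smooth functions to embeddings. -/

section Embedding

variable {d : ℕ} {X : Set (Euc d)} {s r : ℕ} {p P : ℝ} {w : MIdx d → Euc d → ℝ} {wc : Euc d → ℝ}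

/-- A bound for the derivatives of smooth functions produces `C^r` representatives. -/
lemma MemSobolev.exists_contDiffOn (hX : IsModelDomain X) (hP : 1 ≤ P)
    (hw : ∀ j, mlen j ≤ s → AEMeasurable (w j) (volume.restrict X))
    (hw0 : ∀ᵐ x ∂(volume.restrict X), 0 < w 0 x) {C : ℝ≥0∞} (hC : C ≠ ⊤)
    (hb : ∀ k ≤ r, ∀ φ : Euc d → ℝ, ContDiff ℝ ∞ φ → ∀ a ∈ X,
      ‖iteratedFDeriv ℝ k φ a‖ₑ ≤ C * jet X s P w φ)
    {u : Euc d → ℝ} (hu : MemSobolev X s P w u) :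
    ∃ f : Euc d → ℝ, f =ᵐ[volume.restrict X] u ∧ ContDiffOn ℝ r f X ∧
      ∃ φ : ℕ → Euc d → ℝ, (∀ n, ContDiff ℝ ∞ (φ n)) ∧
        Tendsto (fun n => jet X s P w (φ n)) atTop (𝓝 (sobolevNorm X s P w u)) ∧
        ∀ k ≤ r, ∀ x ∈ X, Tendsto (fun n => iteratedFDeriv ℝ k (φ n) x) atTop
          (𝓝 (iteratedFDerivWithin ℝ k f X x)) := by
  have hP0 : 0 < P := by linarith
  obtain ⟨φ, hφ, ht, _, hjet⟩ := hu.exists_seq hX hP hw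
  have hs : ∀ n, ContDiff ℝ ∞ (φ n) := fun n => (hφ n).1
  set e := fun n => jetNorm X s P w (fun j x => multiD j (φ n) x - weakD X j u x) with he
  have hcau : ∀ k ≤ r, UniformCauchySeqOn (fun n => iteratedFDeriv ℝ k (φ n)) atTop X := by
    intro k hk
    rw [Metric.uniformCauchySeqOn_iff]
    intro ε hε
    have ht2 : Tendsto (fun n => C * e n) atTop (𝓝 0) := by
      simpa using ENNReal.Tendsto.const_mul ht (Or.inr hC)
    have hε' : (0 : ℝ≥0∞) < ENNReal.ofReal (ε / 2) := by simpa using hε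
    obtain ⟨K, hK⟩ := eventually_atTop.1 (ht2.eventually_lt_const hε')
    refine ⟨K, fun n hn m hm x hx => ?_⟩
    have h1 := hb k hk (fun x => φ n x - φ m x) ((hs n).sub (hs m)) x hx
    have h2 : iteratedFDeriv ℝ k (fun x => φ n x - φ m x) x =
        iteratedFDeriv ℝ k (φ n) x - iteratedFDeriv ℝ k (φ m) x :=
      iteratedFDeriv_sub_apply ((hs n).contDiffAt.of_le (by exact_mod_cast le_top))
        ((hs m).contDiffAt.of_le (by exact_mod_cast le_top))
    rw [h2] at h1
    have h3 : ‖iteratedFDeriv ℝ k (φ n) x - iteratedFDeriv ℝ k (φ m) x‖ₑ < ENNReal.ofReal ε := by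
      refine h1.trans_lt ((mul_le_mul_right
        (jetNorm_seq_cauchy hX hP hw hu (hs n) (hs m)) C).trans_lt ?_)
      rw [mul_add]
      refine (ENNReal.add_lt_add (hK n hn) (hK m hm)).trans_eq ?_
      rw [← ENNReal.ofReal_add (by positivity) (by positivity)]
      congr 1; ring
    rw [dist_eq_norm]
    rw [← ofReal_norm] at h3
    exact (ENNReal.ofReal_lt_ofReal_iff hε).1 h3
  obtain ⟨f, hf, hlim⟩ := exists_contDiffOn_limit hX hs hcau
  refine ⟨f, ?_, hf, φ, hs, hjet, hlim⟩
  have h0 : mlen (0 : MIdx d) ≤ s := by simp [mlen_zero]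
  -- The uniform limit must agree with u. Convergence of the zeroth derivative in the weighted space
  -- gives a subsequence converging almost everywhere for the weighted measure, hence for Lebesgue
  -- measure since the weight w 0 is positive almost everywhere.
  have hnorm : Tendsto (fun n => eLpNorm (fun x => φ n x - weakD X 0 u x) (ENNReal.ofReal P)
      (wMeas X (w 0))) atTop (𝓝 0) := by
    refine tendsto_of_tendsto_of_tendsto_of_le_of_le tendsto_const_nhds ht
      (fun _ => zero_le) fun n => ?_
    have hm : AEStronglyMeasurable (fun x => multiD 0 (φ n) x - weakD X 0 u x)
        (volume.restrict X) :=
      (aestronglyMeasurable_multiD (hs n) 0 _).sub (hu.aestronglyMeasurable_weakD hX h0)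
    have h1 := wLp_le_jetNorm hP w (X := X) (fun j x => multiD j (φ n) x - weakD X j u x) h0
    rw [wLp_eq_eLpNorm' (hw 0 h0) hm, multiD_zero] at h1
    rw [eLpNorm_eq_eLpNorm' (by simpa using hP0) (by simp), ENNReal.toReal_ofReal hP0.le]
    exact h1
  have hmeas : TendstoInMeasure (wMeas X (w 0)) φ atTop (weakD X 0 u) := by
    refine tendstoInMeasure_of_tendsto_eLpNorm (p := ENNReal.ofReal P) (by simpa using hP0)
      (fun n => (hs n).continuous.aestronglyMeasurable)
      ((hu.aestronglyMeasurable_weakD hX h0).mono_ac (wMeas_absolutelyContinuous X _)) ?_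
    exact hnorm
  obtain ⟨ns, hns, hae⟩ := hmeas.exists_seq_tendsto_ae
  have hae' := (absolutelyContinuous_wMeas (hw 0 h0) hw0).ae_le hae
  have hmem : ∀ᵐ x ∂(volume.restrict X), x ∈ X := ae_restrict_mem hX.measurableSet
  filter_upwards [hae', hmem, hu.weakD_zero hX] with x hx hxX hx0
  have h1 := (hlim 0 (Nat.zero_le _) x hxX).comp hns.tendsto_atTop
  have h2 : Tendsto (fun n => φ (ns n) x) atTop (𝓝 (f x)) := by
    have h3 := ((ContinuousMultilinearMap.apply ℝ (fun _ : Fin 0 => Euc d) ℝ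
      (0 : Fin 0 → Euc d)).continuous.tendsto _).comp h1
    simpa [Function.comp_def] using h3
  rw [← hx0]
  exact tendsto_nhds_unique h2 hx

lemma le_mul_of_tendsto_jet {a A : ℕ → ℝ≥0∞} {b B C : ℝ≥0∞} (hC : C ≠ ⊤)
    (ha : Tendsto a atTop (𝓝 b)) (hA : Tendsto A atTop (𝓝 B)) (h : ∀ n, a n ≤ C * A n) :
    b ≤ C * B :=
  le_of_tendsto_of_tendsto' ha (ENNReal.Tendsto.const_mul hA (Or.inr hC)) h

lemma embedsInCr_add {N N' : (Euc d → ℝ) → ℝ≥0∞} {C C' : ℝ≥0∞} (hC : C ≠ ⊤) (hC' : C' ≠ ⊤)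
    (h : ∀ u, MemSobolev X s P w u → ∃ f : Euc d → ℝ,
      f =ᵐ[volume.restrict X] u ∧ ContDiffOn ℝ r f X ∧ N f ≤ C * sobolevNorm X s P w u ∧
        N' f ≤ C' * sobolevNorm X s P w u) :
    EmbedsInCr X s P w r fun f => N f + N' f := by
  refine ⟨(C + C').toNNReal, fun u hu => ?_⟩
  obtain ⟨f, h1, h2, h3, h4⟩ := h u hu
  refine ⟨f, h1, h2, ?_⟩
  rw [ENNReal.coe_toNNReal (by simp [hC, hC']), add_mul]
  exact add_le_add h3 h4

/-- Scaled bounds for smooth functions give the embeddings into the target spaces. -/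
lemma ScaledBound.embedsInTarget (hX : IsModelDomain X) (hd : 1 ≤ d) (hp : 1 ≤ p) (hP : 1 ≤ P)
    (hw : ∀ j, mlen j ≤ s → AEMeasurable (w j) (volume.restrict X))
    (hw0 : ∀ᵐ x ∂(volume.restrict X), 0 < w 0 x)
    (h : ScaledBound X s p wc (jet X s P w)) : EmbedsInTarget X s r p P w wc := by
  have hp0 : 0 < p := by linarith
  have hd0 : (0 : ℝ) < d := by exact_mod_cast hd
  -- the common part of the three cases
  have common : ∀ k, r + k ≤ s → (d / p < k ∨ (p = 1 ∧ d ≤ k)) →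
      ∃ C : ℝ≥0∞, C ≠ ⊤ ∧ (∀ m ≤ r, ∀ φ : Euc d → ℝ, ContDiff ℝ ∞ φ → ∀ a ∈ X,
        ‖iteratedFDeriv ℝ m φ a‖ₑ ≤ C * jet X s P w φ) ∧
      ∀ u, MemSobolev X s P w u → ∃ f : Euc d → ℝ,
        f =ᵐ[volume.restrict X] u ∧ ContDiffOn ℝ r f X ∧
        crNorm X r f ≤ (r + 1 : ℕ) * C * sobolevNorm X s P w u ∧
        weightedSup X wc f ≤ C * sobolevNorm X s P w u ∧
        ∃ φ : ℕ → Euc d → ℝ, (∀ n, ContDiff ℝ ∞ (φ n)) ∧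
        Tendsto (fun n => jet X s P w (φ n)) atTop (𝓝 (sobolevNorm X s P w u)) ∧
        ∀ k ≤ r, ∀ x ∈ X, Tendsto (fun n => iteratedFDeriv ℝ k (φ n) x) atTop
          (𝓝 (iteratedFDerivWithin ℝ k f X x)) := by
    intro k hk hk2
    have h1 : ∀ m, ∃ C : ℝ≥0∞, C ≠ ⊤ ∧ (m ≤ r → ∀ φ : Euc d → ℝ, ContDiff ℝ ∞ φ → ∀ a ∈ X,
        ‖iteratedFDeriv ℝ m φ a‖ₑ ≤ C * jet X s P w φ ∧
        ‖wc a‖ₑ * ‖iteratedFDeriv ℝ m φ a‖ₑ ≤ C * jet X s P w φ) := by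
      intro m
      by_cases hm : m ≤ r
      · obtain ⟨C, hC, H⟩ := h.enorm_le hp (m := m) (k := k) (by omega) hk2
        exact ⟨C, hC, fun _ => H⟩
      · exact ⟨0, by simp, fun h => absurd h hm⟩
    choose C hC H using h1
    set C' := ∑ m ∈ Finset.range (r + 1), C m with hC'
    have hC't : C' ≠ ⊤ := ENNReal.sum_ne_top.2 fun m _ => hC m
    have hle : ∀ m ≤ r, C m ≤ C' := fun m hm =>
      Finset.single_le_sum (f := C) (fun _ _ => zero_le) (Finset.mem_range.2 (by omega))
    have Hb : ∀ m ≤ r, ∀ φ : Euc d → ℝ, ContDiff ℝ ∞ φ → ∀ a ∈ X,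
        ‖iteratedFDeriv ℝ m φ a‖ₑ ≤ C' * jet X s P w φ := fun m hm φ hφ a ha =>
      (H m hm φ hφ a ha).1.trans (by gcongr; exact hle m hm)
    refine ⟨C', hC't, Hb, fun u hu => ?_⟩
    obtain ⟨f, hfu, hf, φ, hφ, hjet, hlim⟩ := hu.exists_contDiffOn hX hP hw hw0 hC't Hb
    refine ⟨f, hfu, hf, ?_, ?_, φ, hφ, hjet, hlim⟩
    · unfold crNorm
      refine (Finset.sum_le_card_nsmul _ _ (C' * sobolevNorm X s P w u) fun m hm => ?_).trans ?_
      · have hm' : m ≤ r := by have := Finset.mem_range.1 hm; omega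
        refine iSup₂_le fun x hx => ?_
        exact le_mul_of_tendsto_jet hC't (hlim m hm' x hx).enorm hjet
          fun n => Hb m hm' _ (hφ n) x hx
      · rw [Finset.card_range, nsmul_eq_mul, mul_assoc]
    · refine iSup₂_le fun x hx => ?_
      have h0 := hlim 0 (Nat.zero_le _) x hx
      have e : ‖f x‖ₑ = ‖iteratedFDerivWithin ℝ 0 f X x‖ₑ := by
        rw [← ofReal_norm, ← ofReal_norm, norm_iteratedFDerivWithin_zero]
      rw [enorm_mul, e]
      refine le_mul_of_tendsto_jet hC't (ENNReal.Tendsto.const_mul h0.enorm (Or.inr (by simp)))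
        hjet fun n => ?_
      exact (H 0 (Nat.zero_le _) _ (hφ n) x hx).2.trans (by gcongr; exact hle 0 (Nat.zero_le _))
  have holder : ∀ k, r + k ≤ s → (d / p < k ∨ (p = 1 ∧ d ≤ k)) → ∀ η : ℝ, 0 < η →
      (∃ C : ℝ≥0∞, C ≠ ⊤ ∧ ∀ φ : Euc d → ℝ, ContDiff ℝ ∞ φ → ∀ x ∈ X, ∀ y ∈ X,
        ‖iteratedFDeriv ℝ r φ x - iteratedFDeriv ℝ r φ y‖ₑ ≤
          C * jet X s P w φ * ‖x - y‖ₑ ^ η) →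
      EmbedsInCr X s P w r fun f => crNorm X r f + holderSeminorm X r η f + weightedSup X wc f := by
    rintro k hk hk2 η hη ⟨C1, hC1, H1⟩
    obtain ⟨C, hC, _, H⟩ := common k hk hk2
    refine embedsInCr_add (N := fun f => crNorm X r f + holderSeminorm X r η f)
      (C := (r + 1 : ℕ) * C + C1) (C' := C)
      (ENNReal.add_ne_top.2 ⟨ENNReal.mul_ne_top (by simp) hC, hC1⟩) hC fun u hu => ?_
    obtain ⟨f, hfu, hf, h1, h2, φ, hφ, hjet, hlim⟩ := H u hu
    refine ⟨f, hfu, hf, ?_, h2⟩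
    rw [add_mul]
    refine add_le_add h1 (iSup₂_le fun x hx => iSup₂_le fun y hy => iSup_le fun hxy => ?_)
    refine ENNReal.div_le_of_le_mul ?_
    have hxt : ‖x - y‖ₑ ^ η ≠ ⊤ := ENNReal.rpow_ne_top_of_nonneg hη.le (by simp)
    rw [mul_right_comm]
    refine le_mul_of_tendsto_jet (ENNReal.mul_ne_top hC1 hxt)
      ((hlim r le_rfl x hx).sub (hlim r le_rfl y hy)).enorm hjet fun n => ?_
    rw [mul_right_comm]
    exact H1 (φ n) (hφ n) x hx y hy
  refine ⟨fun hp1 hdr => ?_, fun η h1 h2 h3 h4 => ?_, fun hp1 hdr => ?_⟩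
  · have hdr' : r + d ≤ s := by
      have : (r : ℝ) + d ≤ s := by linarith
      exact_mod_cast this
    obtain ⟨C, hC, _, H⟩ := common d hdr' (Or.inr ⟨hp1, le_rfl⟩)
    refine embedsInCr_add (C := (r + 1 : ℕ) * C) (C' := C)
      (ENNReal.mul_ne_top (by simp) hC) hC fun u hu => ?_
    obtain ⟨f, hfu, hf, h1, h2, _⟩ := H u hu
    exact ⟨f, hfu, hf, h1, h2⟩
  · have hdp : 0 < (d : ℝ) / p := by positivity
    have hrs : r < s := by
      have : (r : ℝ) < s := by linarith
      exact_mod_cast this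
    obtain ⟨k, rfl⟩ : ∃ k, s = r + (k + 1) := ⟨s - r - 1, by omega⟩
    push_cast at h1 h2 h4
    -- Here s - r = k + 1: the bounds 0 < η < k + 1 - d/p give d/p < k + 1, and k ≤ d/p gives η < 1.
    exact holder (k + 1) le_rfl (Or.inl (by push_cast; linarith)) η h3
      (h.enorm_sub_le hX hd hp le_rfl h3 (by linarith) (by linarith))
  · have hdr' : s = r + 1 + d := by
      have : (s : ℝ) = r + 1 + d := by linarith
      exact_mod_cast this
    refine holder d (by omega) (Or.inr ⟨hp1, le_rfl⟩) 1 one_pos ?_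
    obtain ⟨C, hC, H⟩ := h.enorm_le hp (m := r + 1) (k := d) (by omega) (Or.inr ⟨hp1, le_rfl⟩)
    refine ⟨C, hC, fun φ hφ x hx y hy => ?_⟩
    rw [ENNReal.rpow_one]
    by_cases hj : C * jet X s P w φ = ⊤
    · rw [hj]
      by_cases hxy : x = y
      · simp [hxy]
      · rw [ENNReal.top_mul (by simpa [sub_eq_zero] using hxy)]; exact le_top
    -- With a finite norm the derivative of order r + 1 is bounded on X, and the mean value
    -- inequality on the convex set X gives the Lipschitz bound.
    have hb : ∀ z ∈ X, ‖fderiv ℝ (iteratedFDeriv ℝ r φ) z‖ ≤ (C * jet X s P w φ).toReal := by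
      intro z hz
      rw [norm_fderiv_iteratedFDeriv]
      have := (H φ hφ z hz).1
      rw [← ofReal_norm] at this
      exact (ENNReal.ofReal_le_iff_le_toReal hj).1 this
    have hm := hX.convex.norm_image_sub_le_of_norm_hasFDerivWithin_le
      (fun z _ => (((hφ.contDiff_one_iteratedFDeriv r).differentiable
        (by simp)) z).hasFDerivAt.hasFDerivWithinAt) hb hy hx
    rw [← ofReal_norm, ← ofReal_norm, ← ENNReal.ofReal_toReal hj,
      ← ENNReal.ofReal_mul ENNReal.toReal_nonneg]
    exact ENNReal.ofReal_le_ofReal hm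

end Embedding


/-! ### Scaled bounds from the conditions on annuli. -/

section WeightConditions

variable {d : ℕ} {X : Set (Euc d)}

lemma lpD_le_sum_multiD {p : ℝ} (hp : 1 ≤ p) {φ : Euc d → ℝ} (hφ : ContDiff ℝ ∞ φ) (i : ℕ)
    (Q : Set (Euc d)) :
    lpD i p Q φ ≤ (d : ℝ≥0∞) ^ i * ∑ j ∈ (midxLE d i).filter (fun j => mlen j = i),
      eLpNorm' (multiD j φ) p (volume.restrict Q) := by
  have hp0 : 0 < p := by linarith
  set S := (midxLE d i).filter (fun j => mlen j = i)
  have hm : ∀ j ∈ S, AEStronglyMeasurable (fun x => ‖multiD j φ x‖) (volume.restrict Q) :=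
    fun j _ => (aestronglyMeasurable_multiD hφ j _).norm
  calc lpD i p Q φ ≤ eLpNorm' ((d : ℝ) ^ i • ∑ j ∈ S, fun x => ‖multiD j φ x‖) p
        (volume.restrict Q) := by
        refine eLpNorm'_mono_ae hp0.le (Eventually.of_forall fun x => ?_)
        refine (norm_iteratedFDeriv_le_sum_multiD hφ i x).trans (le_trans ?_ (le_abs_self _))
        simp [S]
    _ = (d : ℝ≥0∞) ^ i * eLpNorm' (∑ j ∈ S, fun x => ‖multiD j φ x‖) p (volume.restrict Q) := by
        rw [eLpNorm'_const_smul _ hp0]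
        congr 1
        rw [enorm_pow, Real.enorm_natCast]
    _ ≤ (d : ℝ≥0∞) ^ i * ∑ j ∈ S, eLpNorm' (fun x => ‖multiD j φ x‖) p (volume.restrict Q) := by
        gcongr
        exact eLpNorm'_sum_le hm hp
    _ = _ := by simp only [eLpNorm'_norm]

/-- Insert W^(1/ρ) W^(-1/ρ) under the integral and apply Hölder's inequality with exponents ρ and
ρ/(ρ - 1). This accounts for the Sobolev exponent pρ and for the power of the integral in (A3). -/
lemma eLpNorm'_le_weighted_holder {E : Set (Euc d)} (hE : E ⊆ X) {p ρ : ℝ} (hp : 1 ≤ p)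
    (hρ : 1 < ρ) {W v : Euc d → ℝ} (hW : AEMeasurable W (volume.restrict X))
    (hpos : ∀ᵐ x ∂(volume.restrict X), 0 < W x) (hv : Continuous v) :
    eLpNorm' v p (volume.restrict E) ≤
      (∫⁻ x in E, ENNReal.ofReal (W x) ^ (-(1 / (ρ - 1)))) ^ ((ρ - 1) / (p * ρ)) *
        wLp X (p * ρ) W v := by
  have hp0 : 0 < p := by linarith
  have hρ0 : 0 < ρ := by linarith
  have hρ1 : 0 < ρ - 1 := by linarith
  have hle : volume.restrict E ≤ volume.restrict X := Measure.restrict_mono hE le_rfl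
  have hWE := (hW.mono_measure hle).ennreal_ofReal
  have hc : ρ.HolderConjugate (ρ / (ρ - 1)) := Real.HolderConjugate.conjExponent hρ
  have key := ENNReal.lintegral_mul_le_Lp_mul_Lq (volume.restrict E) hc
    (f := fun x => ‖v x‖ₑ ^ p * ENNReal.ofReal (W x) ^ (1 / ρ))
    (g := fun x => ENNReal.ofReal (W x) ^ (-(1 / ρ)))
    ((hv.enorm.measurable.pow_const _).aemeasurable.mul (hWE.pow_const _)) (hWE.pow_const _)
  have e1 : ∫⁻ x in E, ‖v x‖ₑ ^ p = ∫⁻ x in E, ((fun x => ‖v x‖ₑ ^ p *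
      ENNReal.ofReal (W x) ^ (1 / ρ)) * fun x => ENNReal.ofReal (W x) ^ (-(1 / ρ))) x := by
    refine lintegral_congr_ae ?_
    filter_upwards [ae_mono hle hpos] with x hx
    simp only [Pi.mul_apply]
    rw [mul_assoc, ← ENNReal.rpow_add _ _ (by simpa using hx) (by simp), add_neg_cancel,
      ENNReal.rpow_zero, mul_one]
  have e2 : ∀ x, (‖v x‖ₑ ^ p * ENNReal.ofReal (W x) ^ (1 / ρ)) ^ ρ =
      ‖v x‖ₑ ^ (p * ρ) * ENNReal.ofReal (W x) := by
    intro x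
    rw [ENNReal.mul_rpow_of_nonneg _ _ hρ0.le, ← ENNReal.rpow_mul, ← ENNReal.rpow_mul,
      one_div_mul_cancel hρ0.ne', ENNReal.rpow_one]
  have e3 : ∀ x, (ENNReal.ofReal (W x) ^ (-(1 / ρ))) ^ (ρ / (ρ - 1)) =
      ENNReal.ofReal (W x) ^ (-(1 / (ρ - 1))) := by
    intro x
    rw [← ENNReal.rpow_mul]
    congr 1; field_simp
  rw [← e1] at key
  simp only [e2, e3] at key
  have h2 := ENNReal.rpow_le_rpow key (z := 1 / p) (by positivity)
  rw [ENNReal.mul_rpow_of_nonneg _ _ (by positivity), ← ENNReal.rpow_mul, ← ENNReal.rpow_mul,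
    mul_comm] at h2
  refine (le_trans (le_of_eq rfl) h2).trans ?_
  have e4 : 1 / (ρ / (ρ - 1)) * (1 / p) = (ρ - 1) / (p * ρ) := by field_simp
  have e5 : 1 / ρ * (1 / p) = 1 / (p * ρ) := by field_simp
  rw [e4, e5]
  gcongr
  exact wLp_mono_set hE (by positivity) W v

/-- The hypothesis on B says that B^p W ≥ 1 on E, wherever W is positive. -/
lemma eLpNorm'_le_weighted_sup {E : Set (Euc d)} (hE : E ⊆ X) (hEm : MeasurableSet E) {p : ℝ}
    (hp : 1 ≤ p) {W v : Euc d → ℝ} (hpos : ∀ᵐ x ∂(volume.restrict X), 0 < W x) {B : ℝ≥0∞}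
    (hBt : B ≠ ⊤) (hB : ∀ x ∈ E, (ENNReal.ofReal (W x))⁻¹ ^ (1 / p) ≤ B) :
    eLpNorm' v p (volume.restrict E) ≤ B * wLp X p W v := by
  have hp0 : 0 < p := by linarith
  have hle : volume.restrict E ≤ volume.restrict X := Measure.restrict_mono hE le_rfl
  refine le_trans ?_ (mul_le_mul_right (wLp_mono_set hE hp0.le W v) B)
  have hBp : B = (B ^ p) ^ (1 / p) := by
    rw [← ENNReal.rpow_mul, mul_one_div_cancel hp0.ne', ENNReal.rpow_one]
  unfold eLpNorm' wLp
  rw [hBp, ← ENNReal.mul_rpow_of_nonneg _ _ (by positivity), ← lintegral_const_mul' _ _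
    (ENNReal.rpow_ne_top_of_nonneg hp0.le hBt)]
  refine ENNReal.rpow_le_rpow (lintegral_mono_ae ?_) (by positivity)
  filter_upwards [ae_mono hle hpos, ae_restrict_mem hEm] with x hx hxE
  have h1 : (ENNReal.ofReal (W x))⁻¹ ≤ B ^ p := by
    have := ENNReal.rpow_le_rpow (hB x hxE) hp0.le
    rwa [← ENNReal.rpow_mul, one_div_mul_cancel hp0.ne', ENNReal.rpow_one] at this
  have hW0 : ENNReal.ofReal (W x) ≠ 0 := by simpa using hx
  calc ‖v x‖ₑ ^ p = (ENNReal.ofReal (W x))⁻¹ * ENNReal.ofReal (W x) * ‖v x‖ₑ ^ p := by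
        rw [ENNReal.inv_mul_cancel hW0 (by simp), one_mul]
    _ ≤ B ^ p * ENNReal.ofReal (W x) * ‖v x‖ₑ ^ p := by gcongr
    _ = _ := by ring

lemma exists_bound_of_limsup {F : ℝ → ℝ≥0∞} (h : limsup F atTop < ⊤) :
    ∃ M : ℝ≥0∞, M ≠ ⊤ ∧ ∀ᶠ R in atTop, F R ≤ M := by
  obtain ⟨M, h1, h2⟩ := exists_between h
  exact ⟨M, h2.ne, (eventually_lt_of_limsup_lt h1).mono fun _ h => h.le⟩

lemma measurableSet_annulus (hX : IsModelDomain X) (R : ℝ) : MeasurableSet (annulus X R) := by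
  have : annulus X R = X ∩ {x | R ≤ ‖x‖} ∩ {x | ‖x‖ ≤ 2 * R} := by
    ext x; simp only [annulus, mem_ofPred_eq, mem_inter_iff, and_assoc]
  rw [this]
  exact (hX.measurableSet.inter (measurableSet_le measurable_const measurable_norm)).inter
    (measurableSet_le measurable_norm measurable_const)

lemma exists_uniform_bound {ι : Type*} (S : Finset ι) {F : ι → ℝ → ℝ≥0∞}
    (h : ∀ i ∈ S, limsup (F i) atTop < ⊤) :
    ∃ M : ℝ≥0∞, M ≠ ⊤ ∧ ∀ᶠ R in atTop, ∀ i ∈ S, F i R ≤ M := by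
  have h' : ∀ i, ∃ M : ℝ≥0∞, M ≠ ⊤ ∧ (i ∈ S → ∀ᶠ R in atTop, F i R ≤ M) := by
    intro i
    by_cases hi : i ∈ S
    · obtain ⟨M, h1, h2⟩ := exists_bound_of_limsup (h i hi)
      exact ⟨M, h1, fun _ => h2⟩
    · exact ⟨0, by simp, fun h => absurd h hi⟩
  choose M hM hb using h'
  refine ⟨∑ i ∈ S, M i, ENNReal.sum_ne_top.2 fun i _ => hM i, ?_⟩
  rw [eventually_all_finset]
  exact fun i hi => (hb i hi).mono fun R hR =>
    hR.trans (Finset.single_le_sum (f := M) (fun _ _ => zero_le) hi)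

/-- Local and annular control of unweighted norms by weighted norms gives scaled bounds. -/
lemma scaledBound_of_annulus (hX : IsModelDomain X) (hd : 1 ≤ d) {s : ℕ} {p P : ℝ} (hp : 1 ≤ p)
    (hP : 1 ≤ P) {w : MIdx d → Euc d → ℝ} {wc : Euc d → ℝ} (hwc : BddOnBalls X wc)
    (B : MIdx d → Set (Euc d) → ℝ≥0∞)
    (hB : ∀ i, mlen i ≤ s → ∀ E ⊆ X, MeasurableSet E → B i E ≠ ⊤ → ∀ v : Euc d → ℝ,
      Continuous v → eLpNorm' v p (volume.restrict E) ≤ B i E * wLp X P (w i) v)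
    (hloc : ∀ i, mlen i ≤ s → ∀ R, B i (X ∩ Metric.ball 0 R) ≠ ⊤)
    (hann : ∀ g ∈ ({wc, fun _ => 1} : Set (Euc d → ℝ)), ∀ i, mlen i ≤ s →
      limsup (fun R : ℝ => ENNReal.ofReal (R ^ ((mlen i : ℝ) - d / p)) *
        (⨆ x ∈ annulus X R, ‖g x‖ₑ) * B i (annulus X R)) atTop < ⊤) :
    ScaledBound X s p wc (jet X s P w) := by
  have hd0 : (0 : ℝ) < d := by exact_mod_cast hd
  have hd1 : (1 : ℝ) ≤ d := by exact_mod_cast hd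
  obtain ⟨M1, hM1, h1⟩ := exists_uniform_bound (midxLE d s)
    fun i hi => hann wc (by simp) i (mem_midxLE.1 hi)
  obtain ⟨M2, hM2, h2⟩ := exists_uniform_bound (midxLE d s)
    fun i hi => hann (fun _ => 1) (by simp) i (mem_midxLE.1 hi)
  -- Beyond R0 all annular bounds hold at once. The threshold R1 is also at least 2d, which makes
  -- the cubes chosen below have side at least 1; Rb bounds the ball that contains the unit cubes at
  -- the remaining points.
  obtain ⟨R0, hR0⟩ := eventually_atTop.1 (h1.and h2)
  set R1 := max R0 (2 * d) with hR1
  have hR1d : 2 * (d : ℝ) ≤ R1 := le_max_right _ _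
  set Rb := 3 / 2 * R1 + d + 1 with hRb
  obtain ⟨Cw, hCw⟩ := hwc Rb
  set n := (midxLE d s).card
  -- K absorbs the powers of 2d that arise when δ = R/(2d) replaces R, whatever the sign of i - d/p.
  set K : ℝ≥0∞ := ∑ i ∈ Finset.range (s + 1), ENNReal.ofReal ((2 * d : ℝ) ^ (-((i : ℝ) - d / p)))
    with hK
  have hKt : K ≠ ⊤ := ENNReal.sum_ne_top.2 fun _ _ => ENNReal.ofReal_ne_top
  have hKle : ∀ i ≤ s, ENNReal.ofReal ((2 * d : ℝ) ^ (-((i : ℝ) - d / p))) ≤ K := fun i hi =>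
    Finset.single_le_sum (f := fun i : ℕ => ENNReal.ofReal ((2 * d : ℝ) ^ (-((i : ℝ) - d / p))))
      (fun _ _ => zero_le) (Finset.mem_range.2 (by omega))
  set L : ℝ≥0∞ := ∑ i ∈ midxLE d s, B i (X ∩ Metric.ball 0 Rb) with hL
  have hLt : L ≠ ⊤ := ENNReal.sum_ne_top.2 fun i hi => hloc i (mem_midxLE.1 hi) _
  set A : ℝ≥0∞ := K * (M1 + M2) + (1 + ENNReal.ofReal Cw) * L with hA
  have hAt : A ≠ ⊤ := ENNReal.add_ne_top.2 ⟨ENNReal.mul_ne_top hKt (by simp [hM1, hM2]),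
    ENNReal.mul_ne_top (by simp) hLt⟩
  have hnd : ∀ i ≤ s, (d : ℝ≥0∞) ^ i ≤ (d : ℝ≥0∞) ^ s := fun i hi =>
    pow_le_pow_right₀ (by exact_mod_cast hd) hi
  -- the bound for the individual partial derivatives
  suffices H : ∀ a ∈ X, ∃ δ : ℝ, 1 ≤ δ ∧ ∀ φ : Euc d → ℝ, ContDiff ℝ ∞ φ →
      ∀ j, mlen j ≤ s → ∀ c : ℝ≥0∞, (c = 1 ∨ c = ‖wc a‖ₑ) →
        c * (ENNReal.ofReal δ ^ ((mlen j : ℝ) - d / p) *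
          eLpNorm' (multiD j φ) p (volume.restrict (cube a δ))) ≤ A * jet X s P w φ by
    refine ⟨(d : ℝ≥0∞) ^ s * (n * A),
      ENNReal.mul_ne_top (by simp) (ENNReal.mul_ne_top (by simp) hAt), fun a ha => ?_⟩
    obtain ⟨δ, hδ, Hδ⟩ := H a ha
    refine ⟨δ, hδ, fun φ hφ i hi => ?_⟩
    have key : ∀ c : ℝ≥0∞, (c = 1 ∨ c = ‖wc a‖ₑ) →
        c * (ENNReal.ofReal δ ^ ((i : ℝ) - d / p) * lpD i p (cube a δ) φ) ≤
          (d : ℝ≥0∞) ^ s * (n * A) * jet X s P w φ := by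
      intro c hc
      set S := (midxLE d i).filter (fun j => mlen j = i) with hS
      calc c * (ENNReal.ofReal δ ^ ((i : ℝ) - d / p) * lpD i p (cube a δ) φ)
          ≤ c * (ENNReal.ofReal δ ^ ((i : ℝ) - d / p) * ((d : ℝ≥0∞) ^ i *
            ∑ j ∈ S, eLpNorm' (multiD j φ) p (volume.restrict (cube a δ)))) := by
            gcongr
            exact lpD_le_sum_multiD hp hφ i _
        _ = (d : ℝ≥0∞) ^ i * ∑ j ∈ S, c * (ENNReal.ofReal δ ^ ((i : ℝ) - d / p) *
              eLpNorm' (multiD j φ) p (volume.restrict (cube a δ))) := by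
            rw [← Finset.mul_sum, ← Finset.mul_sum]; ring
        _ ≤ (d : ℝ≥0∞) ^ s * (n * (A * jet X s P w φ)) := by
            refine mul_le_mul' (hnd i hi) ?_
            · refine (Finset.sum_le_card_nsmul _ _ (A * jet X s P w φ) fun j hj => ?_).trans ?_
              · have hji : mlen j = i := (Finset.mem_filter.1 hj).2
                have := Hδ φ hφ j (by omega) c hc
                rwa [hji] at this
              · rw [nsmul_eq_mul]
                gcongr
                refine (Finset.card_filter_le _ _).trans (Finset.card_le_card fun j hj => ?_)
                rw [mem_midxLE] at hj ⊢
                omega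
        _ = _ := by ring
    exact ⟨by simpa using key 1 (Or.inl rfl), key _ (Or.inr rfl)⟩
  intro a ha
  have hjet : ∀ φ : Euc d → ℝ, ∀ j, mlen j ≤ s → wLp X P (w j) (multiD j φ) ≤ jet X s P w φ :=
    fun φ j hj => wLp_le_jetNorm hP w (fun j => multiD j φ) hj
  by_cases haR : 3 / 2 * R1 ≤ ‖a‖
  -- Now |a| = 3R/2 is the middle of the annulus, and a cube of side R/(2d) has diameter at most
  -- R/2, so it stays in the annulus.
  · set R := 2 / 3 * ‖a‖ with hR
    have hRR1 : R1 ≤ R := by rw [hR]; linarith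
    have hRpos : 0 < R := by linarith
    set δ := R / (2 * d) with hδ
    have hδ1 : 1 ≤ δ := by rw [hδ, le_div_iff₀ (by positivity)]; linarith
    have hcell := isCell_cube a (show 0 < δ by linarith)
    have haann : a ∈ annulus X R := ⟨ha, by rw [hR]; linarith [norm_nonneg a],
      by rw [hR]; linarith [norm_nonneg a]⟩
    have hsub : cube a δ ⊆ annulus X R := by
      intro x hx
      have h := hcell.diam x hx a fun k => ⟨le_rfl, by linarith⟩
      have h' : d * δ = R / 2 := by rw [hδ]; field_simp
      rw [h'] at h
      have h3 := abs_le.1 ((abs_norm_sub_norm_le x a).trans h)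
      have h4 : ‖a‖ = 3 / 2 * R := by rw [hR]; ring
      exact ⟨hX.cube_subset ha δ hx, by linarith [h3.1], by linarith [h3.2]⟩
    refine ⟨δ, hδ1, fun φ hφ j hj c hc => ?_⟩
    obtain ⟨hb1, hb2⟩ := hR0 R ((le_max_left _ _).trans hRR1)
    have hb1 := hb1 j (mem_midxLE.2 hj)
    have hb2 := hb2 j (mem_midxLE.2 hj)
    have hb : ENNReal.ofReal (R ^ ((mlen j : ℝ) - d / p)) * c * B j (annulus X R) ≤ M1 + M2 := by
      rcases hc with rfl | rfl
      · refine le_trans ?_ (hb2.trans le_add_self)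
        gcongr
        exact le_iSup₂_of_le a haann (by simp)
      · refine le_trans ?_ (hb1.trans le_self_add)
        gcongr
        exact le_iSup₂_of_le (f := fun x _ => ‖wc x‖ₑ) a haann le_rfl
    have hδe : ENNReal.ofReal δ ^ ((mlen j : ℝ) - d / p) ≤
        K * ENNReal.ofReal (R ^ ((mlen j : ℝ) - d / p)) := by
      rw [ENNReal.ofReal_rpow_of_pos (by linarith), hδ, div_eq_mul_inv,
        Real.mul_rpow hRpos.le (by positivity), ENNReal.ofReal_mul (by positivity), mul_comm,
        Real.inv_rpow (by positivity), ← Real.rpow_neg (by positivity)]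
      gcongr
      exact hKle _ hj
    by_cases hBt : B j (annulus X R) = ⊤
    · -- then the bound forces the constant `c` to vanish
      have hR' : ENNReal.ofReal (R ^ ((mlen j : ℝ) - d / p)) ≠ 0 := by
        have := Real.rpow_pos_of_pos hRpos ((mlen j : ℝ) - d / p)
        simpa using this
      have hc0 : c = 0 := by
        by_contra hc0
        rw [hBt, ENNReal.mul_top (mul_ne_zero hR' hc0), top_le_iff] at hb
        exact (ENNReal.add_ne_top.2 ⟨hM1, hM2⟩) hb
      rw [hc0, zero_mul]; exact zero_le
    have hv := (eLpNorm'_mono_measure (multiD j φ) (Measure.restrict_mono hsub le_rfl)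
      (by linarith)).trans (hB j hj _ (fun x hx => hx.1) (measurableSet_annulus hX R) hBt
      (multiD j φ) (contDiff_multiD hφ j).continuous)
    calc c * (ENNReal.ofReal δ ^ ((mlen j : ℝ) - d / p) *
          eLpNorm' (multiD j φ) p (volume.restrict (cube a δ)))
        ≤ c * (K * ENNReal.ofReal (R ^ ((mlen j : ℝ) - d / p)) *
          (B j (annulus X R) * jet X s P w φ)) := by
          gcongr
          exact hv.trans (by gcongr; exact hjet φ j hj)
      _ = K * (ENNReal.ofReal (R ^ ((mlen j : ℝ) - d / p)) * c * B j (annulus X R)) *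
          jet X s P w φ := by ring
      _ ≤ K * (M1 + M2) * jet X s P w φ := by gcongr
      _ ≤ _ := by gcongr; exact le_self_add
  -- The remaining corners lie in a bounded set: their unit cubes stay in one ball, on which wc and
  -- the local constants are bounded.
  · push Not at haR
    have hcell := isCell_cube a one_pos
    have hsub : cube a 1 ⊆ X ∩ Metric.ball 0 Rb := by
      intro x hx
      have h := hcell.diam x hx a fun k => ⟨le_rfl, by linarith⟩
      have h3 := abs_le.1 ((abs_norm_sub_norm_le x a).trans h)
      refine ⟨hX.cube_subset ha 1 hx, ?_⟩
      rw [mem_ball_zero_iff, hRb]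
      linarith [h3.2]
    refine ⟨1, le_rfl, fun φ hφ j hj c hc => ?_⟩
    have hcle : c ≤ 1 + ENNReal.ofReal Cw := by
      rcases hc with rfl | rfl
      · exact le_self_add
      · refine le_trans ?_ le_add_self
        rw [← ofReal_norm]
        exact ENNReal.ofReal_le_ofReal (hCw a ha (by rw [hRb]; linarith))
    have hv := (eLpNorm'_mono_measure (multiD j φ) (Measure.restrict_mono hsub le_rfl)
      (by linarith)).trans (hB j hj _ inter_subset_left
      (hX.measurableSet.inter measurableSet_ball) (hloc j hj Rb)
      (multiD j φ) (contDiff_multiD hφ j).continuous)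
    have hBL : B j (X ∩ Metric.ball 0 Rb) ≤ L :=
      Finset.single_le_sum (f := fun i => B i (X ∩ Metric.ball 0 Rb)) (fun _ _ => zero_le)
        (mem_midxLE.2 hj)
    rw [ENNReal.ofReal_one, ENNReal.one_rpow, one_mul]
    calc c * eLpNorm' (multiD j φ) p (volume.restrict (cube a 1))
        ≤ (1 + ENNReal.ofReal Cw) * (L * jet X s P w φ) := by
          gcongr
          exact hv.trans (by gcongr; exact hjet φ j hj)
      _ = (1 + ENNReal.ofReal Cw) * L * jet X s P w φ := by ring
      _ ≤ _ := by gcongr; exact le_add_self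

lemma IsWeight.aemeasurable {W : Euc d → ℝ} (h : IsWeight X W) :
    AEMeasurable W (volume.restrict X) := h.1.aestronglyMeasurable.aemeasurable

lemma embedsInTarget_of_integralCond (hX : IsModelDomain X) (hd : 1 ≤ d) {s r : ℕ} {p ρ : ℝ}
    (hp : 1 ≤ p) (hρ : 1 < ρ) {w : MIdx d → Euc d → ℝ} {wc : Euc d → ℝ}
    (hw : ∀ i, mlen i ≤ s → IsWeight X (w i)) (hwc : BddOnBalls X wc)
    (h1 : AnnulusIntegralCond X s p ρ wc w) (h2 : AnnulusIntegralCond X s p ρ (fun _ => 1) w)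
    (h3 : LocBddAndB X s ρ w) : EmbedsInTarget X s r p (p * ρ) w wc := by
  have hP : 1 ≤ p * ρ := by nlinarith
  have hp0 : 0 < p := by linarith
  have hρ1 : 0 < ρ - 1 := by linarith
  refine ScaledBound.embedsInTarget hX hd hp hP (fun j hj => (hw j hj).aemeasurable)
    (hw 0 (by simp [mlen_zero])).2 ?_
  refine scaledBound_of_annulus hX hd hp hP hwc
    (fun i E => (∫⁻ x in E, ENNReal.ofReal (w i x) ^ (-(1 / (ρ - 1)))) ^ ((ρ - 1) / (p * ρ)))
    (fun i hi E hE _ _ v hv => eLpNorm'_le_weighted_holder hE hp hρ (hw i hi).aemeasurable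
      (hw i hi).2 hv) (fun i hi R => ?_) ?_
  · refine ENNReal.rpow_ne_top_of_nonneg (by positivity) ?_
    have hint : IntegrableOn (fun x => w i x ^ (-(1 / (ρ - 1)))) (X ∩ Metric.closedBall 0 R) :=
      (h3 i hi).2.integrableOn_compact_subset inter_subset_left
        ((isCompact_closedBall 0 R).inter_left hX.isClosed)
    have hlt := (hint.mono_set (inter_subset_inter_right X Metric.ball_subset_closedBall)
      ).lintegral_lt_top
    refine (lt_of_eq_of_lt (lintegral_congr_ae ?_) hlt).ne
    filter_upwards [ae_mono (Measure.restrict_mono inter_subset_left le_rfl) (hw i hi).2] with x hx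
    exact ENNReal.ofReal_rpow_of_pos hx
  · intro g hg i hi
    rcases hg with rfl | rfl
    · exact h1 i hi
    · exact h2 i hi

lemma embedsInTarget_of_supCond (hX : IsModelDomain X) (hd : 1 ≤ d) {s r : ℕ} {p : ℝ}
    (hp : 1 ≤ p) {w : MIdx d → Euc d → ℝ} {wc : Euc d → ℝ}
    (hw : ∀ i, mlen i ≤ s → IsWeight X (w i)) (hwc : BddOnBalls X wc)
    (hA1 : LowerBddLocBdd X s w) (h1 : AnnulusSupCond X s p wc w)
    (h2 : AnnulusSupCond X s p (fun _ => 1) w) : EmbedsInTarget X s r p p w wc := by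
  refine ScaledBound.embedsInTarget hX hd hp hp (fun j hj => (hw j hj).aemeasurable)
    (hw 0 (by simp [mlen_zero])).2 ?_
  obtain ⟨⟨c, hc, hcw⟩, _⟩ := hA1
  refine scaledBound_of_annulus hX hd hp hp hwc
    (fun i E => ⨆ x ∈ E, (ENNReal.ofReal (w i x))⁻¹ ^ (1 / p))
    (fun i hi E hE hEm hBt v _ => eLpNorm'_le_weighted_sup hE hEm hp (hw i hi).2 hBt
      fun x hx => le_iSup₂_of_le (f := fun x _ => (ENNReal.ofReal (w i x))⁻¹ ^ (1 / p)) x hx le_rfl)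
    (fun i hi R => ?_) ?_
  · have hb : (ENNReal.ofReal c)⁻¹ ^ (1 / p) ≠ ⊤ :=
      ENNReal.rpow_ne_top_of_nonneg (by positivity) (by simpa using hc)
    refine ne_top_of_le_ne_top hb (iSup₂_le fun x hx => ?_)
    gcongr
    exact hcw i hi x hx.1
  · intro g hg i hi
    rcases hg with rfl | rfl
    · exact h1 i hi
    · exact h2 i hi

end WeightConditions


/-! ### Grids adapted to the domain. -/

section Grid

variable {d : ℕ} {X : Set (Euc d)}

lemma ENNReal.sum_rpow_le_rpow_sum {ι : Type*} (S : Finset ι) (a : ι → ℝ≥0∞) {t : ℝ}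
    (ht : 1 ≤ t) : ∑ i ∈ S, a i ^ t ≤ (∑ i ∈ S, a i) ^ t := by
  classical
  induction S using Finset.induction_on with
  | empty => simp
  | insert j S hj ih =>
    rw [Finset.sum_insert hj, Finset.sum_insert hj]
    exact (add_le_add le_rfl ih).trans (ENNReal.add_rpow_le_rpow_add _ _ ht)

lemma pairwiseDisjoint_gridCell {δ : ℝ} (hδ : 0 < δ) (Z : Set (Fin d → ℤ)) :
    Z.PairwiseDisjoint (gridCell (d := d) δ) := by
  intro z _ z' _ hne
  refine Set.disjoint_left.2 fun x hx hx' => hne ?_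
  rw [mem_gridCell_iff hδ] at hx hx'
  rw [hx, hx']

/-- The coordinate hyperplanes are unions of faces of the grid, so a cell that meets the orthant
lies in it. -/
lemma IsModelDomain.gridCell_subset (hX : IsModelDomain X) {δ : ℝ} (hδ : 0 < δ) {z : Fin d → ℤ}
    {x : Euc d} (hx : x ∈ X) (hxz : x ∈ gridCell δ z) : gridCell δ z ⊆ X := by
  rcases hX with rfl | rfl
  · exact subset_univ _
  · intro y hy k
    have h1 := (mem_gridCell_iff hδ).1 hxz
    have h2 : (0 : ℝ) ≤ z k := by
      rw [h1]
      exact_mod_cast Int.floor_nonneg.2 (div_nonneg (hx k) hδ.le)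
    exact (mul_nonneg h2 hδ.le).trans (hy k).1

lemma exists_grid_cover (hX : IsModelDomain X) {δ : ℝ} (hδ : 0 < δ) (hδ1 : δ ≤ 1) (R : ℝ) :
    ∃ Z : Finset (Fin d → ℤ), X ∩ Metric.ball 0 R ⊆ ⋃ z ∈ Z, gridCell δ z ∧
      ∀ z ∈ Z, gridCell δ z ⊆ X ∩ Metric.ball 0 (R + d) := by
  classical
  set Z := (Fintype.piFinset fun _ : Fin d => Finset.Icc ⌊-R / δ⌋ ⌊R / δ⌋).filter
    fun z => ∃ x ∈ X ∩ Metric.ball (0 : Euc d) R, x ∈ gridCell δ z with hZ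
  refine ⟨Z, fun x hx => ?_, fun z hz => ?_⟩
  · have hxz : x ∈ gridCell δ fun k => ⌊x k / δ⌋ := (mem_gridCell_iff hδ).2 rfl
    refine mem_biUnion (x := fun k => ⌊x k / δ⌋) ?_ hxz
    rw [Finset.mem_coe, hZ, Finset.mem_filter, Fintype.mem_piFinset]
    refine ⟨fun k => ?_, x, hx, hxz⟩
    have h1 : ‖x‖ < R := mem_ball_zero_iff.1 hx.2
    have h2 := abs_le.1 ((PiLp.norm_apply_le x k).trans h1.le)
    rw [Finset.mem_Icc]
    exact ⟨Int.floor_le_floor (div_le_div_of_nonneg_right h2.1 hδ.le),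
      Int.floor_le_floor (div_le_div_of_nonneg_right h2.2 hδ.le)⟩
  · obtain ⟨x, hx, hxz⟩ := (Finset.mem_filter.1 hz).2
    refine fun y hy => ⟨hX.gridCell_subset hδ hx.1 hxz hy, ?_⟩
    have h1 : ‖x‖ < R := mem_ball_zero_iff.1 hx.2
    have h2 := (isCell_gridCell hδ z).diam y hy x hxz
    have h3 : d * δ ≤ d := mul_le_of_le_one_right (by positivity) hδ1
    rw [mem_ball_zero_iff]
    have := norm_le_norm_add_norm_sub' y x
    linarith

lemma eLpNorm'_biUnion_gridCell {F : Type*} [NormedAddCommGroup F] {δ : ℝ} (hδ : 0 < δ)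
    (Z : Finset (Fin d → ℤ)) {q : ℝ} (hq : 0 < q) (g : Euc d → F) :
    eLpNorm' g q (volume.restrict (⋃ z ∈ Z, gridCell δ z)) =
      (∑ z ∈ Z, eLpNorm' g q (volume.restrict (gridCell δ z)) ^ q) ^ (1 / q) := by
  unfold eLpNorm'
  rw [lintegral_biUnion_finset (pairwiseDisjoint_gridCell hδ _)
    fun z _ => (isCell_gridCell hδ z).meas]
  congr 1
  refine Finset.sum_congr rfl fun z _ => ?_
  rw [← ENNReal.rpow_mul, one_div_mul_cancel hq.ne', ENNReal.rpow_one]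

lemma eLpNorm'_biUnion_gridCell_le_sum {F : Type*} [NormedAddCommGroup F] {δ : ℝ} (hδ : 0 < δ)
    (Z : Finset (Fin d → ℤ)) {q : ℝ} (hq : 1 ≤ q) (g : Euc d → F) :
    eLpNorm' g q (volume.restrict (⋃ z ∈ Z, gridCell δ z)) ≤
      ∑ z ∈ Z, eLpNorm' g q (volume.restrict (gridCell δ z)) := by
  have hq0 : 0 < q := by linarith
  rw [eLpNorm'_biUnion_gridCell hδ Z hq0, one_div, ENNReal.rpow_inv_le_iff hq0]
  exact ENNReal.sum_rpow_le_rpow_sum _ _ hq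

end Grid

/-! ### Local Sobolev and Rellich estimates for smooth functions. -/

section LocalSobolev

variable {d : ℕ} {X : Set (Euc d)} {s : ℕ} {p : ℝ} {w : MIdx d → Euc d → ℝ}

lemma eLpNorm'_le_wLp_of_le {E : Set (Euc d)} (hE : E ⊆ X) (hEm : MeasurableSet E) {c : ℝ}
    (hc : 0 < c) {W : Euc d → ℝ} (hW : ∀ x ∈ X, c ≤ W x) (hp : 1 ≤ p)
    (v : Euc d → ℝ) :
    eLpNorm' v p (volume.restrict E) ≤ (ENNReal.ofReal c)⁻¹ ^ (1 / p) * wLp E p W v := by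
  have hp0 : 0 < p := by linarith
  refine eLpNorm'_le_weighted_sup (X := E) le_rfl hEm hp ?_
    (ENNReal.rpow_ne_top_of_nonneg (by positivity) (by simpa using hc)) fun x hx => ?_
  · filter_upwards [ae_restrict_mem hEm] with x hx
    exact hc.trans_le (hW x (hE hx))
  · gcongr
    exact hW x (hE hx)

/-- The lower bound on the weights lets the weighted norm control the unweighted L^p norms on all of
X. -/
lemma LowerBddLocBdd.lpD_le_jet (hX : IsModelDomain X) (hA : LowerBddLocBdd X s w) (hp : 1 ≤ p) :
    ∃ C : ℝ≥0∞, C ≠ ⊤ ∧ ∀ φ : Euc d → ℝ, ContDiff ℝ ∞ φ → ∀ i ≤ s,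
      lpD i p X φ ≤ C * jet X s p w φ := by
  obtain ⟨⟨c, hc, hcw⟩, _⟩ := hA
  set K := (ENNReal.ofReal c)⁻¹ ^ (1 / p) with hK
  have hKt : K ≠ ⊤ := ENNReal.rpow_ne_top_of_nonneg (by positivity) (by simpa using hc)
  refine ⟨∑ i ∈ Finset.range (s + 1), (d : ℝ≥0∞) ^ i * ((midxLE d i).card * K),
    ENNReal.sum_ne_top.2 fun i _ => ENNReal.mul_ne_top (by simp)
      (ENNReal.mul_ne_top (by simp) hKt), fun φ hφ i hi => ?_⟩
  have h1 : lpD i p X φ ≤ (d : ℝ≥0∞) ^ i * ((midxLE d i).card * K) * jet X s p w φ := by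
    refine (lpD_le_sum_multiD hp hφ i X).trans ?_
    rw [mul_assoc]
    refine mul_le_mul_right ?_ _
    refine (Finset.sum_le_card_nsmul _ _ (K * jet X s p w φ) fun j hj => ?_).trans ?_
    · have hj' : mlen j ≤ s := by rw [(Finset.mem_filter.1 hj).2]; exact hi
      refine (eLpNorm'_le_wLp_of_le le_rfl hX.measurableSet hc (hcw j hj') hp _).trans ?_
      refine mul_le_mul_right ?_ _
      exact wLp_le_jetNorm hp w (fun j => multiD j φ) hj'
    · rw [nsmul_eq_mul, mul_assoc]
      gcongr
      exact Finset.filter_subset _ _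
  refine h1.trans ?_
  gcongr
  exact Finset.single_le_sum (f := fun i => (d : ℝ≥0∞) ^ i * ((midxLE d i).card * K))
    (fun _ _ => zero_le) (Finset.mem_range.2 (by omega))

lemma lpD_mono_set {m : ℕ} {q : ℝ} (hq : 0 ≤ q) {E E' : Set (Euc d)} (h : E ⊆ E')
    (φ : Euc d → ℝ) : lpD m q E φ ≤ lpD m q E' φ :=
  eLpNorm'_mono_measure _ (Measure.restrict_mono h le_rfl) hq

/-- The cell inequality is applied on a unit grid covering the ball; only finitely many cells occur,
so crude summation suffices. -/
lemma LowerBddLocBdd.lpD_ball_le_jet (hX : IsModelDomain X) (hA : LowerBddLocBdd X s w)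
    {θ : ℝ} (hθ : d * θ < 1) {k m : ℕ} (hmk : m + k ≤ s) {q : ℝ} (hp : 1 ≤ p) (hpq : p ≤ q)
    (h : 1 / p - 1 / q ≤ k * θ) (R : ℝ) :
    ∃ C : ℝ≥0∞, C ≠ ⊤ ∧ ∀ φ : Euc d → ℝ, ContDiff ℝ ∞ φ →
      lpD m q (X ∩ Metric.ball 0 R) φ ≤ C * jet X s p w φ := by
  obtain ⟨C0, hC0, H0⟩ := hA.lpD_le_jet hX hp
  obtain ⟨C1, hC1, H1⟩ := lpD_le_lpDSum d hθ k hp hpq h m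
  obtain ⟨Z, hZ1, hZ2⟩ := exists_grid_cover hX one_pos le_rfl R
  refine ⟨Z.card * (C1 * ((k + 1 : ℕ) * C0)), ENNReal.mul_ne_top (by simp)
    (ENNReal.mul_ne_top hC1 (ENNReal.mul_ne_top (by simp) hC0)), fun φ hφ => ?_⟩
  refine (lpD_mono_set (by linarith) hZ1 φ).trans ?_
  refine (eLpNorm'_biUnion_gridCell_le_sum one_pos Z (by linarith) _).trans ?_
  refine (Finset.sum_le_card_nsmul _ _ (C1 * ((k + 1 : ℕ) * C0) * jet X s p w φ)
    fun z hz => ?_).trans ?_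
  · refine (H1 1 _ (isCell_gridCell one_pos z) φ hφ).trans ?_
    rw [ENNReal.ofReal_one, ENNReal.one_rpow, mul_one, mul_assoc]
    refine mul_le_mul_right ?_ _
    unfold lpDSum
    refine (Finset.sum_le_card_nsmul _ _ (C0 * jet X s p w φ) fun j hj => ?_).trans ?_
    · rw [ENNReal.ofReal_one, one_pow, one_mul]
      have := Finset.mem_range.1 hj
      exact (lpD_mono_set (by linarith) ((hZ2 z hz).trans inter_subset_left) φ).trans
        (H0 φ hφ _ (by omega))
    · rw [Finset.card_range, nsmul_eq_mul, mul_assoc]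
  · rw [nsmul_eq_mul]
    exact le_of_eq (by ring)

lemma norm_fderiv_multiD_le {φ : Euc d → ℝ} (hφ : ContDiff ℝ ∞ φ) (j : MIdx d) (x : Euc d) :
    ‖fderiv ℝ (multiD j φ) x‖ ≤ ‖iteratedFDeriv ℝ (mlen j + 1) φ x‖ := by
  rw [← norm_fderiv_iteratedFDeriv]
  refine ContinuousLinearMap.opNorm_le_bound _ (by positivity) fun v => ?_
  have e : multiD j φ = fun y => iteratedFDeriv ℝ (midxList j).length φ y
      (fun k => EuclideanSpace.single ((midxList j).get k) (1 : ℝ)) :=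
    funext fun y => multiD_eq_iteratedFDeriv hφ j y
  have hd : DifferentiableAt ℝ (iteratedFDeriv ℝ (midxList j).length φ) x :=
    (hφ.contDiff_one_iteratedFDeriv _).differentiable (by simp) x
  rw [e, fderiv_continuousMultilinear_apply_const_apply hd, ← length_midxList]
  refine (ContinuousMultilinearMap.le_opNorm _ _).trans ?_
  simp only [List.get_eq_getElem, PiLp.norm_single, norm_one, Finset.prod_const_one,
    mul_one]
  exact ContinuousLinearMap.le_opNorm _ _

/-- Up to an error `ε`, the `L^q` norm of a lower order derivative on a bounded set is controlled by
finitely many means. -/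
lemma LowerBddLocBdd.rellich_estimate (hX : IsModelDomain X) (hd : 1 ≤ d)
    (hA : LowerBddLocBdd X s w) {k l : ℕ} (hs : l + (k + 1) ≤ s) {q : ℝ} (hp : 1 ≤ p) (hq : 1 ≤ q)
    (hpq : 1 / p - 1 / q < (k + 1 : ℕ) / d) (R : ℝ) {j : MIdx d} (hj : mlen j ≤ l)
    {ε : ℝ≥0∞} (hε : 0 < ε) :
    ∃ (n : ℕ) (Z : Finset (Fin d → ℤ)) (C : ℝ≥0∞), C ≠ ⊤ ∧
      (∀ z ∈ Z, gridCell (1 / ((n : ℝ) + 1)) z ⊆ X) ∧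
      ∀ φ : Euc d → ℝ, ContDiff ℝ ∞ φ →
        eLpNorm' (multiD j φ) q (volume.restrict (X ∩ Metric.ball 0 R)) ≤
          ε * jet X s p w φ +
            C * ∑ z ∈ Z, ‖∫ x in gridCell (1 / ((n : ℝ) + 1)) z, multiD j φ x‖ₑ := by
  have hd0 : (0 : ℝ) < d := by exact_mod_cast hd
  have hp0 : 0 < p := by linarith
  -- Exponents must not decrease along the Sobolev steps, so q is first raised to q1; the factor V
  -- below returns from q1 to q on the bounded set. Distributing the gap equally over k + 1
  -- derivatives gives θ, and the strict hypothesis becomes dθ < 1.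
  set q1 := max p q with hq1
  have hpq1 : p ≤ q1 := le_max_left _ _
  have hq10 : 0 < q1 := by linarith
  have hk0 : (0 : ℝ) < (k + 1 : ℕ) := by positivity
  set θ := (1 / p - 1 / q1) / (k + 1 : ℕ) with hθ
  have hθ0 : 0 ≤ θ := by
    have := one_div_le_one_div_of_le hp0 hpq1
    exact div_nonneg (by linarith) hk0.le
  have hdθ : d * θ < 1 := by
    have h1 : 1 / p - 1 / q1 < (k + 1 : ℕ) / d := by
      rcases max_choice p q with h | h
      · rw [hq1, h, sub_self]; positivity
      · rw [hq1, h]; exact hpq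
    rw [hθ, mul_div_assoc', div_lt_one hk0]
    rw [lt_div_iff₀ hd0] at h1
    linarith
  have hkθ : (k + 1 : ℕ) * θ = 1 / p - 1 / q1 := by rw [hθ]; field_simp
  push_cast at hkθ
  have hiq : 0 < 1 / q1 := by positivity
  -- One derivative is kept in reserve: k of them bring the gradient into L^p1, and the last step
  -- from p1 to q1 is the Poincaré inequality on small cells. It leaves the mesh to the power τ = 1
  -- - dθ > 0.
  set p1 := 1 / (1 / q1 + θ) with hp1
  have hip1 : 1 / p1 = 1 / q1 + θ := by rw [hp1, one_div_one_div]
  have hp10 : 0 < p1 := by rw [hp1]; positivity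
  have hp1q1 : p1 ≤ q1 := by
    rw [← one_div_le_one_div hq10 hp10, hip1]; linarith
  have hpp1 : p ≤ p1 := by
    rw [← one_div_le_one_div hp10 hp0, hip1]
    nlinarith [Nat.cast_nonneg (α := ℝ) k]
  have h1p1 : 1 ≤ p1 := hp.trans hpp1
  obtain ⟨C1, hC1, H1⟩ := eLpNorm'_cell_le_mean d h1p1 hp1q1
    (by rw [hip1]; simpa using hdθ) ℝ
  obtain ⟨C2, hC2, H2⟩ := hA.lpD_ball_le_jet hX hdθ (k := k) (m := mlen j + 1) (q := p1)
    (by omega) hp hpp1 (by rw [hip1]; linarith) (R + d)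
  set V := volume (X ∩ Metric.ball (0 : Euc d) R) ^ (1 / q - 1 / q1) with hV
  have hVt : V ≠ ⊤ := by
    refine ENNReal.rpow_ne_top_of_nonneg ?_
      (measure_ne_top_of_subset inter_subset_right measure_ball_lt_top.ne)
    have := one_div_le_one_div_of_le (by linarith) (le_max_right p q)
    linarith
  set τ := 1 + (d : ℝ) * (1 / q1 - 1 / p1) with hτ
  have hτ0 : 0 < τ := by rw [hτ, hip1]; nlinarith
  -- choice of the mesh
  have hlim : Tendsto (fun n : ℕ => V * (C1 * C2) * ENNReal.ofReal (1 / ((n : ℝ) + 1)) ^ τ)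
      atTop (𝓝 0) := by
    have h1 : Tendsto (fun n : ℕ => ENNReal.ofReal (1 / ((n : ℝ) + 1)) ^ τ) atTop (𝓝 0) := by
      have h2 := ENNReal.tendsto_ofReal (tendsto_one_div_add_atTop_nhds_zero_nat (𝕜 := ℝ))
      have h3 := (ENNReal.continuous_rpow_const (y := τ)).tendsto _ |>.comp h2
      simpa [ENNReal.zero_rpow_of_pos hτ0, Function.comp_def] using h3
    simpa using ENNReal.Tendsto.const_mul h1
      (Or.inr (ENNReal.mul_ne_top hVt (ENNReal.mul_ne_top hC1 hC2)))
  obtain ⟨n, hn⟩ := (hlim.eventually_lt_const hε).exists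
  set δ : ℝ := 1 / ((n : ℝ) + 1) with hδ
  have hδ0 : 0 < δ := by positivity
  have hδ1 : δ ≤ 1 := by
    rw [hδ, div_le_one (by positivity)]; linarith [Nat.cast_nonneg (α := ℝ) n]
  obtain ⟨Z, hZ1, hZ2⟩ := exists_grid_cover hX hδ0 hδ1 R
  set D := ENNReal.ofReal δ with hD
  have hD0 : D ≠ 0 := by simpa [hD] using hδ0
  set K := D ^ ((d : ℝ) * (1 / q1 - 1)) with hK
  have hKt : K ≠ ⊤ := ENNReal.rpow_ne_top_of_ne_zero hD0 (by simp [hD])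
  refine ⟨n, Z, V * K, ENNReal.mul_ne_top hVt hKt,
    fun z hz => (hZ2 z hz).trans inter_subset_left, fun φ hφ => ?_⟩
  set g := multiD j φ with hg
  have hgc : ContDiff ℝ ∞ g := contDiff_multiD hφ j
  have hg1 : ContDiff ℝ 1 g := hgc.of_le (by exact_mod_cast le_top)
  set I : (Fin d → ℤ) → ℝ≥0∞ := fun z => ‖∫ x in gridCell δ z, g x‖ₑ with hI
  set G : (Fin d → ℤ) → ℝ≥0∞ := fun z => eLpNorm' (fderiv ℝ g) p1 (volume.restrict (gridCell δ z))
    with hG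
  have hU : eLpNorm' g q1 (volume.restrict (⋃ z ∈ Z, gridCell δ z)) ≤
      C1 * D ^ τ * (C2 * jet X s p w φ) + K * ∑ z ∈ Z, I z := by
    rw [eLpNorm'_biUnion_gridCell hδ0 Z hq10]
    have hcell : ∀ z ∈ Z, eLpNorm' g q1 (volume.restrict (gridCell δ z)) ^ q1 ≤
        (C1 * D ^ τ * G z + K * I z) ^ q1 := fun z _ =>
      ENNReal.rpow_le_rpow (H1 δ _ (isCell_gridCell hδ0 z) g hg1) hq10.le
    refine (ENNReal.rpow_le_rpow (Finset.sum_le_sum hcell) (by positivity)).trans ?_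
    refine (ENNReal.Lp_add_le _ _ _ (by linarith)).trans ?_
    refine add_le_add ?_ ?_
    · simp_rw [ENNReal.mul_rpow_of_nonneg (C1 * D ^ τ) _ hq10.le]
      rw [← Finset.mul_sum, ENNReal.mul_rpow_of_nonneg _ _ (by positivity), ← ENNReal.rpow_mul,
        mul_one_div_cancel hq10.ne', ENNReal.rpow_one]
      refine mul_le_mul_right ?_ _
      -- Since q1 ≥ p1, the ℓ^q1 sum over the cells is at most the ℓ^p1 sum, which reassembles to
      -- the L^p1 norm over their union with a constant independent of the mesh.
      have e1 : ∀ z, G z ^ q1 = (G z ^ p1) ^ (q1 / p1) := fun z => by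
        rw [← ENNReal.rpow_mul]; congr 1; field_simp
      simp_rw [e1]
      refine (ENNReal.rpow_le_rpow (ENNReal.sum_rpow_le_rpow_sum Z _
        ((one_le_div hp10).2 hp1q1)) (by positivity)).trans ?_
      rw [← ENNReal.rpow_mul, show q1 / p1 * (1 / q1) = 1 / p1 by field_simp,
        ← eLpNorm'_biUnion_gridCell hδ0 Z hp10]
      refine le_trans ?_ (H2 φ hφ)
      have hsub : (⋃ z ∈ Z, gridCell δ z) ⊆ X ∩ Metric.ball 0 (R + d) :=
        iUnion₂_subset hZ2
      refine (eLpNorm'_mono_measure _ (Measure.restrict_mono hsub le_rfl) hp10.le).trans ?_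
      exact eLpNorm'_mono_ae hp10.le (Eventually.of_forall fun x => norm_fderiv_multiD_le hφ j x)
    · simp_rw [ENNReal.mul_rpow_of_nonneg K _ hq10.le]
      rw [← Finset.mul_sum, ENNReal.mul_rpow_of_nonneg _ _ (by positivity), ← ENNReal.rpow_mul,
        mul_one_div_cancel hq10.ne', ENNReal.rpow_one]
      refine mul_le_mul_right ?_ _
      rw [one_div, ENNReal.rpow_inv_le_iff hq10]
      exact ENNReal.sum_rpow_le_rpow_sum _ _ (by linarith)
  calc eLpNorm' g q (volume.restrict (X ∩ Metric.ball 0 R))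
      ≤ eLpNorm' g q1 (volume.restrict (X ∩ Metric.ball 0 R)) * V :=
        eLpNorm'_restrict_le_of_le (by linarith) (le_max_right _ _)
          hgc.continuous.aestronglyMeasurable
    _ ≤ (C1 * D ^ τ * (C2 * jet X s p w φ) + K * ∑ z ∈ Z, I z) * V := by
        gcongr
        exact (eLpNorm'_mono_measure _ (Measure.restrict_mono hZ1 le_rfl) hq10.le).trans hU
    _ = (V * (C1 * C2) * D ^ τ) * jet X s p w φ + V * K * ∑ z ∈ Z, I z := by ring
    _ ≤ _ := by gcongr

lemma LowerBddLocBdd.enorm_integral_gridCell_le (hX : IsModelDomain X)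
    (hA : LowerBddLocBdd X s w) (hp : 1 ≤ p) {δ : ℝ} (hδ : 0 < δ) {z : Fin d → ℤ}
    (hz : gridCell δ z ⊆ X) {j : MIdx d} (hj : mlen j ≤ s) :
    ∃ C : ℝ≥0∞, C ≠ ⊤ ∧ ∀ φ : Euc d → ℝ, ContDiff ℝ ∞ φ →
      ‖∫ x in gridCell δ z, multiD j φ x‖ₑ ≤ C * jet X s p w φ := by
  obtain ⟨C, hC, H⟩ := hA.lpD_le_jet hX hp
  have hQ := isCell_gridCell hδ z
  refine ⟨ENNReal.ofReal δ ^ (d * (1 - 1 / p)) * C, ENNReal.mul_ne_top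
    (ENNReal.rpow_ne_top_of_ne_zero hQ.ofReal_ne_zero (by simp)) hC, fun φ hφ => ?_⟩
  refine (enorm_integral_cell_le hQ (contDiff_multiD hφ j).continuous hp).trans ?_
  rw [mul_assoc]
  refine mul_le_mul_right (le_trans ?_ (H φ hφ _ hj)) _
  refine (eLpNorm'_mono_measure _ (Measure.restrict_mono hz le_rfl) (by linarith)).trans ?_
  exact eLpNorm'_mono_ae (by linarith) (Eventually.of_forall fun x => abs_multiD_le hφ j x)

/-- The local Sobolev embedding for smooth functions. -/
lemma LowerBddLocBdd.local_sobolev (hX : IsModelDomain X) (hd : 1 ≤ d)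
    (hA : LowerBddLocBdd X s w) {k l : ℕ} (hs : l + (k + 1) ≤ s) {q : ℝ} (hp : 1 ≤ p) (hq : 1 ≤ q)
    (hpq : 1 / p - 1 / q < (k + 1 : ℕ) / d) (R : ℝ) {j : MIdx d} (hj : mlen j ≤ l) :
    ∃ C : ℝ≥0∞, C ≠ ⊤ ∧ ∀ φ : Euc d → ℝ, ContDiff ℝ ∞ φ →
      eLpNorm' (multiD j φ) q (volume.restrict (X ∩ Metric.ball 0 R)) ≤ C * jet X s p w φ := by
  -- With ε = 1 the mesh is fixed, and each of the finitely many means is bounded by the Sobolev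
  -- norm.
  obtain ⟨n, Z, C, hC, hZ, H⟩ := hA.rellich_estimate hX hd hs hp hq hpq R hj one_pos
  have hδ0 : (0 : ℝ) < 1 / ((n : ℝ) + 1) := by positivity
  have h1 : ∀ z : Fin d → ℤ, ∃ C : ℝ≥0∞, C ≠ ⊤ ∧ (z ∈ Z → ∀ φ : Euc d → ℝ, ContDiff ℝ ∞ φ →
      ‖∫ x in gridCell (1 / ((n : ℝ) + 1)) z, multiD j φ x‖ₑ ≤ C * jet X s p w φ) := by
    intro z
    by_cases hz : z ∈ Z
    · obtain ⟨C, h1, h2⟩ := hA.enorm_integral_gridCell_le hX hp hδ0 (hZ z hz) (j := j) (by omega)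
      exact ⟨C, h1, fun _ => h2⟩
    · exact ⟨0, by simp, fun h => absurd h hz⟩
  choose B hB HB using h1
  refine ⟨1 + C * ∑ z ∈ Z, B z, by
    simpa using ENNReal.mul_ne_top hC (ENNReal.sum_ne_top.2 fun z _ => hB z), fun φ hφ => ?_⟩
  refine (H φ hφ).trans ?_
  rw [add_mul, mul_assoc C, Finset.sum_mul]
  gcongr with z hz
  exact HB z hz φ hφ

end LocalSobolev


/-! ### Comparison of the weights at infinity. -/

section WeightedTails

variable {d : ℕ} {X : Set (Euc d)} {l : ℕ} {q : ℝ} {w w' : MIdx d → Euc d → ℝ}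

lemma exists_uniform_const (l : ℕ) {P : MIdx d → ℝ≥0∞ → Prop}
    (hmono : ∀ j C C', C ≤ C' → P j C → P j C')
    (h : ∀ j, mlen j ≤ l → ∃ C : ℝ≥0∞, C ≠ ⊤ ∧ P j C) :
    ∃ C : ℝ≥0∞, C ≠ ⊤ ∧ ∀ j, mlen j ≤ l → P j C := by
  choose! C hC hP using h
  refine ⟨∑ j ∈ midxLE d l, C j, ENNReal.sum_ne_top.2 fun j hj => hC j (mem_midxLE.1 hj),
    fun j hj => hmono j _ _ ?_ (hP j hj)⟩
  exact Finset.single_le_sum (f := C) (fun _ _ => zero_le) (mem_midxLE.2 hj)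

lemma wLp_le_inter_add_diff (hq : 1 ≤ q) (E : Set (Euc d)) {B : Set (Euc d)}
    (hB : MeasurableSet B) (W v : Euc d → ℝ) :
    wLp E q W v ≤ wLp (E ∩ B) q W v + wLp (E \ B) q W v := by
  unfold wLp
  rw [← lintegral_inter_add_sdiff _ E hB]
  exact ENNReal.rpow_add_le_add_rpow _ _ (by positivity)
    (by rw [div_le_one (by linarith)]; exact hq)

lemma wLp_eq_zero_of_forall (hq : 0 < q) {E : Set (Euc d)} (hE : MeasurableSet E)
    {v : Euc d → ℝ} (W : Euc d → ℝ) (h : ∀ x ∈ E, v x = 0) : wLp E q W v = 0 := by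
  unfold wLp
  rw [setLIntegral_congr_fun hE (g := fun _ => 0) fun x hx => by simp [h x hx, hq]]
  simp [hq]

lemma wLp_congr_on {E : Set (Euc d)} (hE : MeasurableSet E) {v v' : Euc d → ℝ} (W : Euc d → ℝ)
    (h : ∀ x ∈ E, v x = v' x) : wLp E q W v = wLp E q W v' := by
  unfold wLp
  rw [setLIntegral_congr_fun hE fun x hx => by rw [h x hx]]

lemma BddOnBalls.wLp_le {W : Euc d → ℝ} (hW : BddOnBalls X W) (hq : 1 ≤ q)
    (R : ℝ) : ∃ C : ℝ≥0∞, C ≠ ⊤ ∧ ∀ E ⊆ X ∩ Metric.ball 0 R, MeasurableSet E → ∀ v : Euc d → ℝ,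
      wLp E q W v ≤ C * eLpNorm' v q (volume.restrict E) := by
  obtain ⟨M, hM⟩ := hW R
  have hq0 : 0 < q := by linarith
  refine ⟨ENNReal.ofReal M ^ (1 / q), ENNReal.rpow_ne_top_of_nonneg (by positivity) (by simp),
    fun E hE hEm v => ?_⟩
  unfold wLp eLpNorm'
  rw [← ENNReal.mul_rpow_of_nonneg _ _ (by positivity),
    ← lintegral_const_mul' _ _ ENNReal.ofReal_ne_top]
  refine ENNReal.rpow_le_rpow (setLIntegral_mono' hEm fun x hx => ?_) (by positivity)
  rw [mul_comm]
  gcongr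
  exact (le_abs_self _).trans (hM x (hE hx).1 (mem_ball_zero_iff.1 (hE hx).2))

/-- Outside a large ball w j ≤ r^q w' j almost everywhere for some 0 < r < ε, uniformly over the
finitely many multi-indices. -/
lemma RatioDecreasesToZero.wLp_tail_le (hX : MeasurableSet X) (hr : RatioDecreasesToZero X l w w')
    (hpos : ∀ j, mlen j ≤ l → ∀ᵐ x ∂(volume.restrict X), 0 < w' j x) (hq : 1 ≤ q)
    {ε : ℝ≥0∞} (hε : 0 < ε) :
    ∃ R : ℝ, 0 < R ∧ ∀ j, mlen j ≤ l → ∀ v : Euc d → ℝ,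
      wLp (X \ Metric.ball 0 R) q (w j) v ≤ ε * wLp X q (w' j) v := by
  obtain ⟨K, -, hK⟩ := hr
  obtain ⟨r, hr0, hrε⟩ := ENNReal.lt_iff_exists_nnreal_btwn.1 hε
  have hr0' : (0 : ℝ) < r := by exact_mod_cast hr0
  have hq0 : 0 < q := by linarith
  have hev : ∀ᶠ x in cocompact (Euc d), ∀ j ∈ midxLE d l, x ∈ X → w j x / w' j x < (r : ℝ) ^ q := by
    rw [Finset.eventually_all]
    intro j hj
    have := (hK j (mem_midxLE.1 hj)).2.eventually_lt_const (Real.rpow_pos_of_pos hr0' q)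
    exact eventually_inf_principal.1 this
  obtain ⟨S, hS, hSs⟩ := mem_cocompact.1 hev
  obtain ⟨R, hR0, hR⟩ := hS.isBounded.subset_ball_lt 0 0
  refine ⟨R, hR0, fun j hj v => ?_⟩
  refine le_trans ?_ (mul_le_mul_left hrε.le _)
  unfold wLp
  have e : (r : ℝ≥0∞) = ((r : ℝ≥0∞) ^ q) ^ (1 / q) := by
    rw [← ENNReal.rpow_mul, mul_one_div_cancel hq0.ne', ENNReal.rpow_one]
  rw [e, ← ENNReal.mul_rpow_of_nonneg _ _ (by positivity),
    ← lintegral_const_mul' _ _ (ENNReal.rpow_ne_top_of_nonneg hq0.le (by simp))]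
  refine ENNReal.rpow_le_rpow ?_ (by positivity)
  refine le_trans ?_ (lintegral_mono_set (sdiff_subset (s := X) (t := Metric.ball 0 R)))
  refine lintegral_mono_ae ?_
  filter_upwards [ae_restrict_mem (hX.diff measurableSet_ball),
    ae_restrict_of_ae_restrict_of_subset sdiff_subset (hpos j hj)] with x hx hx'
  have h1 := hSs (show x ∈ Sᶜ from fun h => hx.2 (hR h)) j (mem_midxLE.2 hj) hx.1
  rw [div_lt_iff₀ hx'] at h1
  rw [mul_left_comm]
  gcongr
  calc ENNReal.ofReal (w j x) ≤ ENNReal.ofReal ((r : ℝ) ^ q * w' j x) :=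
        ENNReal.ofReal_le_ofReal h1.le
    _ = _ := by
        rw [ENNReal.ofReal_mul (by positivity), ← ENNReal.ofReal_rpow_of_nonneg hr0'.le hq0.le,
          ENNReal.ofReal_coe_nnreal]

/-- Up to a small multiple of the stronger norm, the weighted norm is controlled on a bounded set. -/
lemma RatioDecreasesToZero.wLp_le (hX : MeasurableSet X) (hr : RatioDecreasesToZero X l w w')
    (hpos : ∀ j, mlen j ≤ l → ∀ᵐ x ∂(volume.restrict X), 0 < w' j x)
    (hb : ∀ j, mlen j ≤ l → BddOnBalls X (w j)) (hq : 1 ≤ q) {ε : ℝ≥0∞} (hε : 0 < ε) :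
    ∃ (R : ℝ) (C : ℝ≥0∞), C ≠ ⊤ ∧ ∀ j, mlen j ≤ l → ∀ v : Euc d → ℝ,
      wLp X q (w j) v ≤ C * eLpNorm' v q (volume.restrict (X ∩ Metric.ball 0 R)) +
        ε * wLp X q (w' j) v := by
  obtain ⟨R, -, hR⟩ := hr.wLp_tail_le hX hpos hq hε
  obtain ⟨C, hC, H⟩ := exists_uniform_const l (P := fun j C => ∀ E ⊆ X ∩ Metric.ball 0 R,
    MeasurableSet E → ∀ v : Euc d → ℝ, wLp E q (w j) v ≤ C * eLpNorm' v q (volume.restrict E))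
    (fun j C C' h H E hE hEm v => (H E hE hEm v).trans (mul_le_mul_left h _))
    fun j hj => (hb j hj).wLp_le hq R
  refine ⟨R, C, hC, fun j hj v => ?_⟩
  refine (wLp_le_inter_add_diff hq X measurableSet_ball (w j) v (B := Metric.ball 0 R)).trans ?_
  exact add_le_add (H j hj _ le_rfl (hX.inter measurableSet_ball) v) (hR j hj v)

end WeightedTails

/-! ### Transfer of local bounds to the Sobolev space. -/

section LocalControl

variable {d : ℕ} {X : Set (Euc d)} {s l : ℕ} {p q : ℝ} {w w' : MIdx d → Euc d → ℝ}
  {u : Euc d → ℝ}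

lemma multiD_zero_fun (j : MIdx d) : multiD j (fun _ : Euc d => (0 : ℝ)) = fun _ => 0 := by
  have := multiD_sub (f := fun _ : Euc d => (0 : ℝ)) (g := fun _ => 0) contDiff_const contDiff_const j
  simpa using this

lemma MemSobolev.sobolevNorm_ne_top (hX : IsModelDomain X) (hp : 1 ≤ p)
    (hw : ∀ j, mlen j ≤ s → AEMeasurable (w j) (volume.restrict X)) (hu : MemSobolev X s p w u) :
    sobolevNorm X s p w u ≠ ⊤ := by
  obtain ⟨φ, h1, h2, h3⟩ := hu.2 1 one_pos
  refine ne_top_of_le_ne_top ?_ (hu.jetNorm_sub_triangle hX hp hw h1.1).2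
  exact ENNReal.add_ne_top.2 ⟨(h3.trans ENNReal.one_lt_top).ne, h2.ne⟩

/-- Norm convergence gives convergence in measure and then a subsequence converging almost
everywhere for w j dx; positivity of w j carries this over to Lebesgue measure. -/
lemma MemSobolev.exists_ae_tendsto (hX : IsModelDomain X) (hp : 1 ≤ p)
    {j : MIdx d} (hj : mlen j ≤ s) (hw : AEMeasurable (w j) (volume.restrict X))
    (hpos : ∀ᵐ x ∂(volume.restrict X), 0 < w j x) (hu : MemSobolev X s p w u)
    {φ : ℕ → Euc d → ℝ} (hφ : ∀ n, ContDiff ℝ ∞ (φ n))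
    (ht : Tendsto (fun n => jetNorm X s p w (fun j x => multiD j (φ n) x - weakD X j u x))
      atTop (𝓝 0)) :
    ∃ ns : ℕ → ℕ, StrictMono ns ∧ ∀ᵐ x ∂(volume.restrict X),
      Tendsto (fun n => multiD j (φ (ns n)) x) atTop (𝓝 (weakD X j u x)) := by
  have hp0 : 0 < p := by linarith
  have hum := hu.aestronglyMeasurable_weakD hX hj
  have hnorm : Tendsto (fun n => eLpNorm (multiD j (φ n) - weakD X j u) (ENNReal.ofReal p)
      (wMeas X (w j))) atTop (𝓝 0) := by
    refine tendsto_of_tendsto_of_tendsto_of_le_of_le tendsto_const_nhds ht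
      (fun _ => zero_le) fun n => ?_
    have hm : AEStronglyMeasurable (fun x => multiD j (φ n) x - weakD X j u x)
        (volume.restrict X) := (aestronglyMeasurable_multiD (hφ n) j _).sub hum
    have h1 := wLp_le_jetNorm hp w (X := X) (fun j x => multiD j (φ n) x - weakD X j u x) hj
    rw [wLp_eq_eLpNorm' hw hm] at h1
    rw [eLpNorm_eq_eLpNorm' (by simpa using hp0) (by simp), ENNReal.toReal_ofReal hp0.le]
    exact h1
  obtain ⟨ns, hns, hae⟩ := (tendstoInMeasure_of_tendsto_eLpNorm (p := ENNReal.ofReal p)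
    (by simpa using hp0) (fun n => aestronglyMeasurable_multiD (hφ n) j _)
    (hum.mono_ac (wMeas_absolutelyContinuous X _)) hnorm).exists_seq_tendsto_ae
  exact ⟨ns, hns, (absolutelyContinuous_wMeas hw hpos).ae_le hae⟩

/-- An `L^q` bound for smooth functions extends to the Sobolev space. -/
lemma MemSobolev.eLpNorm'_sub_le (hX : IsModelDomain X) (hp : 1 ≤ p) (hq : 1 ≤ q)
    (hw : ∀ j, mlen j ≤ s → IsWeight X (w j)) (hu : MemSobolev X s p w u)
    {j : MIdx d} (hj : mlen j ≤ s) {E : Set (Euc d)} (hE : E ⊆ X) {C : ℝ≥0∞} (hC : C ≠ ⊤)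
    (hb : ∀ φ : Euc d → ℝ, ContDiff ℝ ∞ φ →
      eLpNorm' (multiD j φ) q (volume.restrict E) ≤ C * jet X s p w φ)
    {φ : Euc d → ℝ} (hφ : ContDiff ℝ ∞ φ) :
    eLpNorm' (fun x => multiD j φ x - weakD X j u x) q (volume.restrict E) ≤
      C * jetNorm X s p w (fun j x => multiD j φ x - weakD X j u x) := by
  have hwm : ∀ j, mlen j ≤ s → AEMeasurable (w j) (volume.restrict X) := fun j hj =>
    (hw j hj).aemeasurable
  obtain ⟨ψ, hψ, ht, -, -⟩ := hu.exists_seq hX hp hwm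
  obtain ⟨ns, hns, hae⟩ := hu.exists_ae_tendsto hX hp hj (hwm j hj) (hw j hj).2
    (fun n => (hψ n).1) ht
  set J := jetNorm X s p w (fun j x => multiD j φ x - weakD X j u x) with hJ
  -- Fatou's lemma along the subsequence ψ (ns n); the bound for smooth functions is applied to φ -
  -- ψ (ns n).
  have hfat := Lp.eLpNorm'_lim_le_liminf_eLpNorm' (μ := volume.restrict E) (p := q) (by linarith)
    (f := fun n x => multiD j φ x - multiD j (ψ (ns n)) x)
    (fun n => (aestronglyMeasurable_multiD hφ j _).sub (aestronglyMeasurable_multiD (hψ _).1 j _))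
    (f_lim := fun x => multiD j φ x - weakD X j u x) (by
      filter_upwards [ae_restrict_of_ae_restrict_of_subset hE hae] with x hx
      exact hx.const_sub _)
  refine hfat.trans ?_
  have hle : ∀ n, eLpNorm' (fun x => multiD j φ x - multiD j (ψ (ns n)) x) q (volume.restrict E) ≤
      C * (J + jetNorm X s p w (fun j x => multiD j (ψ (ns n)) x - weakD X j u x)) := fun n => by
    have h1 := hb (fun x => φ x - ψ (ns n) x) (hφ.sub (hψ _).1)
    rw [multiD_sub hφ (hψ _).1] at h1
    exact h1.trans (mul_le_mul_right (jetNorm_seq_cauchy hX hp hwm hu hφ (hψ _).1) _)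
  refine (liminf_le_liminf (Eventually.of_forall hle)).trans (le_of_eq ?_)
  have hlim : Tendsto (fun n => C * (J + jetNorm X s p w
      (fun j x => multiD j (ψ (ns n)) x - weakD X j u x))) atTop (𝓝 (C * (J + 0))) :=
    ENNReal.Tendsto.const_mul ((ht.comp hns.tendsto_atTop).const_add J) (Or.inr hC)
  rw [hlim.liminf_eq, add_zero]

/-- On bounded sets the Sobolev norm controls the `L^q` norms of the derivatives of order at most
`l` of smooth functions. -/
def LocallyControls (X : Set (Euc d)) (s l : ℕ) (p q : ℝ) (w : MIdx d → Euc d → ℝ) : Prop :=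
  ∀ R : ℝ, ∃ C : ℝ≥0∞, C ≠ ⊤ ∧ ∀ j : MIdx d, mlen j ≤ l → ∀ φ : Euc d → ℝ, ContDiff ℝ ∞ φ →
    eLpNorm' (multiD j φ) q (volume.restrict (X ∩ Metric.ball 0 R)) ≤ C * jet X s p w φ

lemma LowerBddLocBdd.locallyControls (hX : IsModelDomain X) (hd : 1 ≤ d)
    (hA : LowerBddLocBdd X s w) {k l : ℕ} (hs : l + (k + 1) ≤ s) (hp : 1 ≤ p) (hq : 1 ≤ q)
    (hpq : 1 / p - 1 / q < (k + 1 : ℕ) / d) : LocallyControls X s l p q w := fun R =>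
  exists_uniform_const l (P := fun j C => ∀ φ : Euc d → ℝ, ContDiff ℝ ∞ φ →
    eLpNorm' (multiD j φ) q (volume.restrict (X ∩ Metric.ball 0 R)) ≤ C * jet X s p w φ)
    (fun _ _ _ h H φ hφ => (H φ hφ).trans (mul_le_mul_left h _))
    fun _ hj => hA.local_sobolev hX hd hs hp hq hpq R hj

lemma MemSobolev.eLpNorm'_weakD_le (hX : IsModelDomain X) (hp : 1 ≤ p) (hq : 1 ≤ q)
    (hw : ∀ j, mlen j ≤ s → IsWeight X (w j)) (hu : MemSobolev X s p w u)
    {j : MIdx d} (hj : mlen j ≤ s) {E : Set (Euc d)} (hE : E ⊆ X) {C : ℝ≥0∞} (hC : C ≠ ⊤)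
    (hb : ∀ φ : Euc d → ℝ, ContDiff ℝ ∞ φ →
      eLpNorm' (multiD j φ) q (volume.restrict E) ≤ C * jet X s p w φ) :
    eLpNorm' (weakD X j u) q (volume.restrict E) ≤ C * sobolevNorm X s p w u := by
  -- With φ = 0 the error of approximation is u itself.
  have := hu.eLpNorm'_sub_le hX hp hq hw hj hE hC hb (φ := fun _ => 0) contDiff_const
  unfold sobolevNorm
  simp only [multiD_zero_fun, zero_sub] at this
  simpa [eLpNorm', jetNorm] using this

/-- The continuity of the embedding of the intersection. -/
lemma LocallyControls.sobolevNorm_le (hX : IsModelDomain X) (hp : 1 ≤ p) (hq : 1 ≤ q)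
    (hls : l ≤ s) (hc : LocallyControls X s l p q w) (hw : ∀ j, mlen j ≤ s → IsWeight X (w j))
    (hw' : ∀ j, mlen j ≤ l → IsWeight X (w' j)) (hb : ∀ j, mlen j ≤ l → BddOnBalls X (w j))
    (hr : RatioDecreasesToZero X l w w') :
    ∃ C : ℝ≥0∞, C ≠ ⊤ ∧ ∀ u, MemSobolev X s p w u → MemSobolev X l q w' u →
      sobolevNorm X l q w u ≤ C * (sobolevNorm X s p w u + sobolevNorm X l q w' u) := by
  obtain ⟨R, C0, hC0, H0⟩ := hr.wLp_le hX.measurableSet (fun j hj => (hw' j hj).2) hb hq one_pos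
  obtain ⟨C1, hC1, H1⟩ := hc R
  refine ⟨(midxLE d l).card * (C0 * C1 + 1), ENNReal.mul_ne_top (by simp)
    (by simpa using ENNReal.mul_ne_top hC0 hC1), fun u hu hu' => ?_⟩
  refine (jetNorm_le_sum l hq w _).trans ?_
  refine (Finset.sum_le_card_nsmul _ _ ((C0 * C1 + 1) *
    (sobolevNorm X s p w u + sobolevNorm X l q w' u)) fun j hj => ?_).trans
    (by rw [nsmul_eq_mul, mul_assoc])
  rw [mem_midxLE] at hj
  refine (H0 j hj _).trans ?_
  have h1 := hu.eLpNorm'_weakD_le hX hp hq hw (hj.trans hls) inter_subset_left hC1 (H1 j hj)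
  have h2 : wLp X q (w' j) (weakD X j u) ≤ sobolevNorm X l q w' u :=
    wLp_le_jetNorm hq w' (fun j => weakD X j u) hj
  calc _ ≤ C0 * (C1 * sobolevNorm X s p w u) + 1 * sobolevNorm X l q w' u := by gcongr
    _ ≤ C0 * (C1 * (sobolevNorm X s p w u + sobolevNorm X l q w' u)) +
        1 * (sobolevNorm X s p w u + sobolevNorm X l q w' u) := by
        gcongr
        · exact le_self_add
        · exact le_add_self
    _ = _ := by ring

end LocalControl


/-! ### Gluing approximations of two kinds. -/

section Gluing

variable {d : ℕ} {X : Set (Euc d)} {s l : ℕ} {p q : ℝ} {w w' : MIdx d → Euc d → ℝ}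
  {u : Euc d → ℝ}

lemma multiD_congr_of_eventuallyEq {f g : Euc d → ℝ} (hf : ContDiff ℝ ∞ f) (hg : ContDiff ℝ ∞ g)
    {x : Euc d} (h : f =ᶠ[𝓝 x] g) (j : MIdx d) : multiD j f x = multiD j g x := by
  rw [multiD_eq_iteratedFDeriv hf, multiD_eq_iteratedFDeriv hg, (h.iteratedFDeriv ℝ _).eq_of_nhds]

lemma exists_iteratedFDeriv_bound {χ : Euc d → ℝ} (hχ : ContDiff ℝ ∞ χ) (hs : HasCompactSupport χ)
    (l : ℕ) : ∃ K : ℝ, 0 ≤ K ∧ ∀ i ≤ l, ∀ x, ‖iteratedFDeriv ℝ i χ x‖ ≤ K := by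
  have h : ∀ i : ℕ, ∃ K : ℝ, ∀ x, ‖iteratedFDeriv ℝ i χ x‖ ≤ K := fun i =>
    (hs.iteratedFDeriv i).exists_bound_of_continuous (hχ.contDiff_one_iteratedFDeriv i).continuous
  choose K hK using h
  have hK0 : ∀ i, 0 ≤ K i := fun i => (norm_nonneg _).trans (hK i 0)
  refine ⟨∑ i ∈ Finset.range (l + 1), K i, Finset.sum_nonneg fun i _ => hK0 i, fun i hi x => ?_⟩
  exact (hK i x).trans (Finset.single_le_sum (f := K) (fun i _ => hK0 i)
    (Finset.mem_range.2 (by omega)))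

/-- Leibniz' rule: the derivatives of the compactly supported factor are bounded, and full
derivatives of g are bounded by its multi-index derivatives. -/
lemma exists_abs_multiD_mul_le {χ : Euc d → ℝ} (hχ : ContDiff ℝ ∞ χ) (hs : HasCompactSupport χ)
    (l : ℕ) : ∃ K : ℝ, 0 ≤ K ∧ ∀ g : Euc d → ℝ, ContDiff ℝ ∞ g → ∀ j : MIdx d, mlen j ≤ l → ∀ x,
      ‖multiD j (fun y => χ y * g y) x‖ ≤ K * ∑ i ∈ midxLE d l, ‖multiD i g x‖ := by
  obtain ⟨K, hK0, hK⟩ := exists_iteratedFDeriv_bound hχ hs l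
  refine ⟨2 ^ l * (K * (d + 1) ^ l), by positivity, fun g hg j hj x => ?_⟩
  set T := ∑ i ∈ midxLE d l, ‖multiD i g x‖ with hT
  have hT0 : 0 ≤ T := Finset.sum_nonneg fun _ _ => norm_nonneg _
  have hd1 : (1 : ℝ) ≤ d + 1 := by linarith [Nat.cast_nonneg (α := ℝ) d]
  have hg' : ∀ n ≤ l, ‖iteratedFDeriv ℝ n g x‖ ≤ (d + 1) ^ l * T := by
    intro n hn
    refine (norm_iteratedFDeriv_le_sum_multiD hg n x).trans ?_
    refine mul_le_mul ?_ ?_ (Finset.sum_nonneg fun _ _ => norm_nonneg _) (by positivity)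
    · exact (pow_le_pow_left₀ (by positivity) (by linarith) n).trans (pow_le_pow_right₀ hd1 hn)
    · refine Finset.sum_le_sum_of_subset_of_nonneg (fun i hi => ?_) fun _ _ _ => norm_nonneg _
      rw [Finset.mem_filter] at hi
      exact mem_midxLE.2 (by omega)
  refine (abs_multiD_le (hχ.mul hg) j x).trans ?_
  refine (norm_iteratedFDeriv_mul_le hχ hg x (n := mlen j) (by exact_mod_cast le_top)).trans ?_
  calc _ ≤ ∑ i ∈ Finset.range (mlen j + 1), ((mlen j).choose i : ℝ) * (K * ((d + 1) ^ l * T)) := by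
        refine Finset.sum_le_sum fun i hi => ?_
        have := Finset.mem_range.1 hi
        rw [mul_assoc]
        refine mul_le_mul_of_nonneg_left ?_ (by positivity)
        exact mul_le_mul (hK i (by omega) x) (hg' _ (by omega)) (norm_nonneg _) hK0
    _ = 2 ^ mlen j * (K * ((d + 1) ^ l * T)) := by
        rw [← Finset.sum_mul]
        congr 1
        exact_mod_cast Nat.sum_range_choose (mlen j)
    _ ≤ 2 ^ l * (K * ((d + 1) ^ l * T)) :=
        mul_le_mul_of_nonneg_right (pow_le_pow_right₀ (by norm_num) hj) (by positivity)
    _ = _ := by ring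

lemma SmoothVanishing.add_hasCompactSupport {ψ f : Euc d → ℝ} (hψ : SmoothVanishing X ψ)
    (hf : ContDiff ℝ ∞ f) (hc : HasCompactSupport f) :
    SmoothVanishing X fun x => ψ x + f x := by
  refine ⟨hψ.1.add hf, ?_⟩
  simpa using hψ.2.add (hc.is_zero_at_infty.mono_left inf_le_left)

/-- Approximations in the two norms are glued to one approximation in the norm of the target. -/
lemma LocallyControls.exists_glued (hX : IsModelDomain X) (hp : 1 ≤ p) (hq : 1 ≤ q)
    (hls : l ≤ s) (hc : LocallyControls X s l p q w) (hw : ∀ j, mlen j ≤ s → IsWeight X (w j))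
    (hw' : ∀ j, mlen j ≤ l → IsWeight X (w' j)) (hA : LowerBddLocBdd X s w)
    (hr : RatioDecreasesToZero X l w w') :
    ∃ C : ℝ≥0∞, C ≠ ⊤ ∧ ∀ u, MemSobolev X s p w u → MemSobolev X l q w' u → ∀ φ ψ : Euc d → ℝ,
      ContDiff ℝ ∞ φ → SmoothVanishing X ψ → ∃ h : Euc d → ℝ, SmoothVanishing X h ∧
        jetNorm X l q w (fun j x => multiD j h x - weakD X j u x) ≤
          C * (jetNorm X s p w (fun j x => multiD j φ x - weakD X j u x) +
            jetNorm X l q w' (fun j x => multiD j ψ x - weakD X j u x)) := by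
  have hXm := hX.measurableSet
  have hq0 : 0 < q := by linarith
  obtain ⟨⟨c, hc0, hcw⟩, hb⟩ := hA
  obtain ⟨R, hR0, HR⟩ := hr.wLp_tail_le hXm (fun j hj => (hw' j hj).2) hq one_pos
  -- The cutoff chosen below is supported in the closed ball of radius R + 1; radius R + 2 leaves
  -- room for it in an open ball.
  obtain ⟨C0, hC0, H0⟩ := exists_uniform_const l (P := fun j C => ∀ E ⊆ X ∩ Metric.ball 0 (R + 2),
    MeasurableSet E → ∀ v : Euc d → ℝ, wLp E q (w j) v ≤ C * eLpNorm' v q (volume.restrict E))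
    (fun j C C' h H E hE hEm v => (H E hE hEm v).trans (mul_le_mul_left h _))
    fun j hj => (hb j (hj.trans hls)).wLp_le hq (R + 2)
  obtain ⟨C1, hC1, H1⟩ := hc (R + 2)
  set χ : ContDiffBump (0 : Euc d) := ⟨R, R + 1, hR0, by linarith⟩ with hχ
  have hχd : ContDiff ℝ ∞ χ := χ.contDiff
  have hχc : HasCompactSupport χ := χ.hasCompactSupport
  obtain ⟨K, hK0, HK⟩ := exists_abs_multiD_mul_le hχd hχc l
  set B := Metric.ball (0 : Euc d) R with hB
  set A := (X \ B) ∩ Metric.ball (0 : Euc d) (R + 2) with hAdef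
  have hBm : MeasurableSet B := measurableSet_ball
  have hAm : MeasurableSet A := (hXm.diff hBm).inter measurableSet_ball
  have hAX : A ⊆ X ∩ Metric.ball 0 (R + 2) := fun x hx => ⟨hx.1.1, hx.2⟩
  set c' := (ENNReal.ofReal c)⁻¹ ^ (1 / q) with hc'
  have hc't : c' ≠ ⊤ := ENNReal.rpow_ne_top_of_nonneg (by positivity) (by simpa using hc0)
  obtain ⟨N, hN⟩ : ∃ N : ℝ≥0∞, N = ((midxLE d l).card : ℝ≥0∞) := ⟨_, rfl⟩
  set C2 := C0 * (ENNReal.ofReal K * (N * (C1 + c'))) with hC2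
  have hC2t : C2 ≠ ⊤ := by
    refine ENNReal.mul_ne_top hC0 (ENNReal.mul_ne_top (by simp) (ENNReal.mul_ne_top (by simp [hN]) ?_))
    exact ENNReal.add_ne_top.2 ⟨hC1, hc't⟩
  refine ⟨N * (C0 * C1 + (1 + C2)), ENNReal.mul_ne_top (by simp [hN])
    (ENNReal.add_ne_top.2 ⟨ENNReal.mul_ne_top hC0 hC1, by simpa using hC2t⟩),
    fun u hu hu' φ ψ hφ hψ => ?_⟩
  set a := jetNorm X s p w (fun j x => multiD j φ x - weakD X j u x) with ha
  set b := jetNorm X l q w' (fun j x => multiD j ψ x - weakD X j u x) with hbdef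
  set g : Euc d → ℝ := fun x => φ x - ψ x with hg
  have hgd : ContDiff ℝ ∞ g := hφ.sub hψ.1
  -- The glued function ψ + χ(φ - ψ) equals φ where χ = 1 and ψ where χ = 0.
  set f : Euc d → ℝ := fun x => χ x * g x with hf
  have hfd : ContDiff ℝ ∞ f := hχd.mul hgd
  have hfc : HasCompactSupport f := hχc.mul_right
  have hh := hψ.add_hasCompactSupport hfd hfc
  refine ⟨fun x => ψ x + f x, hh, ?_⟩
  have hφu : ∀ j, mlen j ≤ l → eLpNorm' (fun x => multiD j φ x - weakD X j u x) q
      (volume.restrict (X ∩ Metric.ball 0 (R + 2))) ≤ C1 * a := fun j hj =>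
    hu.eLpNorm'_sub_le hX hp hq hw (hj.trans hls) inter_subset_left hC1 (H1 j hj) hφ
  have hψu : ∀ j, mlen j ≤ l →
      wLp (X \ B) q (w j) (fun x => multiD j ψ x - weakD X j u x) ≤ b := fun j hj => by
    refine (HR j hj _).trans ?_
    rw [one_mul]
    exact wLp_le_jetNorm hq w' (fun j x => multiD j ψ x - weakD X j u x) hj
  have hum : ∀ j, mlen j ≤ l → AEStronglyMeasurable (weakD X j u) (volume.restrict X) :=
    fun j hj => hu'.aestronglyMeasurable_weakD hX hj
  -- On the transition region A, φ is close to u by local control, and ψ is close to u because w i ≥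
  -- c while outside B the w i norm is dominated by the w' i norm. Hence the difference φ - ψ is
  -- small in L^q with its derivatives.
  have hgA : ∀ i, mlen i ≤ l → eLpNorm' (multiD i g) q (volume.restrict A) ≤ (C1 + c') * (a + b) := by
    intro i hi
    have hmA : AEStronglyMeasurable (weakD X i u) (volume.restrict A) :=
      (hum i hi).mono_measure (Measure.restrict_mono (fun x hx => hx.1.1) le_rfl)
    have e : multiD i g = (fun x => multiD i φ x - weakD X i u x) +
        fun x => weakD X i u x - multiD i ψ x := by
      rw [hg, multiD_sub hφ hψ.1]; ext x; simp
    rw [e]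
    refine (eLpNorm'_add_le ((aestronglyMeasurable_multiD hφ i _).sub hmA)
      (hmA.sub (aestronglyMeasurable_multiD hψ.1 i _)) hq).trans ?_
    have h1 : eLpNorm' (fun x => multiD i φ x - weakD X i u x) q (volume.restrict A) ≤ C1 * a :=
      (eLpNorm'_mono_measure _ (Measure.restrict_mono hAX le_rfl) hq0.le).trans (hφu i hi)
    have h2 : eLpNorm' (fun x => weakD X i u x - multiD i ψ x) q (volume.restrict A) ≤ c' * b := by
      refine (eLpNorm'_le_wLp_of_le (fun x hx => hx.1.1) hAm hc0 (hcw i (hi.trans hls)) hq _).trans ?_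
      rw [wLp_sub_comm]
      gcongr
      exact (wLp_mono_set inter_subset_left hq0.le _ _).trans (hψu i hi)
    calc _ ≤ C1 * a + c' * b := add_le_add h1 h2
      _ ≤ C1 * (a + b) + c' * (a + b) := by
          gcongr
          · exact le_self_add
          · exact le_add_self
      _ = _ := by ring
  have hfj : ∀ j, mlen j ≤ l → wLp (X \ B) q (w j) (multiD j f) ≤ C2 * (a + b) := by
    intro j hj
    refine (wLp_le_inter_add_diff hq _ (measurableSet_ball (x := (0 : Euc d)) (ε := R + 2))
      (w j) _).trans ?_
    rw [wLp_eq_zero_of_forall (E := (X \ B) \ Metric.ball 0 (R + 2)) hq0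
      ((hXm.diff hBm).diff measurableSet_ball) (w j), add_zero]
    · refine (H0 j hj A hAX hAm _).trans ?_
      rw [hC2, mul_assoc]
      refine mul_le_mul_right ?_ _
      have h1 : eLpNorm' (multiD j f) q (volume.restrict A) ≤
          eLpNorm' (K • ∑ i ∈ midxLE d l, fun x => ‖multiD i g x‖) q (volume.restrict A) := by
        refine eLpNorm'_mono_ae hq0.le (Eventually.of_forall fun x => ?_)
        refine (HK g hgd j hj x).trans ?_
        rw [Real.norm_eq_abs]
        refine le_trans (le_of_eq ?_) (le_abs_self _)
        simp
      refine h1.trans ?_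
      rw [eLpNorm'_const_smul _ hq0, Real.enorm_eq_ofReal hK0, mul_assoc]
      refine mul_le_mul_right ?_ _
      refine (eLpNorm'_sum_le (fun i _ => (aestronglyMeasurable_multiD hgd i _).norm) hq).trans ?_
      refine (Finset.sum_le_card_nsmul _ _ ((C1 + c') * (a + b)) fun i hi => ?_).trans
        (by rw [nsmul_eq_mul, ← hN, mul_assoc])
      refine le_trans (le_of_eq ?_) (hgA i (mem_midxLE.1 hi))
      exact eLpNorm'_norm
    · intro x hx
      have hx' : x ∉ tsupport χ := by
        rw [χ.tsupport_eq]
        intro h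
        refine hx.2 ?_
        rw [mem_closedBall_zero_iff] at h
        rw [mem_ball_zero_iff]
        have : χ.rOut = R + 1 := rfl
        linarith
      have he : f =ᶠ[𝓝 x] fun _ => 0 := by
        filter_upwards [notMem_tsupport_iff_eventuallyEq.1 hx'] with y hy
        simp [hf, hy]
      rw [multiD_congr_of_eventuallyEq hfd contDiff_const he, multiD_zero_fun]
  refine (jetNorm_le_sum l hq w _).trans ?_
  refine (Finset.sum_le_card_nsmul _ _ ((C0 * C1 + (1 + C2)) * (a + b)) fun j hj => ?_).trans
    (by rw [nsmul_eq_mul, ← hN, mul_assoc])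
  rw [mem_midxLE] at hj
  refine (wLp_le_inter_add_diff hq X hBm (w j) _).trans ?_
  rw [add_mul]
  refine add_le_add ?_ ?_
  · have hBX : X ∩ B ⊆ X ∩ Metric.ball 0 (R + 2) :=
      inter_subset_inter_right _ (Metric.ball_subset_ball (by linarith))
    -- On the open ball B the cutoff is 1, so the glued function agrees with φ near every point and
    -- has the same derivatives.
    rw [wLp_congr_on (hXm.inter hBm) (v' := fun x => multiD j φ x - weakD X j u x)]
    · refine (H0 j hj _ hBX (hXm.inter hBm) _).trans ?_
      rw [mul_assoc]
      refine mul_le_mul_right ?_ _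
      refine ((eLpNorm'_mono_measure _ (Measure.restrict_mono hBX le_rfl) hq0.le).trans
        (hφu j hj)).trans ?_
      gcongr
      exact le_self_add
    · intro x hx
      congr 1
      refine multiD_congr_of_eventuallyEq hh.1 hφ ?_ j
      filter_upwards [Metric.isOpen_ball.mem_nhds hx.2] with y hy
      have : χ y = 1 := χ.one_of_mem_closedBall (Metric.ball_subset_closedBall hy)
      simp [hf, hg, this]
  · have e : (fun x => multiD j (fun x => ψ x + f x) x - weakD X j u x) =
        fun x => (multiD j ψ x - weakD X j u x) + multiD j f x := by
      rw [multiD_add hψ.1 hfd]; ext x; simp; ring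
    rw [e, add_mul, one_mul]
    have hmono : volume.restrict (X \ B) ≤ volume.restrict X :=
      Measure.restrict_mono sdiff_subset le_rfl
    refine (wLp_add_le hq (((hw j (hj.trans hls)).aemeasurable).mono_measure hmono)
      ((aestronglyMeasurable_multiD hψ.1 j _).sub ((hum j hj).mono_measure hmono))
      (aestronglyMeasurable_multiD hfd j _)).trans ?_
    exact add_le_add ((hψu j hj).trans le_add_self) (hfj j hj)

/-- The embedding of the intersection is well defined. -/
lemma LocallyControls.memSobolev (hX : IsModelDomain X) (hp : 1 ≤ p) (hq : 1 ≤ q)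
    (hls : l ≤ s) (hc : LocallyControls X s l p q w) (hw : ∀ j, mlen j ≤ s → IsWeight X (w j))
    (hw' : ∀ j, mlen j ≤ l → IsWeight X (w' j)) (hA : LowerBddLocBdd X s w)
    (hr : RatioDecreasesToZero X l w w') (hu : MemSobolev X s p w u) (hu' : MemSobolev X l q w' u) :
    MemSobolev X l q w u := by
  refine ⟨hu'.1, fun ε hε => ?_⟩
  obtain ⟨C, hC, H⟩ := hc.exists_glued hX hp hq hls hw hw' hA hr
  obtain ⟨C', hC', H'⟩ := hc.sobolevNorm_le hX hp hq hls hw hw'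
    (fun j hj => hA.2 j (hj.trans hls)) hr
  have hwm : ∀ j, mlen j ≤ s → AEMeasurable (w j) (volume.restrict X) := fun j hj =>
    (hw j hj).aemeasurable
  have hwm' : ∀ j, mlen j ≤ l → AEMeasurable (w' j) (volume.restrict X) := fun j hj =>
    (hw' j hj).aemeasurable
  obtain ⟨φ, hφ, ht, -, -⟩ := hu.exists_seq hX hp hwm
  obtain ⟨ψ, hψ, ht', -, -⟩ := hu'.exists_seq hX hq hwm'
  have hlim := ENNReal.Tendsto.const_mul (ht.add ht') (Or.inr hC)
  rw [add_zero, mul_zero] at hlim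
  obtain ⟨n, hn⟩ := (hlim.eventually_lt_const (lt_min hε one_pos)).exists
  obtain ⟨h, hh1, hh2⟩ := H u hu hu' (φ n) (ψ n) (hφ n).1 (hψ n)
  have hh3 := hh2.trans_lt hn
  refine ⟨h, hh1, ?_, hh3.trans_le (min_le_left _ _)⟩
  have htri := jetNorm_add_le (X := X) (m := l) hq (w := w)
    (v := fun j x => multiD j h x - weakD X j u x)
    (v' := fun j => weakD X j u) (fun j hj => hwm j (hj.trans hls))
    (fun j hj => (aestronglyMeasurable_multiD hh1.1 j _).sub (hu'.aestronglyMeasurable_weakD hX hj))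
    (fun j hj => hu'.aestronglyMeasurable_weakD hX hj)
  simp only [sub_add_cancel] at htri
  refine htri.trans_lt (ENNReal.add_lt_top.2 ⟨hh3.trans_le le_top, ?_⟩)
  refine (H' u hu hu').trans_lt (ENNReal.mul_lt_top hC'.lt_top (ENNReal.add_lt_top.2
    ⟨(hu.sobolevNorm_ne_top hX hp hwm).lt_top, (hu'.sobolevNorm_ne_top hX hq hwm').lt_top⟩))

end Gluing


/-! ### Completeness for weights bounded below. -/

section Completeness

variable {d : ℕ} {X : Set (Euc d)} {l : ℕ} {q : ℝ} {w : MIdx d → Euc d → ℝ}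

lemma ENNReal.tendsto_nhds_zero_of_le {ι : Type*} {F : Filter ι} {f g : ι → ℝ≥0∞}
    (hg : Tendsto g F (𝓝 0)) (h : ∀ i, f i ≤ g i) : Tendsto f F (𝓝 0) :=
  tendsto_of_tendsto_of_tendsto_of_le_of_le tendsto_const_nhds hg (fun _ => zero_le) h

lemma jetNorm_sub_le (hq : 1 ≤ q) {v v' : MIdx d → Euc d → ℝ}
    (hw : ∀ j, mlen j ≤ l → AEMeasurable (w j) (volume.restrict X))
    (hv : ∀ j, mlen j ≤ l → AEStronglyMeasurable (v j) (volume.restrict X))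
    (hv' : ∀ j, mlen j ≤ l → AEStronglyMeasurable (v' j) (volume.restrict X)) :
    jetNorm X l q w (fun j x => v j x - v' j x) ≤ jetNorm X l q w v + jetNorm X l q w v' := by
  have h := jetNorm_add_le hq hw hv (v' := fun j x => -v' j x) fun j hj => (hv' j hj).neg
  simp only [← sub_eq_add_neg] at h
  simpa [jetNorm] using h

lemma exists_eLpNorm_limit {α : Type*} [MeasurableSpace α] {μ : Measure α} {P : ℝ≥0∞}
    (hP : 1 ≤ P) {f : ℕ → α → ℝ} (hf : ∀ n, MemLp (f n) P μ)
    (hc : Tendsto (fun n : ℕ × ℕ => eLpNorm (f n.1 - f n.2) P μ) atTop (𝓝 0)) :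
    ∃ g, MemLp g P μ ∧ Tendsto (fun n => eLpNorm (f n - g) P μ) atTop (𝓝 0) := by
  have : Fact (1 ≤ P) := ⟨hP⟩
  have h1 : CauchySeq fun n => (hf n).toLp (f n) := by
    rw [Lp.cauchySeq_Lp_iff_cauchySeq_eLpNorm]
    refine hc.congr fun n => eLpNorm_congr_ae ?_
    exact ((hf n.1).coeFn_toLp.sub (hf n.2).coeFn_toLp).symm
  obtain ⟨G, hG⟩ := cauchySeq_tendsto_of_complete h1
  refine ⟨G, Lp.memLp G, (Lp.tendsto_Lp_iff_tendsto_eLpNorm'' f hf G (Lp.memLp G)).1 ?_⟩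
  rwa [Lp.toLp_coeFn]

lemma wLp_eq_eLpNorm {W v : Euc d → ℝ} (hq : 0 < q) (hW : AEMeasurable W (volume.restrict X))
    (hv : AEStronglyMeasurable v (volume.restrict X)) :
    wLp X q W v = eLpNorm v (ENNReal.ofReal q) (wMeas X W) := by
  rw [wLp_eq_eLpNorm' hW hv, eLpNorm_eq_eLpNorm' (by simpa using hq) (by simp),
    ENNReal.toReal_ofReal hq.le]

lemma exists_wLp_limit {W : Euc d → ℝ} (hq : 1 ≤ q) (hW : IsWeight X W) {f : ℕ → Euc d → ℝ}
    (hf : ∀ n, AEStronglyMeasurable (f n) (volume.restrict X)) (hft : ∀ n, wLp X q W (f n) ≠ ⊤)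
    (hc : Tendsto (fun n : ℕ × ℕ => wLp X q W fun x => f n.1 x - f n.2 x) atTop (𝓝 0)) :
    ∃ g, AEStronglyMeasurable g (volume.restrict X) ∧ wLp X q W g ≠ ⊤ ∧
      Tendsto (fun n => wLp X q W fun x => f n x - g x) atTop (𝓝 0) := by
  have hq0 : 0 < q := by linarith
  have hac := wMeas_absolutelyContinuous X W
  obtain ⟨g, hg, hlim⟩ := exists_eLpNorm_limit (μ := wMeas X W) (P := ENNReal.ofReal q) (f := f)
    (by simpa using hq)
    (fun n => ⟨(hf n).mono_ac hac, by
      rw [← wLp_eq_eLpNorm hq0 hW.aemeasurable (hf n)]; exact (hft n).lt_top⟩)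
    (hc.congr fun n => wLp_eq_eLpNorm hq0 hW.aemeasurable ((hf n.1).sub (hf n.2)))
  have hgm : AEStronglyMeasurable g (volume.restrict X) :=
    hg.1.mono_ac (absolutelyContinuous_wMeas hW.aemeasurable hW.2)
  refine ⟨g, hgm, ?_, hlim.congr fun n =>
    (wLp_eq_eLpNorm hq0 hW.aemeasurable ((hf n).sub hgm)).symm⟩
  rw [wLp_eq_eLpNorm hq0 hW.aemeasurable hgm]
  exact hg.2.ne

lemma tsupport_multiD_subset {φ : Euc d → ℝ} (hφ : ContDiff ℝ ∞ φ) (j : MIdx d) :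
    tsupport (multiD j φ) ⊆ tsupport φ := by
  refine closure_minimal (fun x hx => ?_) (isClosed_tsupport φ)
  by_contra h
  refine hx ?_
  rw [multiD_congr_of_eventuallyEq hφ contDiff_const (notMem_tsupport_iff_eventuallyEq.1 h)]
  exact congrFun (multiD_zero_fun j) x

lemma integrableOn_mul_of_hasCompactSupport {v φ : Euc d → ℝ}
    (hv : LocallyIntegrableOn v (interior X)) (hφ : Continuous φ) (hc : HasCompactSupport φ)
    (hs : tsupport φ ⊆ interior X) : IntegrableOn (fun x => v x * φ x) X := by
  have h1 : IntegrableOn (fun x => φ x • v x) (tsupport φ) :=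
    (hv.integrableOn_compact_subset hs hc).continuousOn_smul hφ.continuousOn hc
  have h2 : Integrable fun x => φ x • v x :=
    (integrableOn_iff_integrable_of_support_subset (by
      refine fun x hx => subset_tsupport φ ?_
      rw [Function.mem_support] at hx ⊢
      exact fun h0 => hx (by simp [h0]))).1 h1
  simpa only [smul_eq_mul, mul_comm] using h2.integrableOn

lemma IsWeakDeriv.sub {j : MIdx d} {u u' v v' : Euc d → ℝ} (h : IsWeakDeriv X j u v)
    (h' : IsWeakDeriv X j u' v') :
    IsWeakDeriv X j (fun x => u x - u' x) fun x => v x - v' x := by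
  refine ⟨h.1.sub h'.1, h.2.1.sub h'.2.1, fun φ hφ hc hs => ?_⟩
  have hcD : HasCompactSupport (multiD j φ) :=
    hc.of_isClosed_subset (isClosed_tsupport _) (tsupport_multiD_subset hφ j)
  have hsD : tsupport (multiD j φ) ⊆ interior X := (tsupport_multiD_subset hφ j).trans hs
  have hDc : Continuous (multiD j φ) := (contDiff_multiD hφ j).continuous
  simp only [sub_mul]
  rw [integral_sub (integrableOn_mul_of_hasCompactSupport h.1 hDc hcD hsD)
    (integrableOn_mul_of_hasCompactSupport h'.1 hDc hcD hsD),
    integral_sub (integrableOn_mul_of_hasCompactSupport h.2.1 hφ.continuous hc hs)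
    (integrableOn_mul_of_hasCompactSupport h'.2.1 hφ.continuous hc hs),
    h.2.2 φ hφ hc hs, h'.2.2 φ hφ hc hs, mul_sub]

lemma IsWeakDeriv.congr {j : MIdx d} {u u' v : Euc d → ℝ} (h : IsWeakDeriv X j u v)
    (hu' : LocallyIntegrableOn u' (interior X)) (he : u =ᵐ[volume.restrict X] u') :
    IsWeakDeriv X j u' v := by
  refine ⟨hu', h.2.1, fun φ hφ hc hs => ?_⟩
  rw [← h.2.2 φ hφ hc hs]
  refine integral_congr_ae ?_
  filter_upwards [he] with x hx
  rw [hx]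

/-- Hölder's inequality with the conjugate exponent: a continuous function of compact support lies
in every L^P. This passes the defining identity of weak derivatives to the limit. -/
lemma tendsto_integral_mul_of_eLpNorm {μ : Measure (Euc d)} [IsFiniteMeasureOnCompacts μ]
    {P : ℝ≥0∞} (hP : 1 ≤ P) {f : ℕ → Euc d → ℝ} {g : Euc d → ℝ} (hf : ∀ n, MemLp (f n) P μ)
    (hg : MemLp g P μ) (ht : Tendsto (fun n => eLpNorm (f n - g) P μ) atTop (𝓝 0))
    {φ : Euc d → ℝ} (hφ : Continuous φ) (hc : HasCompactSupport φ) :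
    Tendsto (fun n => ∫ x, f n x * φ x ∂μ) atTop (𝓝 (∫ x, g x * φ x ∂μ)) := by
  have := ENNReal.HolderConjugate.conjExponent hP
  have hφm : MemLp φ P.conjExponent μ := hφ.memLp_of_hasCompactSupport hc
  refine tendsto_integral_of_L1' (fun x => g x * φ x) (hg.1.mul hφm.1)
    (Eventually.of_forall fun n => (hf n).integrable_mul hφm) ?_
  have hlim := ENNReal.Tendsto.mul_const (b := eLpNorm φ P.conjExponent μ) ht (Or.inr hφm.2.ne)
  rw [zero_mul] at hlim
  refine ENNReal.tendsto_nhds_zero_of_le hlim fun n => ?_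
  have e : (fun x => f n x * φ x) - (fun x => g x * φ x) = (f n - g) • φ := by
    ext x; simp [sub_mul]
  rw [e]
  exact eLpNorm_smul_le_mul_eLpNorm hφm.1 ((hf n).1.sub hg.1)

/-- The weighted Sobolev space is complete when the weights are bounded below. -/
lemma exists_sobolev_limit (hX : IsModelDomain X) (hq : 1 ≤ q)
    (hw : ∀ j, mlen j ≤ l → IsWeight X (w j)) {c : ℝ} (hc0 : 0 < c)
    (hcw : ∀ j, mlen j ≤ l → ∀ x ∈ X, c ≤ w j x) {u : ℕ → Euc d → ℝ}
    (hu : ∀ n, MemSobolev X l q w (u n))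
    (hcau : ∀ j, mlen j ≤ l → Tendsto (fun n : ℕ × ℕ => wLp X q (w j) fun x =>
      weakD X j (u n.1) x - weakD X j (u n.2) x) atTop (𝓝 0)) :
    ∃ v, MemSobolev X l q w v ∧
      Tendsto (fun n => sobolevNorm X l q w fun x => u n x - v x) atTop (𝓝 0) := by
  have hq0 : 0 < q := by linarith
  have hwm : ∀ j, mlen j ≤ l → AEMeasurable (w j) (volume.restrict X) := fun j hj =>
    (hw j hj).aemeasurable
  set P := ENNReal.ofReal q with hP
  have hP1 : 1 ≤ P := by simpa [hP] using hq
  have hum : ∀ n, ∀ j, mlen j ≤ l → AEStronglyMeasurable (weakD X j (u n)) (volume.restrict X) :=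
    fun n j hj => (hu n).aestronglyMeasurable_weakD hX hj
  have hut : ∀ n, ∀ j, mlen j ≤ l → wLp X q (w j) (weakD X j (u n)) ≠ ⊤ := fun n j hj =>
    ne_top_of_le_ne_top ((hu n).sobolevNorm_ne_top hX hq hwm)
      (wLp_le_jetNorm hq w (fun j => weakD X j (u n)) hj)
  have hex : ∀ j, mlen j ≤ l → ∃ g, AEStronglyMeasurable g (volume.restrict X) ∧
      wLp X q (w j) g ≠ ⊤ ∧
      Tendsto (fun n => wLp X q (w j) fun x => weakD X j (u n) x - g x) atTop (𝓝 0) :=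
    fun j hj => exists_wLp_limit hq (hw j hj) (fun n => hum n j hj) (fun n => hut n j hj)
      (hcau j hj)
  choose! g hgm hgt hlim using hex
  -- unweighted convergence
  set K := (ENNReal.ofReal c)⁻¹ ^ (1 / q) with hK
  have hKt : K ≠ ⊤ := ENNReal.rpow_ne_top_of_nonneg (by positivity) (by simpa using hc0)
  have hunw : ∀ j, mlen j ≤ l → ∀ v : Euc d → ℝ,
      eLpNorm v P (volume.restrict X) ≤ K * wLp X q (w j) v := fun j hj v => by
    rw [eLpNorm_eq_eLpNorm' (by simpa [hP] using hq0) (by simp [hP]), ENNReal.toReal_ofReal hq0.le]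
    exact eLpNorm'_le_wLp_of_le le_rfl hX.measurableSet hc0 (hcw j hj) hq v
  have hgL : ∀ j, mlen j ≤ l → MemLp (g j) P (volume.restrict X) := fun j hj =>
    ⟨hgm j hj, (hunw j hj _).trans_lt (ENNReal.mul_lt_top hKt.lt_top (hgt j hj).lt_top)⟩
  have huL : ∀ n, ∀ j, mlen j ≤ l → MemLp (weakD X j (u n)) P (volume.restrict X) := fun n j hj =>
    ⟨hum n j hj, (hunw j hj _).trans_lt (ENNReal.mul_lt_top hKt.lt_top (hut n j hj).lt_top)⟩
  have hL : ∀ j, mlen j ≤ l →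
      Tendsto (fun n => eLpNorm (weakD X j (u n) - g j) P (volume.restrict X)) atTop (𝓝 0) := by
    intro j hj
    have h1 := ENNReal.Tendsto.const_mul (hlim j hj) (Or.inr hKt)
    rw [mul_zero] at h1
    exact ENNReal.tendsto_nhds_zero_of_le h1 fun n => hunw j hj _
  have hloc : ∀ j, mlen j ≤ l → LocallyIntegrableOn (g j) (interior X) := fun j hj =>
    (locallyIntegrableOn_of_locallyIntegrable_restrict
      ((hgL j hj).locallyIntegrable hP1)).mono_set interior_subset
  have h0 : mlen (0 : MIdx d) ≤ l := by simp [mlen_zero]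
  have hweak : ∀ j, mlen j ≤ l → IsWeakDeriv X j (g 0) (g j) := by
    refine fun j hj => ⟨hloc 0 h0, hloc j hj, fun φ hφ hc hs => ?_⟩
    have hcD : HasCompactSupport (multiD j φ) :=
      hc.of_isClosed_subset (isClosed_tsupport _) (tsupport_multiD_subset hφ j)
    have t1 := tendsto_integral_mul_of_eLpNorm hP1 (fun n => huL n 0 h0) (hgL 0 h0) (hL 0 h0)
      (contDiff_multiD hφ j).continuous hcD
    have t2 := (tendsto_integral_mul_of_eLpNorm hP1 (fun n => huL n j hj) (hgL j hj) (hL j hj)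
      hφ.continuous hc).const_mul ((-1 : ℝ) ^ mlen j)
    refine tendsto_nhds_unique t1 (t2.congr fun n => ?_)
    -- The zeroth weak derivative agrees with u n only almost everywhere, so the identity is first
    -- moved onto it.
    have h1 := ((hu n).isWeakDeriv hj).congr ((hu n).isWeakDeriv h0).2.1
      ((hu n).weakD_zero hX).symm
    exact (h1.2.2 φ hφ hc hs).symm
  have hwD : ∀ j, mlen j ≤ l → weakD X j (g 0) =ᵐ[volume.restrict X] g j := fun j hj =>
    (hweak j hj).weakD_ae_eq hX
  have hjet : Tendsto (fun n => jetNorm X l q w fun j x => weakD X j (u n) x - g j x)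
      atTop (𝓝 0) := by
    have h1 : Tendsto (fun n => ∑ j ∈ midxLE d l,
        wLp X q (w j) fun x => weakD X j (u n) x - g j x) atTop (𝓝 (∑ j ∈ midxLE d l, 0)) :=
      tendsto_finsetSum _ fun j hj => hlim j (mem_midxLE.1 hj)
    rw [Finset.sum_const_zero] at h1
    exact ENNReal.tendsto_nhds_zero_of_le h1 fun n => jetNorm_le_sum l hq w _
  refine ⟨g 0, ⟨fun j hj => ⟨g j, hweak j hj⟩, fun ε hε => ?_⟩, hjet.congr fun n => ?_⟩
  · have hε2 : 0 < ε / 2 := ENNReal.half_pos hε.ne'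
    obtain ⟨n, hn⟩ := (hjet.eventually_lt_const hε2).exists
    obtain ⟨φ, h1, h2, h3⟩ := (hu n).2 _ hε2
    refine ⟨φ, h1, h2, ?_⟩
    have h4 := jetNorm_add_le (X := X) hq (w := w)
      (v := fun j x => multiD j φ x - weakD X j (u n) x)
      (v' := fun j x => weakD X j (u n) x - g j x) hwm
      (fun j hj => (aestronglyMeasurable_multiD h1.1 j _).sub (hum n j hj))
      (fun j hj => (hum n j hj).sub (hgm j hj))
    simp only [sub_add_sub_cancel] at h4
    rw [jetNorm_congr (v' := fun j x => multiD j φ x - g j x) fun j hj => by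
      filter_upwards [hwD j hj] with x hx
      rw [hx]]
    exact h4.trans_lt ((ENNReal.add_lt_add h3 hn).trans_eq (ENNReal.add_halves ε))
  · refine jetNorm_congr fun j hj => ?_
    exact ((((hu n).isWeakDeriv hj).sub (hweak j hj)).weakD_ae_eq hX).symm

end Completeness

/-! ### Compactness of the embedding. -/

section Compactness

variable {d : ℕ} {X : Set (Euc d)} {s k l : ℕ} {p q : ℝ} {w w' : MIdx d → Euc d → ℝ}

/-- Bounded sequences of smooth functions have subsequences whose derivatives of order at most `l`
are Cauchy in `L^q` on all bounded sets. -/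
lemma LowerBddLocBdd.exists_cauchy_subseq (hX : IsModelDomain X) (hd : 1 ≤ d)
    (hA : LowerBddLocBdd X s w)
    (hw : ∀ j, mlen j ≤ s → AEMeasurable (w j) (volume.restrict X))
    (hs : l + (k + 1) ≤ s) (hp : 1 ≤ p) (hq : 1 ≤ q)
    (hpq : 1 / p - 1 / q < (k + 1 : ℕ) / d) {h : ℕ → Euc d → ℝ} (hh : ∀ n, ContDiff ℝ ∞ (h n))
    {M : ℝ≥0∞} (hM : M ≠ ⊤) (hb : ∀ n, jet X s p w (h n) ≤ M) :
    ∃ σ : ℕ → ℕ, StrictMono σ ∧ ∀ (R : ℝ) (j : MIdx d), mlen j ≤ l →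
      Tendsto (fun n : ℕ × ℕ => eLpNorm' (fun x => multiD j (h (σ n.1)) x - multiD j (h (σ n.2)) x) q
        (volume.restrict (X ∩ Metric.ball 0 R))) atTop (𝓝 0) := by
  classical
  have hδ0 : ∀ n : ℕ, (0 : ℝ) < 1 / ((n : ℝ) + 1) := fun n => by positivity
  -- All cell means, over all meshes 1/(n + 1), form one sequence in a product of compact intervals.
  -- The index set is countable, so the product is sequentially compact and one subsequence serves
  -- every mesh, multi-index and radius. Irrelevant indices get the value 0.
  set a : ℕ → (MIdx d × ℕ × (Fin d → ℤ)) → ℝ := fun m i =>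
    if mlen i.1 ≤ l ∧ gridCell (1 / ((i.2.1 : ℝ) + 1)) i.2.2 ⊆ X then
      ∫ x in gridCell (1 / ((i.2.1 : ℝ) + 1)) i.2.2, multiD i.1 (h m) x else 0 with ha
  have hbd : ∀ i, ∃ B : ℝ, ∀ m, a m i ∈ Icc (-B) B := by
    intro i
    by_cases hi : mlen i.1 ≤ l ∧ gridCell (1 / ((i.2.1 : ℝ) + 1)) i.2.2 ⊆ X
    · obtain ⟨C, hC, H⟩ := hA.enorm_integral_gridCell_le hX hp (hδ0 i.2.1) hi.2 (j := i.1) (by omega)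
      refine ⟨(C * M).toReal, fun m => abs_le.1 ?_⟩
      simp only [ha, if_pos hi]
      rw [← Real.norm_eq_abs, ← toReal_enorm]
      exact ENNReal.toReal_mono (ENNReal.mul_ne_top hC hM)
        ((H (h m) (hh m)).trans (mul_le_mul_right (hb m) C))
    · exact ⟨0, fun m => by simp only [ha, if_neg hi]; simp⟩
  choose B hB using hbd
  obtain ⟨L, -, σ, hσ, hlim⟩ := (isCompact_univ_pi fun i => isCompact_Icc (a := -B i) (b := B i)
    ).tendsto_subseq (x := a) fun m i _ => hB i m
  rw [tendsto_pi_nhds] at hlim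
  refine ⟨σ, hσ, fun R j hj => ?_⟩
  rw [ENNReal.tendsto_nhds_zero]
  intro ε hε
  -- Differences have norm at most 2M; adding 1 keeps the divisor nonzero.
  set T := 2 * M + 1 with hT
  have hTt : T ≠ ⊤ := by rw [hT]; simpa using ENNReal.mul_ne_top (by simp) hM
  have hT0 : T ≠ 0 := by simp [hT]
  have hε' : 0 < ε / 2 / T := ENNReal.div_pos (ENNReal.half_pos hε.ne').ne' hTt
  obtain ⟨n, Z, C, hC, hZ, H⟩ := hA.rellich_estimate hX hd hs hp hq hpq R hj hε'
  have hcoef : Tendsto (fun m : ℕ × ℕ => C * ∑ z ∈ Z,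
      ‖a (σ m.1) (j, n, z) - a (σ m.2) (j, n, z)‖ₑ) atTop (𝓝 0) := by
    have h1 : ∀ z ∈ Z, Tendsto (fun m : ℕ × ℕ =>
        ‖a (σ m.1) (j, n, z) - a (σ m.2) (j, n, z)‖ₑ) atTop (𝓝 0) := by
      intro z _
      have h2 := hlim (j, n, z)
      rw [← prod_atTop_atTop_eq]
      have h3 := ((h2.comp (tendsto_fst (g := atTop))).sub (h2.comp (tendsto_snd (f := atTop)))).enorm
      simpa using h3
    have h4 := ENNReal.Tendsto.const_mul (tendsto_finsetSum Z h1) (Or.inr hC)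
    simpa using h4
  filter_upwards [hcoef.eventually_lt_const (ENNReal.half_pos hε.ne')] with m hm
  have hg : ContDiff ℝ ∞ fun x => h (σ m.1) x - h (σ m.2) x := (hh _).sub (hh _)
  have h1 := H _ hg
  have hj2 : jet X s p w (fun x => h (σ m.1) x - h (σ m.2) x) ≤ 2 * M := by
    have := jetNorm_sub_le (X := X) hp hw (v := fun j => multiD j (h (σ m.1)))
      (v' := fun j => multiD j (h (σ m.2))) (fun j _ => aestronglyMeasurable_multiD (hh _) j _)
      fun j _ => aestronglyMeasurable_multiD (hh _) j _
    simp only [jet, multiD_sub (hh _) (hh _)]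
    exact this.trans ((add_le_add (hb _) (hb _)).trans_eq (two_mul M).symm)
  have hint : ∀ z ∈ Z, ‖∫ x in gridCell (1 / ((n : ℝ) + 1)) z,
      multiD j (fun x => h (σ m.1) x - h (σ m.2) x) x‖ₑ =
      ‖a (σ m.1) (j, n, z) - a (σ m.2) (j, n, z)‖ₑ := by
    intro z hz
    have hi : mlen j ≤ l ∧ gridCell (1 / ((n : ℝ) + 1)) z ⊆ X := ⟨hj, hZ z hz⟩
    have hI : ∀ m, IntegrableOn (multiD j (h m)) (gridCell (1 / ((n : ℝ) + 1)) z) := fun m =>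
      (contDiff_multiD (hh m) j).continuous.integrableOn_of_isBounded
        (isCell_gridCell (hδ0 n) z).isBounded
    simp only [ha, if_pos hi]
    rw [multiD_sub (hh _) (hh _), integral_sub (hI _) (hI _)]
  rw [Finset.sum_congr rfl hint, multiD_sub (hh _) (hh _)] at h1
  refine h1.trans ?_
  calc _ ≤ ε / 2 / T * T + ε / 2 := by
        gcongr
        exact hj2.trans le_self_add
    _ = ε := by rw [ENNReal.div_mul_cancel hT0 hTt, ENNReal.add_halves]

/-- The compactness of the embedding of the intersection. -/
lemma LowerBddLocBdd.compactlyEmbedsInter (hX : IsModelDomain X) (hd : 1 ≤ d)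
    (hA : LowerBddLocBdd X s w) (hr : RatioDecreasesToZero X l w w')
    (hw : ∀ j, mlen j ≤ s → IsWeight X (w j)) (hw' : ∀ j, mlen j ≤ l → IsWeight X (w' j))
    (hs : l + (k + 1) ≤ s) (hp : 1 ≤ p) (hq : 1 ≤ q)
    (hpq : 1 / p - 1 / q < (k + 1 : ℕ) / d) : CompactlyEmbedsInter X s l p q w w' := by
  have hls : l ≤ s := by omega
  have hq0 : 0 < q := by linarith
  have hc := hA.locallyControls hX hd hs hp hq hpq
  have hb : ∀ j, mlen j ≤ l → BddOnBalls X (w j) := fun j hj => hA.2 j (hj.trans hls)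
  have hmem : ∀ u, MemSobolev X s p w u → MemSobolev X l q w' u → MemSobolev X l q w u :=
    fun u hu hu' => hc.memSobolev hX hp hq hls hw hw' hA hr hu hu'
  have hwm : ∀ j, mlen j ≤ s → AEMeasurable (w j) (volume.restrict X) := fun j hj =>
    (hw j hj).aemeasurable
  have hwm' : ∀ j, mlen j ≤ l → AEMeasurable (w' j) (volume.restrict X) := fun j hj =>
    (hw' j hj).aemeasurable
  refine ⟨hmem, ?_, fun u M hu => ?_⟩
  · obtain ⟨C, hC, H⟩ := hc.sobolevNorm_le hX hp hq hls hw hw' hb hr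
    lift C to ℝ≥0 using hC
    exact ⟨C, H⟩
  have hu1 : ∀ n, sobolevNorm X s p w (u n) ≤ M := fun n => le_self_add.trans (hu n).2.2
  have hu2 : ∀ n, sobolevNorm X l q w' (u n) ≤ M := fun n => le_add_self.trans (hu n).2.2
  have hum : ∀ n, ∀ j, mlen j ≤ l → AEStronglyMeasurable (weakD X j (u n)) (volume.restrict X) :=
    fun n j hj => (hu n).2.1.aestronglyMeasurable_weakD hX hj
  choose h hh _ hhu using fun n : ℕ => (hu n).1.2 ((n + 1 : ℕ) : ℝ≥0∞)⁻¹ (by simp)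
  have hbd : ∀ n, jet X s p w (h n) ≤ 1 + M := fun n => by
    refine ((hu n).1.jetNorm_sub_triangle hX hp hwm (hh n).1).1.trans (add_le_add ?_ (hu1 n))
    refine (hhu n).le.trans (ENNReal.inv_le_one.2 ?_)
    exact_mod_cast Nat.succ_pos n
  obtain ⟨σ, hσ, hcau⟩ := hA.exists_cauchy_subseq hX hd hwm hs hp hq hpq (fun n => (hh n).1)
    (M := 1 + M) (by simp) hbd
  have hinv : Tendsto (fun n => ((σ n + 1 : ℕ) : ℝ≥0∞)⁻¹) atTop (𝓝 0) :=
    (ENNReal.tendsto_inv_nat_nhds_zero.comp (tendsto_add_atTop_nat 1)).comp hσ.tendsto_atTop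
  -- The Cauchy property passes from the smooth approximations h n to u n, since their local L^q
  -- distance is at most C/(n + 1).
  have hball : ∀ (R : ℝ) (j : MIdx d), mlen j ≤ l → Tendsto (fun n : ℕ × ℕ =>
      eLpNorm' (fun x => weakD X j (u (σ n.1)) x - weakD X j (u (σ n.2)) x) q
        (volume.restrict (X ∩ Metric.ball 0 R))) atTop (𝓝 0) := by
    intro R j hj
    obtain ⟨C, hC, H⟩ := hc R
    have hdiff : ∀ n, eLpNorm' (fun x => multiD j (h n) x - weakD X j (u n) x) q
        (volume.restrict (X ∩ Metric.ball 0 R)) ≤ C * ((n + 1 : ℕ) : ℝ≥0∞)⁻¹ := fun n =>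
      ((hu n).1.eLpNorm'_sub_le hX hp hq hw (hj.trans hls) inter_subset_left hC (H j hj)
        (hh n).1).trans (mul_le_mul_right (hhu n).le C)
    have hinvC := ENNReal.Tendsto.const_mul hinv (Or.inr hC)
    rw [mul_zero] at hinvC
    have hlim : Tendsto (fun n : ℕ × ℕ =>
        eLpNorm' (fun x => multiD j (h (σ n.1)) x - multiD j (h (σ n.2)) x) q
          (volume.restrict (X ∩ Metric.ball 0 R)) +
        (C * ((σ n.1 + 1 : ℕ) : ℝ≥0∞)⁻¹ + C * ((σ n.2 + 1 : ℕ) : ℝ≥0∞)⁻¹)) atTop (𝓝 0) := by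
      have h1 := hcau R j hj
      rw [← prod_atTop_atTop_eq] at h1 ⊢
      have h2 := h1.add ((hinvC.comp (tendsto_fst (g := atTop))).add
        (hinvC.comp (tendsto_snd (f := atTop))))
      simpa using h2
    refine ENNReal.tendsto_nhds_zero_of_le hlim fun n => ?_
    have hm : ∀ n, AEStronglyMeasurable (fun x => multiD j (h n) x - weakD X j (u n) x)
        (volume.restrict (X ∩ Metric.ball 0 R)) := fun n =>
      (aestronglyMeasurable_multiD (hh n).1 j _).sub
        ((hum n j hj).mono_measure (Measure.restrict_mono inter_subset_left le_rfl))
    have e : (fun x => weakD X j (u (σ n.1)) x - weakD X j (u (σ n.2)) x) =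
        (fun x => multiD j (h (σ n.1)) x - multiD j (h (σ n.2)) x) +
        (-(fun x => multiD j (h (σ n.1)) x - weakD X j (u (σ n.1)) x) +
          fun x => multiD j (h (σ n.2)) x - weakD X j (u (σ n.2)) x) := by
      ext x; simp; ring
    rw [e]
    refine (eLpNorm'_add_le ((aestronglyMeasurable_multiD (hh _).1 j _).sub
      (aestronglyMeasurable_multiD (hh _).1 j _)) ((hm _).neg.add (hm _)) hq).trans ?_
    refine add_le_add le_rfl ?_
    refine (eLpNorm'_add_le (hm _).neg (hm _) hq).trans ?_
    rw [eLpNorm'_neg]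
    exact add_le_add (hdiff _) (hdiff _)
  -- The tail costs a small multiple of the w' norm of a difference, which is at most 2M; inside the
  -- ball the local Cauchy property applies.
  have hglob : ∀ j, mlen j ≤ l → Tendsto (fun n : ℕ × ℕ => wLp X q (w j) fun x =>
      weakD X j (u (σ n.1)) x - weakD X j (u (σ n.2)) x) atTop (𝓝 0) := by
    intro j hj
    rw [ENNReal.tendsto_nhds_zero]
    intro ε hε
    set T : ℝ≥0∞ := 2 * M + 1 with hT
    have hTt : T ≠ ⊤ := by rw [hT]; simpa using ENNReal.mul_ne_top (by simp) (by simp)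
    have hT0 : T ≠ 0 := by simp [hT]
    have hε' : 0 < ε / 2 / T := ENNReal.div_pos (ENNReal.half_pos hε.ne').ne' hTt
    obtain ⟨R, C, hC, H⟩ := hr.wLp_le hX.measurableSet (fun j hj => (hw' j hj).2) hb hq hε'
    have hlim := ENNReal.Tendsto.const_mul (hball R j hj) (Or.inr hC)
    rw [mul_zero] at hlim
    filter_upwards [hlim.eventually_lt_const (ENNReal.half_pos hε.ne')] with n hn
    have h2M : wLp X q (w' j) (fun x => weakD X j (u (σ n.1)) x - weakD X j (u (σ n.2)) x) ≤
        2 * M := by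
      refine (wLp_le_jetNorm hq w' (fun j x => weakD X j (u (σ n.1)) x - weakD X j (u (σ n.2)) x)
        hj).trans ((jetNorm_sub_le hq hwm' (hum _) (hum _)).trans ?_)
      exact (add_le_add (hu2 _) (hu2 _)).trans_eq (two_mul _).symm
    calc _ ≤ C * eLpNorm' (fun x => weakD X j (u (σ n.1)) x - weakD X j (u (σ n.2)) x) q
          (volume.restrict (X ∩ Metric.ball 0 R)) + ε / 2 / T * wLp X q (w' j)
          (fun x => weakD X j (u (σ n.1)) x - weakD X j (u (σ n.2)) x) := H j hj _
      _ ≤ ε / 2 + ε / 2 / T * T := by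
          gcongr
          exact h2M.trans le_self_add
      _ = ε := by rw [ENNReal.div_mul_cancel hT0 hTt, ENNReal.add_halves]
  obtain ⟨c, hc0, hcw⟩ := hA.1
  obtain ⟨v, hv1, hv2⟩ := exists_sobolev_limit hX hq (fun j hj => hw j (hj.trans hls)) hc0
    (fun j hj => hcw j (hj.trans hls)) (u := fun n => u (σ n))
    (fun n => hmem _ (hu _).1 (hu _).2.1) hglob
  exact ⟨σ, v, hσ, hv1, hv2⟩

end Compactness


/-! ### Reduction of the theorem to the embeddings above. -/

theorem mainTheorem7 (d : ℕ) (hd : 1 ≤ d) (X : Set (Euc d))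
    (hX : X = Set.univ ∨ (d = 1 ∧ X = {x : Euc d | ∀ k, 0 ≤ x k})) :
    (∀ (s l : ℕ) (p q : ℝ) (w w' : MIdx d → Euc d → ℝ), 1 ≤ p → 1 ≤ q →
      (∀ i, mlen i ≤ s → IsWeight X (w i)) → (∀ i, mlen i ≤ l → IsWeight X (w' i)) →
      LowerBddLocBdd X s w → RatioDecreasesToZero X l w w' →
      ((0 < (d : ℝ) - ((s : ℝ) - l) * p ∧ (d : ℝ) - ((s : ℝ) - l) * p < d ∧
          1 / p - (s : ℝ) / d < 1 / q - (l : ℝ) / d) ∨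
        (d : ℝ) = ((s : ℝ) - l) * p) →
      CompactlyEmbedsInter X s l p q w w') ∧
    (∀ (s r : ℕ) (p : ℝ) (w : MIdx d → Euc d → ℝ) (wc : Euc d → ℝ), 1 ≤ p →
      (∀ i, mlen i ≤ s → IsWeight X (w i)) → IsWeight X wc → BddOnBalls X wc →
      (∀ ρ : ℝ, 1 < ρ → AnnulusIntegralCond X s p ρ wc w →
        AnnulusIntegralCond X s p ρ (fun _ => 1) w → LocBddAndB X s ρ w →
        (∃ i, w i 0 = 0) → EmbedsInTarget X s r p (p * ρ) w wc) ∧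
      (LowerBddLocBdd X s w → AnnulusSupCond X s p wc w →
        AnnulusSupCond X s p (fun _ => 1) w → EmbedsInTarget X s r p p w wc)) := by
  have hXd : IsModelDomain X := hX.imp id And.right
  have hd0 : (0 : ℝ) < d := by exact_mod_cast hd
  refine ⟨fun s l p q w w' hp hq hw hw' hA hr hcase => ?_,
    fun s r p w wc hp hw _ hwc => ⟨fun ρ hρ h1 h2 h3 _ =>
      embedsInTarget_of_integralCond hXd hd hp hρ hw hwc h1 h2 h3, fun hA1 h1 h2 =>
      embedsInTarget_of_supCond hXd hd hp hw hwc hA1 h1 h2⟩⟩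
  have hp0 : 0 < p := by linarith
  have hq0 : 0 < q := by linarith
  -- Either alternative forces s > l, so at least one derivative is available.
  have hpos : 0 < ((s : ℝ) - l) * p := by
    rcases hcase with ⟨_, h, _⟩ | h <;> linarith
  have hsl : (l : ℝ) < s := by
    have := (pos_iff_pos_of_mul_pos hpos).2 hp0
    linarith
  obtain ⟨k, hk⟩ := Nat.exists_eq_add_of_lt (show l < s by exact_mod_cast hsl)
  have hks : ((k + 1 : ℕ) : ℝ) = s - l := by rw [hk]; push_cast; ring
  refine hA.compactlyEmbedsInter hXd hd (k := k) hr hw hw' (by omega) hp hq ?_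
  rw [hks, sub_div]
  rcases hcase with ⟨_, _, h⟩ | h
  · linarith
  -- In the critical case 1/p = (s - l)/d exactly, and the term 1/q > 0 makes the required
  -- inequality strict for every finite q.
  · have h1 : 1 / p = (s : ℝ) / d - l / d := by
      rw [← sub_div]
      field_simp
      linarith
    have : 0 < 1 / q := by positivity
    linarith
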